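/- Let $n\ge 1$, let $(V,Q)$ be a complex vector space of dimension $2n$ with a nondegenerate quadratic form, and let $C(V)$ be its Clifford algebra ($v^2=Q(v)$ for $v\in V$), with the anti-automorphism $(x_1\cdots x_r)^\star=(-1)^r x_r\cdots x_1$ for $x_i\in V$. Let $K=SO(V)$ and $\widetilde K=Spin(V)=\{x\in C(V)^{even} : x x^\star=1,\ xVx^\star\subset V\}$, with double covering $\rho:\widetilde K\to K$, $\rho(x)v=xvx^\star$. Let $e\in\mathfrak{so}(V)$ be nilpotent with orbit $\mathcal O=K\cdot e$, and let $r_j$ be the number of Jordan blocks of $e$ of size $j$. Let $C_K(e)$ be the centralizer of $e$ in $K$, let $C_{\widetilde K}(e)=\rho^{-1}(C_K(e))$ be its centralizer in $\widetilde K$, and put $A_K(\mathcal O)=C_K(e)/C_K(e)^0$ and $A_{\widetilde K}(\mathcal O)=C_{\widetilde K}(e)/C_{\widetilde K}(e)^0$, where $^0$ denotes the identity component. Let $m$ be the number of distinct odd $j$ with $r_j>0$. Then $$A_K(\mathcal O)\cong\begin{cases}\mathbb Z_2^{\,m-1}&\text{if } m>0,\\ 1&\text{if } m=0.\end{cases}$$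 Furthermore: (1) If $r_{2k+1}>1$ for some $k\ge 0$, then $\rho$ induces an isomorphism $A_{\widetilde K}(\mathcal O)\cong A_K(\mathcal O)$. (2) If $r_{2k+1}\le 1$ for all $k\ge 0$, then there is an exact sequence $$1\longrightarrow\{\pm I\}\longrightarrow A_{\widetilde K}(\mathcal O)\longrightarrow A_K(\mathcal O)\longrightarrow 1,$$ in which the first map sends $\pm I\in C_{\widetilde K}(e)$ to its class and the second map is induced by $\rho$. -/

import Mathlib

namespace SpinOrbit

open Module CliffordAlgebra

universe u

section ComponentGroup

variable (G : Type u) [Group G] [TopologicalSpace G] [SeparatelyContinuousMul G]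

/-- The identity component `G⁰`: the connected component of `1`, as a subgroup.  (Continuity of
left and right translations suffices for it to be a normal subgroup.) -/
def identityComponent : Subgroup G where
  carrier := connectedComponent (1 : G)
  one_mem' := mem_connectedComponent
  mul_mem' {a b} ha hb := by
    have h := (continuous_const_mul a).image_connectedComponent_subset 1 ⟨b, hb, rfl⟩
    rw [mul_one, ← connectedComponent_eq ha] at h
    exact h
  inv_mem' {a} ha := by
    have h := (continuous_const_mul a⁻¹).image_connectedComponent_subset a
      ⟨1, by rw [← connectedComponent_eq ha]; exact mem_connectedComponent, rfl⟩
    simp only [inv_mul_cancel, mul_one] at h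
    exact h

instance identityComponent_normal : (identityComponent G).Normal where
  conj_mem a ha g := by
    have hc : Continuous fun x : G => g * x * g⁻¹ :=
      (continuous_mul_const g⁻¹).comp (continuous_const_mul g)
    have h := hc.image_connectedComponent_subset 1 ⟨a, ha, rfl⟩
    simp only [mul_one, mul_inv_cancel] at h
    exact h

/-- The component group `G / G⁰`. -/
abbrev ComponentGroup : Type u := G ⧸ identityComponent G

variable {G}

/-- The class `[x]` of `x` in the component group `G / G⁰`. -/
abbrev componentClass (x : G) : ComponentGroup G := QuotientGroup.mk x

end ComponentGroup

instance subgroup_separatelyContinuousMul {G : Type u} [Group G] [TopologicalSpace G]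
    [SeparatelyContinuousMul G] (H : Subgroup G) : SeparatelyContinuousMul H where
  continuous_const_mul {a} :=
    ((continuous_const_mul (a : G)).comp continuous_subtype_val).subtype_mk _
  continuous_mul_const {a} :=
    ((continuous_mul_const (a : G)).comp continuous_subtype_val).subtype_mk _

variable {V : Type u} [AddCommGroup V] [Module ℂ V]

section JordanBlocks

/-- The number `r_j` of Jordan blocks of size `j` of a nilpotent endomorphism `e`, namely
`dim (ker e ∩ im e^(j-1)) - dim (ker e ∩ im e^j)`.  See `blockCount_eq_card` for the
comparison with an explicit Jordan basis. -/
noncomputable def blockCount (e : End ℂ V) (j : ℕ) : ℕ :=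
  finrank ℂ ↥(LinearMap.ker e ⊓ LinearMap.range (e ^ (j - 1))) -
    finrank ℂ ↥(LinearMap.ker e ⊓ LinearMap.range (e ^ j))

/-- The number `m` of distinct odd block sizes. -/
noncomputable def numOddSizes (e : End ℂ V) : ℕ :=
  Set.ncard {j : ℕ | Odd j ∧ 0 < blockCount e j}

theorem pow_shift {I : Type*} {d : I → ℕ} (b : Basis (Σ i, Fin (d i)) ℂ V) (e : End ℂ V)
    (he : ∀ i (k : Fin (d i)),
      e (b ⟨i, k⟩) = if h : (k : ℕ) + 1 < d i then b ⟨i, ⟨k + 1, h⟩⟩ else 0) (a : ℕ) :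
    ∀ i (k : Fin (d i)),
      (e ^ a) (b ⟨i, k⟩) = if h : (k : ℕ) + a < d i then b ⟨i, ⟨k + a, h⟩⟩ else 0 := by
  induction a with
  | zero => intro i k; simp
  | succ a ih =>
    intro i k
    rw [pow_succ', Module.End.mul_apply, ih]
    split_ifs with h1 h2 h2
    · rw [he, dif_pos (by simpa [add_assoc] using h2)]
      simp [add_assoc]
    · rw [he, dif_neg (by simpa [add_assoc] using h2)]
    · omega
    · simp

theorem finrank_ker_inf_range {I : Type*} [Fintype I] {d : I → ℕ}
    (b : Basis (Σ i, Fin (d i)) ℂ V) (e : End ℂ V)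
    (he : ∀ i (k : Fin (d i)),
      e (b ⟨i, k⟩) = if h : (k : ℕ) + 1 < d i then b ⟨i, ⟨k + 1, h⟩⟩ else 0) (a : ℕ) :
    finrank ℂ ↥(LinearMap.ker e ⊓ LinearMap.range (e ^ a)) =
      Fintype.card {i // a < d i} := by
  classical
  let f : {i // a < d i} → Σ i, Fin (d i) := fun i => ⟨i, ⟨d i - 1, by have := i.2; omega⟩⟩
  have hf : Function.Injective f := by
    intro i j hij
    have := congrArg Sigma.fst hij
    exact Subtype.ext this
  have hspan : LinearMap.ker e ⊓ LinearMap.range (e ^ a) =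
      Submodule.span ℂ (Set.range (b ∘ f)) := by
    apply le_antisymm
    · rintro x ⟨hx1, ⟨y, rfl⟩⟩
      rw [SetLike.mem_coe, LinearMap.mem_ker] at hx1
      set x := (e ^ a) y with hx
      have hlow : ∀ i (k : Fin (d i)), (k : ℕ) < a → b.repr x ⟨i, k⟩ = 0 := by
        intro i k hk
        have : b.coord ⟨i, k⟩ ∘ₗ (e ^ a) = 0 := by
          apply b.ext
          rintro ⟨i', k'⟩
          rw [LinearMap.comp_apply, pow_shift b e he]
          split_ifs with h
          · rw [Basis.coord_apply, Basis.repr_self, LinearMap.zero_apply,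
              Finsupp.single_apply, if_neg]
            intro hh
            obtain ⟨rfl, hh⟩ := Sigma.mk.inj hh
            have := congrArg Fin.val (eq_of_heq hh)
            simp at this
            omega
          · simp
        exact LinearMap.congr_fun this y
      have hhigh : ∀ i (k : Fin (d i)), (k : ℕ) + 1 < d i → b.repr x ⟨i, k⟩ = 0 := by
        intro i k hk
        have : b.coord ⟨i, ⟨k + 1, hk⟩⟩ ∘ₗ e = b.coord ⟨i, k⟩ := by
          apply b.ext
          rintro ⟨i', k'⟩
          rw [LinearMap.comp_apply, he]
          simp only [Basis.coord_apply, Basis.repr_self]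
          by_cases hi : i' = i
          · subst hi
            split_ifs with h1
            · by_cases h2 : (k' : ℕ) = k
              · obtain rfl : k' = k := Fin.ext h2
                simp
              · simp [Fin.ext_iff, h2]
            · have h2 : (k' : ℕ) ≠ k := by omega
              simp [Fin.ext_iff, h2]
          · split_ifs with h1
            · simp [hi]
            · simp [hi]
        have h2 := LinearMap.congr_fun this x
        rw [LinearMap.comp_apply, hx1, map_zero] at h2
        exact h2.symm
      rw [← b.sum_repr x]
      refine Submodule.sum_mem _ fun s _ => ?_
      obtain ⟨i, k⟩ := s
      by_cases h1 : (k : ℕ) < a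
      · simp [hlow i k h1]
      by_cases h2 : (k : ℕ) + 1 < d i
      · simp [hhigh i k h2]
      refine Submodule.smul_mem _ _ (Submodule.subset_span ⟨⟨i, by have := k.2; omega⟩, ?_⟩)
      have : (⟨d i - 1, by have := k.2; omega⟩ : Fin (d i)) = k := by
        apply Fin.ext
        have := k.2
        simp
        omega
      simp [f, this]
    · rw [Submodule.span_le]
      rintro _ ⟨⟨i, hi⟩, rfl⟩
      refine ⟨?_, ?_⟩
      · rw [SetLike.mem_coe, LinearMap.mem_ker, Function.comp_apply, he, dif_neg]
        simp
        omega
      · refine ⟨b ⟨i, ⟨d i - 1 - a, by omega⟩⟩, ?_⟩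
        rw [pow_shift b e he, dif_pos (by simp; omega)]
        simp only [Function.comp_apply, f]
        congr 2
        apply Fin.ext
        simp
        omega
  rw [hspan, finrank_span_eq_card]
  exact b.linearIndependent.comp f hf

/-- If `e` has a Jordan basis consisting of chains
`b ⟨i, 0⟩ → b ⟨i, 1⟩ → ⋯ → b ⟨i, d i - 1⟩ → 0`, then `blockCount e j` is the number of chains
of length `j`. -/
theorem blockCount_eq_card {I : Type*} [Fintype I] {d : I → ℕ}
    (b : Basis (Σ i, Fin (d i)) ℂ V) (e : End ℂ V)
    (he : ∀ i (k : Fin (d i)),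
      e (b ⟨i, k⟩) = if h : (k : ℕ) + 1 < d i then b ⟨i, ⟨k + 1, h⟩⟩ else 0)
    {j : ℕ} (hj : 0 < j) :
    blockCount e j = Fintype.card {i // d i = j} := by
  classical
  rw [blockCount, finrank_ker_inf_range b e he, finrank_ker_inf_range b e he]
  simp only [Fintype.card_subtype]
  have : (Finset.univ.filter fun i => j - 1 < d i) =
      (Finset.univ.filter fun i => d i = j) ∪ (Finset.univ.filter fun i => j < d i) := by
    ext i
    simp
    omega
  rw [this, Finset.card_union_of_disjoint, Nat.add_sub_cancel]
  rw [Finset.disjoint_filter]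
  intro i _ h
  omega

end JordanBlocks

variable (Q : QuadraticForm ℂ V)

/-- `so(V)`: the endomorphisms that are skew for the bilinear form attached to `Q`. -/
noncomputable abbrev soAlgebra : Submodule ℂ (End ℂ V) :=
  LinearMap.skewAdjointSubmodule (QuadraticMap.polarBilin Q)

/-- `SO(V)`: the linear automorphisms of determinant `1` preserving `Q`. -/
def SO : Subgroup (V ≃ₗ[ℂ] V) where
  carrier := {g | (∀ v, Q (g v) = Q v) ∧ LinearMap.det (g : V →ₗ[ℂ] V) = 1}
  one_mem' := ⟨fun _ => rfl, LinearMap.det_id⟩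
  mul_mem' {a b} ha hb := by
    refine ⟨fun v => ?_, ?_⟩
    · rw [LinearEquiv.mul_apply, ha.1, hb.1]
    · have : ((a * b : V ≃ₗ[ℂ] V) : V →ₗ[ℂ] V) = (a : V →ₗ[ℂ] V) * (b : V →ₗ[ℂ] V) := rfl
      rw [this, map_mul, ha.2, hb.2, one_mul]
  inv_mem' {a} ha := by
    have hinv : ∀ v, a (a⁻¹ v) = v := fun v => LinearEquiv.apply_symm_apply a v
    refine ⟨fun v => ?_, ?_⟩
    · rw [← ha.1, hinv]
    · have h : (a : V →ₗ[ℂ] V) * ((a⁻¹ : V ≃ₗ[ℂ] V) : V →ₗ[ℂ] V) = 1 :=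
        LinearMap.ext hinv
      have h2 := congrArg LinearMap.det h
      rwa [map_mul, ha.2, one_mul, map_one] at h2

/-- `SO(V)` has the topology induced from the canonical topology of the complex vector space
`End(V)`. -/
noncomputable instance : TopologicalSpace (SO Q) :=
  TopologicalSpace.induced (fun g => ((g : V ≃ₗ[ℂ] V) : V →ₗ[ℂ] V)) (moduleTopology ℂ (End ℂ V))

/-- `Spin(V)` has the topology induced from the canonical topology of the complex vector space
`C(V)`. -/
noncomputable instance : TopologicalSpace (spinGroup Q) :=
  TopologicalSpace.induced Subtype.val (moduleTopology ℂ (CliffordAlgebra Q))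

theorem continuous_moduleTopology {A : Type u} [AddCommGroup A] [Module ℂ A] (f : A →ₗ[ℂ] A) :
    @Continuous A A (moduleTopology ℂ A) (moduleTopology ℂ A) f := by
  let _ : TopologicalSpace A := moduleTopology ℂ A
  have : IsModuleTopology ℂ A := ⟨rfl⟩
  have := IsModuleTopology.toContinuousAdd ℂ A
  exact IsModuleTopology.continuous_of_linearMap f

instance : SeparatelyContinuousMul (SO Q) where
  continuous_const_mul {a} := by
    let _ : TopologicalSpace (End ℂ V) := moduleTopology ℂ (End ℂ V)
    exact continuous_induced_rng.2 ((continuous_moduleTopology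
      (LinearMap.mulLeft ℂ (((a : V ≃ₗ[ℂ] V) : V →ₗ[ℂ] V) : End ℂ V))).comp
        continuous_induced_dom)
  continuous_mul_const {a} := by
    let _ : TopologicalSpace (End ℂ V) := moduleTopology ℂ (End ℂ V)
    exact continuous_induced_rng.2 ((continuous_moduleTopology
      (LinearMap.mulRight ℂ (((a : V ≃ₗ[ℂ] V) : V →ₗ[ℂ] V) : End ℂ V))).comp
        continuous_induced_dom)

instance : SeparatelyContinuousMul (spinGroup Q) where
  continuous_const_mul {a} := by
    let _ : TopologicalSpace (CliffordAlgebra Q) := moduleTopology ℂ (CliffordAlgebra Q)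
    exact continuous_induced_rng.2 ((continuous_moduleTopology
      (LinearMap.mulLeft ℂ (a : CliffordAlgebra Q))).comp continuous_induced_dom)
  continuous_mul_const {a} := by
    let _ : TopologicalSpace (CliffordAlgebra Q) := moduleTopology ℂ (CliffordAlgebra Q)
    exact continuous_induced_rng.2 ((continuous_moduleTopology
      (LinearMap.mulRight ℂ (a : CliffordAlgebra Q))).comp continuous_induced_dom)

section Covering

theorem cliffordι_injective : Function.Injective (ι Q) := by
  intro v w h
  have h2 := congrArg (equivExterior Q) h
  simp only [equivExterior, changeFormEquiv_apply, changeForm_ι] at h2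
  exact ExteriorAlgebra.ι_leftInverse.injective h2

/-- The linear map `v ↦ x v x*` on `V`, for `x` in the Clifford algebra preserving `V`
(elsewhere it is a projection of `x v x*` to `V`). -/
noncomputable def vectorAction (x : CliffordAlgebra Q) : V →ₗ[ℂ] V :=
  ExteriorAlgebra.ιInv ∘ₗ (equivExterior Q).toLinearMap ∘ₗ
    LinearMap.mulLeft ℂ x ∘ₗ LinearMap.mulRight ℂ (star x) ∘ₗ ι Q

theorem vectorAction_of_eq {x : CliffordAlgebra Q} {v w : V} (h : x * ι Q v * star x = ι Q w) :
    vectorAction Q x v = w := by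
  have : vectorAction Q x v = ExteriorAlgebra.ιInv (equivExterior Q (x * ι Q v * star x)) := by
    simp [vectorAction, mul_assoc]
  rw [this, h]
  simp only [equivExterior, changeFormEquiv_apply, changeForm_ι]
  exact ExteriorAlgebra.ι_leftInverse w

/-- Elements of the Lipschitz group are homogeneous and act on `V` by isometries of determinant
`±1` according to their parity. -/
theorem lipschitz_action [FiniteDimensional ℂ V] {u : (CliffordAlgebra Q)ˣ}
    (hu : u ∈ lipschitzGroup Q) :
    ∃ (k : ℤˣ) (τ : V →ₗ[ℂ] V),
      involute (u : CliffordAlgebra Q) = (k : ℤ) • (u : CliffordAlgebra Q) ∧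
      (∀ v, involute (u : CliffordAlgebra Q) * ι Q v * (↑u⁻¹ : CliffordAlgebra Q) = ι Q (τ v)) ∧
      (∀ v, Q (τ v) = Q v) ∧ LinearMap.det τ = ((k : ℤ) : ℂ) := by
  have key : ∀ a : V, Q a ≠ 0 → ∃ τ : V →ₗ[ℂ] V,
      (∀ v, τ v = v - ((Q a)⁻¹ * QuadraticMap.polar Q a v) • a) ∧
      (∀ v, Q (τ v) = Q v) ∧ LinearMap.det τ = -1 := by
    intro a ha
    refine ⟨LinearMap.transvection (-((Q a)⁻¹ • QuadraticMap.polarBilin Q a)) a, ?_, ?_, ?_⟩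
    · intro v
      simp [LinearMap.transvection.apply, sub_eq_add_neg]
    · intro v
      have h1 : LinearMap.transvection (-((Q a)⁻¹ • QuadraticMap.polarBilin Q a)) a v =
          v + (-((Q a)⁻¹ * QuadraticMap.polar Q a v)) • a := by
        simp [LinearMap.transvection.apply]
      rw [h1, QuadraticMap.map_add Q, QuadraticMap.map_smul, QuadraticMap.polar_smul_right,
        QuadraticMap.polar_comm Q v a]
      simp only [smul_eq_mul]
      field_simp
      ring
    · rw [LinearMap.transvection.det]
      simp only [LinearMap.neg_apply, LinearMap.smul_apply, QuadraticMap.polarBilin_apply_apply,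
        QuadraticMap.polar_self, smul_eq_mul]
      field_simp
      ring
  unfold lipschitzGroup at hu
  induction hu using Subgroup.closure_induction'' with
  | mem x hx =>
    obtain ⟨a, ha⟩ := hx
    let := x.invertible
    let : Invertible (ι Q a) := by rwa [ha]
    let : Invertible (Q a) := invertibleOfInvertibleι Q a
    obtain ⟨τ, h1, h2, h3⟩ := key a (Invertible.ne_zero (Q a))
    refine ⟨-1, τ, ?_, ?_, h2, ?_⟩
    · simp [← ha]
    · intro v
      simp_rw [← invOf_units x, ← ha, involute_ι, neg_mul, ι_mul_ι_mul_invOf_ι Q a v, ← map_neg,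
        h1, invOf_eq_inv, neg_sub]
    · simp [h3]
  | inv_mem x hx =>
    obtain ⟨a, ha⟩ := hx
    let := x.invertible
    let : Invertible (ι Q a) := by rwa [ha]
    let : Invertible (Q a) := invertibleOfInvertibleι Q a
    let := invertibleNeg (ι Q a)
    let := Invertible.map involute (ι Q a)
    obtain ⟨τ, h1, h2, h3⟩ := key a (Invertible.ne_zero (Q a))
    refine ⟨-1, τ, ?_, ?_, h2, ?_⟩
    · simp_rw [← invOf_units x, ← ha, map_invOf, involute_ι, invOf_neg]
      simp
    · intro v
      simp_rw [inv_inv, ← invOf_units x, ← ha, map_invOf, involute_ι, invOf_neg, neg_mul,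
        invOf_ι_mul_ι_mul_ι, ← map_neg, h1, invOf_eq_inv, neg_sub]
    · simp [h3]
  | one => exact ⟨1, LinearMap.id, by simp, by simp, by simp, by simp⟩
  | mul y z _ _ hy hz =>
    obtain ⟨k, τ, h1, h2, h3, h4⟩ := hy
    obtain ⟨k', τ', h1', h2', h3', h4'⟩ := hz
    refine ⟨k * k', τ ∘ₗ τ', ?_, ?_, ?_, ?_⟩
    · rw [Units.val_mul, map_mul, h1, h1', smul_mul_smul_comm, Units.val_mul]
    · intro v
      have : involute ((y * z : (CliffordAlgebra Q)ˣ) : CliffordAlgebra Q) * ι Q v *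
          (↑(y * z)⁻¹ : CliffordAlgebra Q) = involute (y : CliffordAlgebra Q) *
          (involute (z : CliffordAlgebra Q) * ι Q v * (↑z⁻¹ : CliffordAlgebra Q)) *
          (↑y⁻¹ : CliffordAlgebra Q) := by
        simp only [Units.val_mul, map_mul, mul_inv_rev, mul_assoc]
      rw [this, h2', h2, LinearMap.comp_apply]
    · intro v
      rw [LinearMap.comp_apply, h3, h3']
    · rw [LinearMap.det_comp, h4, h4']
      push_cast
      ring

theorem spin_action [FiniteDimensional ℂ V] (x : spinGroup Q) :
    (∀ v, (x : CliffordAlgebra Q) * ι Q v * star (x : CliffordAlgebra Q) =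
      ι Q (vectorAction Q x v)) ∧
    (∀ v, Q (vectorAction Q x v) = Q v) ∧ LinearMap.det (vectorAction Q x) = 1 := by
  obtain ⟨k, τ, h1, h2, h3, h4⟩ := lipschitz_action Q
    (spinGroup.units_mem_lipschitzGroup (x := spinGroup.toUnits x) x.2)
  have hx : involute (x : CliffordAlgebra Q) = x := spinGroup.involute_eq x.2
  have hinv : (↑(spinGroup.toUnits x)⁻¹ : CliffordAlgebra Q) = star (x : CliffordAlgebra Q) := rfl
  have hval : (↑(spinGroup.toUnits x) : CliffordAlgebra Q) = x := rfl
  rw [hval] at h1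
  simp only [hval, hinv, hx] at h2
  have hτ : vectorAction Q x = τ := LinearMap.ext fun v => vectorAction_of_eq Q (h2 v)
  rw [hτ]
  refine ⟨h2, h3, ?_⟩
  rcases Int.units_eq_one_or k with rfl | rfl
  · simpa using h4
  · exfalso
    rw [hx] at h1
    have h5 : (x : CliffordAlgebra Q) = -x := by simpa using h1
    have h6 : (2 : ℂ) • (x : CliffordAlgebra Q) = 0 := by
      rw [two_smul]
      nth_rewrite 1 [h5]
      simp
    have h7 : (x : CliffordAlgebra Q) = 0 := (smul_eq_zero.1 h6).resolve_left two_ne_zero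
    have h8 := spinGroup.star_mul_self_of_mem x.2
    rw [h7, mul_zero] at h8
    exact zero_ne_one h8

theorem vectorAction_mul [FiniteDimensional ℂ V] (x y : spinGroup Q) (v : V) :
    vectorAction Q ↑(x * y) v = vectorAction Q x (vectorAction Q y v) := by
  apply vectorAction_of_eq
  rw [← (spin_action Q x).1, ← (spin_action Q y).1]
  simp [mul_assoc]

theorem vectorAction_one (v : V) : vectorAction Q ((1 : spinGroup Q) : CliffordAlgebra Q) v = v :=
  vectorAction_of_eq Q (by simp)

theorem vectorAction_comp [FiniteDimensional ℂ V] {x y : spinGroup Q} (h : x * y = 1) :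
    vectorAction Q x ∘ₗ vectorAction Q y = LinearMap.id :=
  LinearMap.ext fun v => by
    rw [LinearMap.comp_apply, ← vectorAction_mul, h, vectorAction_one, LinearMap.id_apply]

/-- The element `v ↦ x v x*` of `SO(V)`. -/
noncomputable def coveringFun [FiniteDimensional ℂ V] (x : spinGroup Q) : SO Q :=
  ⟨LinearEquiv.ofLinearMap (vectorAction Q x) (vectorAction Q ↑(x⁻¹))
      (vectorAction_comp Q (mul_inv_cancel x)) (vectorAction_comp Q (inv_mul_cancel x)),
    (spin_action Q x).2⟩

theorem coveringFun_apply [FiniteDimensional ℂ V] (x : spinGroup Q) (v : V) :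
    (coveringFun Q x : V ≃ₗ[ℂ] V) v = vectorAction Q x v := rfl

/-- The covering homomorphism `ρ : Spin(V) → SO(V)`, `ρ(x) v = x v x*`. -/
noncomputable def covering [FiniteDimensional ℂ V] : spinGroup Q →* SO Q :=
  MonoidHom.mk' (coveringFun Q) fun x y => Subtype.ext <| LinearEquiv.ext fun v => by
    rw [Subgroup.coe_mul, LinearEquiv.mul_apply]
    simp only [coveringFun_apply]
    exact vectorAction_mul Q x y v

/-- The defining property of `ρ`, inside the Clifford algebra. -/
theorem ι_covering [FiniteDimensional ℂ V] (x : spinGroup Q) (v : V) :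
    ι Q ((covering Q x : V ≃ₗ[ℂ] V) v) =
      (x : CliffordAlgebra Q) * ι Q v * star (x : CliffordAlgebra Q) :=
  ((spin_action Q x).1 v).symm

end Covering

section Centralizers

variable (e : End ℂ V)

/-- `C_K(e)` for `K = SO(V)`: the elements `g` with `g e g⁻¹ = e`. -/
def centralizerSO : Subgroup (SO Q) where
  carrier := {g | ∀ v, (g : V ≃ₗ[ℂ] V) (e v) = e ((g : V ≃ₗ[ℂ] V) v)}
  one_mem' _ := rfl
  mul_mem' {a b} ha hb v := by
    change (a : V ≃ₗ[ℂ] V) ((b : V ≃ₗ[ℂ] V) (e v)) = e ((a : V ≃ₗ[ℂ] V) ((b : V ≃ₗ[ℂ] V) v))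
    rw [hb v, ha]
  inv_mem' {a} ha v := by
    change (a : V ≃ₗ[ℂ] V).symm (e v) = e ((a : V ≃ₗ[ℂ] V).symm v)
    rw [LinearEquiv.symm_apply_eq, ha, LinearEquiv.apply_symm_apply]

variable [FiniteDimensional ℂ V]

/-- `C_K̃(e)` for `K̃ = Spin(V)`, which acts on `so(V)` through `ρ`. -/
noncomputable def centralizerSpin : Subgroup (spinGroup Q) :=
  (centralizerSO Q e).comap (covering Q)

/-- The restriction `C_K̃(e) → C_K(e)` of the covering `ρ`. -/
noncomputable def coveringCentralizer : centralizerSpin Q e →* centralizerSO Q e :=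
  (covering Q).subgroupComap (centralizerSO Q e)

/-- `A_K(O)` for the orbit `O` of `e` and `K = SO(V)`. -/
abbrev componentGroupSO : Type u := ComponentGroup (centralizerSO Q e)

/-- `A_K̃(O)` for the orbit `O` of `e` and `K̃ = Spin(V)`. -/
abbrev componentGroupSpin : Type u := ComponentGroup (centralizerSpin Q e)

end Centralizers

end SpinOrbit

namespace SpinOrbit

open Module Filter Topology CliffordAlgebra

universe u

set_option linter.unusedSectionVars false

/-! ### Determinants on invariant subspaces and of isometries of bilinear forms -/

section DetOn

variable {V : Type*} [AddCommGroup V] [Module ℂ V]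

/-! Write `B` for the polar form of `Q`. On `ker e ∩ im e^b` the rule `(x, e^b z) ↦ B x z` is a
well-defined form with radical `ker e ∩ im e^(b+1)`, symmetric for even `b` and alternating for odd
`b`. An isometry `g` commuting with `e` thus acts orthogonally or symplectically on the successive
quotients, whose dimensions are the multiplicities `r_(b+1)`, and the numbers `d_b(g) = det(g | ker
e ∩ im e^b)` are signs. The jump `d_b d_(b+1)` is trivial for odd `b`. For even `b` with `r_(b+1) >
0` it takes both values, independently for different `b`, through reflections in nondegenerate
cyclic subspaces. The determinant of `g` is the product of all `d_b`; this collapses to `d_0`, the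
product of the jumps.

The `d_b` are continuous, hence constant on components. Conversely, if all `d_b(g)` are `1`, then
`g` is a product of isometries commuting with `e` and without eigenvalue `-1` (`reflection_mem`,
`mem_cayleyMonoid_iff`), and the Cayley transform joins each of these to `1`. So `A_K(O)` is the
group of sign vectors indexed by the `m` odd block sizes with product `1`.

For Spin, the covering is open and surjective with kernel `{1, -1}`, so the question is whether `-1`
lies in the identity component of the centralizer. If an odd size `a + 1` occurs twice, there are
two isotropic Jordan chains of that length in duality. The torus scaling one by `z^2` and the other
by `z^(-2)` lifts to Spin, with value `(-1)^(a+1) = -1` at `z = -1`.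

If every odd size occurs at most once, let `L` be the sum of all `ker e^k ∩ im e^k`. It is
isotropic, and `L^⊥/L` is made of one line for each odd size, on which the identity component of
`C_K(e)` acts trivially (`IsCayley.sub_mem_coreSum`). Hence this component preserves any Lagrangian
`M` containing `L`, with determinant `det(g | M) = det(g | L) = 1`. Let `ω` be the product in `C(V)`
of a basis of `M`. An element `x` of Spin over the component satisfies `x ω = ω` or `x ω = -ω`
(`spin_mul_vacuum`). This sign is continuous and changes when `x` is replaced by `-x`, so it
separates `1` from `-1` and splits the covering over the component
(`mem_identityComponent_of_sign`). -/

theorem det_eq_of_exact {A B C : Type*} [AddCommGroup A] [Module ℂ A] [AddCommGroup B]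
    [Module ℂ B] [AddCommGroup C] [Module ℂ C] [FiniteDimensional ℂ B]
    (i : A →ₗ[ℂ] B) (q : B →ₗ[ℂ] C) (hi : Function.Injective i) (hq : Function.Surjective q)
    (hiq : LinearMap.range i = LinearMap.ker q) {f : End ℂ A} {g : End ℂ B} {h : End ℂ C}
    (hf : ∀ x, g (i x) = i (f x)) (hh : ∀ x, h (q x) = q (g x)) :
    LinearMap.det g = LinearMap.det f * LinearMap.det h := by
  have hle : LinearMap.ker q ≤ (LinearMap.ker q).comap g := by
    intro x hx
    simp only [Submodule.mem_comap, LinearMap.mem_ker] at hx ⊢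
    rw [← hh, hx, map_zero]
  rw [LinearMap.det_eq_det_mul_det (LinearMap.ker q) g hle]
  let e₁ : A ≃ₗ[ℂ] LinearMap.ker q :=
    (LinearEquiv.ofInjective i hi).trans (LinearEquiv.ofEq _ _ hiq)
  let e₂ : (B ⧸ LinearMap.ker q) ≃ₗ[ℂ] C := q.quotKerEquivOfSurjective hq
  congr 1
  · rw [← LinearMap.det_conj f e₁]
    congr 1
    ext x
    obtain ⟨y, rfl⟩ := e₁.surjective x
    simp only [LinearMap.comp_apply, LinearEquiv.coe_coe, LinearEquiv.symm_apply_apply]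
    exact hf y
  · rw [← LinearMap.det_conj _ e₂]
    congr 1
    ext x
    obtain ⟨y, rfl⟩ := hq x
    have h1 : e₂.symm (q y) = Submodule.Quotient.mk y := by
      rw [LinearEquiv.symm_apply_eq]; rfl
    simp only [LinearMap.comp_apply, LinearEquiv.coe_coe, h1]
    exact (hh y).symm

open Classical in
/-- The determinant of the restriction of `T` to an invariant subspace. -/
noncomputable def detOn (T : End ℂ V) (p : Submodule ℂ V) : ℂ :=
  if h : ∀ x ∈ p, T x ∈ p then LinearMap.det (T.restrict h) else 1

variable {T S : End ℂ V} {p q : Submodule ℂ V}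

theorem detOn_eq (h : ∀ x ∈ p, T x ∈ p) : detOn T p = LinearMap.det (T.restrict h) := dif_pos h

theorem detOn_mul (hT : ∀ x ∈ p, T x ∈ p) (hS : ∀ x ∈ p, S x ∈ p) :
    detOn (T * S) p = detOn T p * detOn S p := by
  rw [detOn_eq hT, detOn_eq hS, detOn_eq (T := T * S) (fun x hx => hT _ (hS x hx)), ← map_mul]
  rfl

theorem detOn_eq_one (h : ∀ x ∈ p, T x = x) : detOn T p = 1 := by
  rw [detOn_eq (fun x hx => by rwa [h x hx])]
  convert LinearMap.det_id using 2
  ext x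
  exact h x x.2

theorem detOn_bot : detOn T ⊥ = 1 := detOn_eq_one fun x hx => by simp_all

theorem detOn_top : detOn T ⊤ = LinearMap.det T := by
  rw [detOn_eq (fun x _ => Submodule.mem_top), ← LinearMap.det_conj _ Submodule.topEquiv]
  congr 1

variable [FiniteDimensional ℂ V]

/-- Equivariance of the exact sequence `0 → p ∩ ker φ → p → φ(p) → 0` under `T`. -/
theorem detOn_eq_mul_map (φ : End ℂ V) (hp : ∀ x ∈ p, T x ∈ p) (hφ : Commute T φ) :
    detOn T p = detOn T (p ⊓ LinearMap.ker φ) * detOn T (p.map φ) := by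
  have hc : ∀ x, T (φ x) = φ (T x) := fun x => LinearMap.congr_fun hφ x
  have h1 : ∀ x ∈ p ⊓ LinearMap.ker φ, T x ∈ p ⊓ LinearMap.ker φ := by
    rintro x ⟨hx, hx'⟩
    refine ⟨hp x hx, ?_⟩
    rw [SetLike.mem_coe, LinearMap.mem_ker] at hx' ⊢
    rw [← hc, hx', map_zero]
  have h2 : ∀ x ∈ p.map φ, T x ∈ p.map φ := by
    rintro _ ⟨x, hx, rfl⟩
    exact ⟨T x, hp x hx, (hc x).symm⟩
  rw [detOn_eq hp, detOn_eq h1, detOn_eq h2]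
  refine det_eq_of_exact (Submodule.inclusion inf_le_left) (φ.submoduleMap p)
    (Submodule.inclusion_injective _) (φ.submoduleMap_surjective p) ?_ (fun x => rfl) ?_
  · ext x
    simp only [LinearMap.mem_range, LinearMap.mem_ker]
    constructor
    · rintro ⟨y, rfl⟩
      exact Subtype.ext y.2.2
    · intro hx
      exact ⟨⟨x, x.2, congrArg Subtype.val hx⟩, rfl⟩
  · intro x
    exact Subtype.ext (hc x)

/-- Comes from the exact sequence `0 → p ∩ q → p × q → p + q → 0`, whose first map is `x ↦ (x, -x)`.
-/
theorem detOn_sup_mul_inf (hp : ∀ x ∈ p, T x ∈ p) (hq : ∀ x ∈ q, T x ∈ q) :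
    detOn T (p ⊔ q) * detOn T (p ⊓ q) = detOn T p * detOn T q := by
  have h1 : ∀ x ∈ p ⊓ q, T x ∈ p ⊓ q := fun x hx => ⟨hp x hx.1, hq x hx.2⟩
  have h2 : ∀ x ∈ p ⊔ q, T x ∈ p ⊔ q := by
    intro x hx
    obtain ⟨y, hy, z, hz, rfl⟩ := Submodule.mem_sup.1 hx
    rw [map_add]
    exact Submodule.add_mem_sup (hp y hy) (hq z hz)
  rw [detOn_eq hp, detOn_eq hq, detOn_eq h1, detOn_eq h2]
  have e1 : LinearMap.det ((T.restrict hp).prodMap (T.restrict hq)) =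
      LinearMap.det (T.restrict hp) * LinearMap.det (T.restrict hq) :=
    det_eq_of_exact (LinearMap.inl ℂ p q) (LinearMap.snd ℂ p q) LinearMap.inl_injective
      LinearMap.snd_surjective (LinearMap.range_inl _ _ _) (fun x => by simp) (fun x => rfl)
  rw [← e1, mul_comm]
  symm
  refine det_eq_of_exact
    ((Submodule.inclusion (inf_le_left : p ⊓ q ≤ p)).prod
      (-(Submodule.inclusion (inf_le_right : p ⊓ q ≤ q))))
    ((Submodule.inclusion (le_sup_left : p ≤ p ⊔ q)).coprod
      (Submodule.inclusion (le_sup_right : q ≤ p ⊔ q))) ?_ ?_ ?_ ?_ ?_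
  · intro x y hxy
    have := congrArg (fun z => (z.1 : V)) hxy
    exact Subtype.ext this
  · rintro ⟨x, hx⟩
    obtain ⟨y, hy, z, hz, rfl⟩ := Submodule.mem_sup.1 hx
    exact ⟨(⟨y, hy⟩, ⟨z, hz⟩), rfl⟩
  · ext ⟨x, y⟩
    simp only [LinearMap.mem_range, LinearMap.mem_ker]
    constructor
    · rintro ⟨z, hz⟩
      rw [← hz]
      exact Subtype.ext (by simp)
    · intro h
      have h' : (x : V) + y = 0 := congrArg Subtype.val h
      have hy : (y : V) = -x := eq_neg_of_add_eq_zero_right h'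
      refine ⟨⟨x, x.2, by simpa [hy] using q.neg_mem y.2⟩, ?_⟩
      refine Prod.ext (Subtype.ext rfl) (Subtype.ext ?_)
      simp [hy]
  · intro x
    refine Prod.ext (Subtype.ext rfl) (Subtype.ext ?_)
    simp
  · rintro ⟨x, y⟩
    refine Subtype.ext ?_
    simp

/-- With `k'` the adjoint of `k`, isometry means `k' k = 1`, so `k' (1 + k) = (1 + k)'`. An
endomorphism and its adjoint have equal determinants, and `det (1 + k)` cancels. No symmetry of `β`
enters, so the symmetric and alternating cases are covered together. -/
theorem det_eq_one_of_isometry (β : V →ₗ[ℂ] V →ₗ[ℂ] ℂ) (hβ : ∀ x, (∀ y, β x y = 0) → x = 0)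
    (k : End ℂ V) (hk : ∀ x y, β (k x) (k y) = β x y) (h1 : LinearMap.det (1 + k) ≠ 0) :
    LinearMap.det k = 1 := by
  have hinj : Function.Injective β := by
    rw [injective_iff_map_eq_zero]
    intro x hx
    exact hβ x fun y => by rw [hx]; rfl
  let E : V ≃ₗ[ℂ] Dual ℂ V := LinearEquiv.ofInjectiveOfFinrankEq β hinj
    (Subspace.dual_finrank_eq).symm
  have hE : ∀ x y, E x y = β x y := fun x y => rfl
  have key : ∀ f : End ℂ V, LinearMap.det (E.symm.toLinearMap ∘ₗ f.dualMap ∘ₗ E.toLinearMap) =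
      LinearMap.det f := by
    intro f
    have := LinearMap.det_conj f.dualMap E.symm
    rw [LinearMap.det_dualMap] at this
    exact this
  have h2 : (E.symm.toLinearMap ∘ₗ k.dualMap ∘ₗ E.toLinearMap) * (1 + k) =
      E.symm.toLinearMap ∘ₗ (1 + k).dualMap ∘ₗ E.toLinearMap := by
    ext x
    simp only [Module.End.mul_apply, LinearMap.comp_apply, LinearEquiv.coe_coe]
    congr 1
    ext y
    simp [hE, LinearMap.dualMap_apply, hk, add_comm]
  have h3 := congrArg LinearMap.det h2
  rw [map_mul, key, key] at h3
  exact mul_right_cancel₀ h1 (h3.trans (one_mul _).symm)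

/-- For an isometry `k` of a possibly degenerate form with `1 + k` invertible, the determinant of
`k` is that of its restriction to the radical. -/
theorem det_eq_det_radical (β : V →ₗ[ℂ] V →ₗ[ℂ] ℂ) (R : Submodule ℂ V)
    (hl : ∀ x, (∀ y, β x y = 0) → x ∈ R) (hR : ∀ x ∈ R, ∀ y, β x y = 0 ∧ β y x = 0)
    (k : End ℂ V) (hk : ∀ x y, β (k x) (k y) = β x y) (hkR : ∀ x ∈ R, k x ∈ R)
    (h1 : Function.Injective (1 + k : End ℂ V)) :
    LinearMap.det k = detOn k R := by
  rw [LinearMap.det_eq_det_mul_det R k hkR, detOn_eq hkR]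
  let β' : (V ⧸ R) →ₗ[ℂ] (V ⧸ R) →ₗ[ℂ] ℂ :=
    R.liftQ (LinearMap.flip (R.liftQ β.flip fun x hx => LinearMap.ext fun y => (hR x hx y).2))
      fun x hx => LinearMap.ext fun y => by
        obtain ⟨y, rfl⟩ := R.mkQ_surjective y
        exact (hR x hx y).1
  have hβ' : ∀ x y, β' (R.mkQ x) (R.mkQ y) = β x y := fun x y => rfl
  rw [det_eq_one_of_isometry β' ?_ (R.mapQ R k hkR) ?_ ?_, mul_one]
  · intro x hx
    obtain ⟨x, rfl⟩ := R.mkQ_surjective x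
    rw [Submodule.mkQ_apply, Submodule.Quotient.mk_eq_zero]
    exact hl x fun y => by rw [← hβ', hx]
  · intro x y
    obtain ⟨x, rfl⟩ := R.mkQ_surjective x
    obtain ⟨y, rfl⟩ := R.mkQ_surjective y
    exact hk x y
  · have h2 : Function.Surjective (1 + R.mapQ R k hkR : End ℂ (V ⧸ R)) := by
      intro x
      obtain ⟨x, rfl⟩ := R.mkQ_surjective x
      obtain ⟨y, rfl⟩ := LinearMap.injective_iff_surjective.1 h1 x
      exact ⟨R.mkQ y, by simp⟩
    exact (LinearMap.isUnit_iff_isUnit_det _).1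
      ((Module.End.isUnit_iff _).2 ⟨LinearMap.injective_iff_surjective.2 h2, h2⟩) |>.ne_zero

end DetOn

/-! ### The filtration of `ker e` by the images of powers of `e` -/

section Kernels

variable {V : Type*} [AddCommGroup V] [Module ℂ V]

/-- A nilpotent endomorphism `e` that is skew for a nondegenerate symmetric bilinear form `B`. -/
structure IsSkewNilpotent (B : V →ₗ[ℂ] V →ₗ[ℂ] ℂ) (e : End ℂ V) : Prop where
  symm : ∀ x y, B x y = B y x
  nondeg : ∀ x, (∀ y, B x y = 0) → x = 0
  skew : ∀ x y, B (e x) y = -B x (e y)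
  nil : IsNilpotent e

/-- `ker e ∩ im e^b`. -/
def kerRange (e : End ℂ V) (b : ℕ) : Submodule ℂ V := LinearMap.ker e ⊓ LinearMap.range (e ^ b)

/-- Isometries of `B` commuting with `e`. -/
structure IsCentIsometry (B : V →ₗ[ℂ] V →ₗ[ℂ] ℂ) (e k : End ℂ V) : Prop where
  isometry : ∀ x y, B (k x) (k y) = B x y
  comm : Commute k e

variable {B : V →ₗ[ℂ] V →ₗ[ℂ] ℂ} {e : End ℂ V}

theorem comm_apply {k : End ℂ V} (h : Commute k e) (x : V) : k (e x) = e (k x) :=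
  LinearMap.congr_fun h x

theorem comm_pow_apply {k : End ℂ V} (h : Commute k e) (i : ℕ) (x : V) :
    k ((e ^ i) x) = (e ^ i) (k x) :=
  LinearMap.congr_fun (h.pow_right i) x

theorem pow_add_apply (i j : ℕ) (x : V) : (e ^ i) ((e ^ j) x) = (e ^ (i + j)) x := by
  rw [pow_add, Module.End.mul_apply]

theorem pow_eq_zero_of_le {a i : ℕ} {x : V} (hx : (e ^ a) x = 0) (h : a ≤ i) : (e ^ i) x = 0 := by
  obtain ⟨j, rfl⟩ := Nat.exists_eq_add_of_le' h
  rw [← pow_add_apply, hx, map_zero]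

theorem kerRange_stable {k : End ℂ V} (h : Commute k e) (b : ℕ) :
    ∀ x ∈ kerRange e b, k x ∈ kerRange e b := by
  rintro x ⟨hx, ⟨y, rfl⟩⟩
  refine ⟨?_, ⟨k y, (comm_pow_apply h b y).symm⟩⟩
  rw [SetLike.mem_coe, LinearMap.mem_ker] at hx ⊢
  rw [← comm_apply h, hx, map_zero]

theorem ker_inf_range_stable {k : End ℂ V} (h : Commute k e) (b c : ℕ) :
    ∀ x ∈ LinearMap.ker (e ^ b) ⊓ LinearMap.range (e ^ c),
      k x ∈ LinearMap.ker (e ^ b) ⊓ LinearMap.range (e ^ c) := by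
  rintro x ⟨hx, ⟨y, rfl⟩⟩
  refine ⟨?_, ⟨k y, (comm_pow_apply h c y).symm⟩⟩
  rw [SetLike.mem_coe, LinearMap.mem_ker] at hx ⊢
  rw [← comm_pow_apply h, hx, map_zero]

namespace IsSkewNilpotent

variable (h : IsSkewNilpotent B e)
include h

theorem skew_pow (i : ℕ) (x y : V) : B ((e ^ i) x) y = (-1) ^ i * B x ((e ^ i) y) := by
  induction i generalizing x y with
  | zero => simp
  | succ i ih =>
    rw [pow_succ', Module.End.mul_apply, h.skew, ih, ← Module.End.mul_apply (e ^ i), ← pow_succ,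
      pow_succ']
    ring

theorem skew_pow' (i : ℕ) (x y : V) : B x ((e ^ i) y) = (-1) ^ i * B ((e ^ i) x) y := by
  rw [h.skew_pow, ← mul_assoc, ← mul_pow]
  simp

theorem pow_pow (i j : ℕ) (x y : V) :
    B ((e ^ i) x) ((e ^ j) y) = (-1) ^ j * B ((e ^ (i + j)) x) y := by
  rw [h.skew_pow', pow_add_apply, add_comm]

variable [FiniteDimensional ℂ V]

/-- Since `e^b` is self-adjoint up to sign, `ker e^b` is the orthogonal of `im e^b`; by
nondegeneracy the converse holds too. -/
theorem mem_range_pow_iff (b : ℕ) (x : V) :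
    x ∈ LinearMap.range (e ^ b) ↔ ∀ y ∈ LinearMap.ker (e ^ b), B x y = 0 := by
  have hrefl : LinearMap.BilinForm.IsRefl B := fun x y hxy => by rw [h.symm, hxy]
  have hnd : LinearMap.BilinForm.Nondegenerate B :=
    ⟨h.nondeg, fun x hx => h.nondeg x fun y => by rw [h.symm, hx]⟩
  have h1 : LinearMap.ker (e ^ b) = LinearMap.BilinForm.orthogonal B (LinearMap.range (e ^ b)) := by
    ext y
    rw [LinearMap.BilinForm.mem_orthogonal_iff]
    constructor
    · rintro hy _ ⟨z, rfl⟩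
      rw [LinearMap.mem_ker] at hy
      change B _ _ = 0
      rw [h.skew_pow, hy, map_zero, mul_zero]
    · intro hy
      refine h.nondeg _ fun z => ?_
      rw [h.symm, h.skew_pow', show B ((e ^ b) z) y = 0 from hy _ ⟨z, rfl⟩, mul_zero]
  rw [h1, ← LinearMap.BilinForm.orthogonal_orthogonal hnd hrefl (LinearMap.range (e ^ b)),
    LinearMap.BilinForm.mem_orthogonal_iff,
    LinearMap.BilinForm.orthogonal_orthogonal hnd hrefl (LinearMap.range (e ^ b))]
  refine forall₂_congr fun y _ => ?_
  change B y x = 0 ↔ _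
  rw [h.symm]

end IsSkewNilpotent

section Det

variable [FiniteDimensional ℂ V]

theorem detOn_restrict {T : End ℂ V} {p q : Submodule ℂ V} (hp : ∀ x ∈ p, T x ∈ p)
    (hq : ∀ x ∈ q, T x ∈ q) (hqp : q ≤ p) :
    detOn (T.restrict hp) (q.submoduleOf p) = detOn T q := by
  have h1 : ∀ x ∈ q.submoduleOf p, T.restrict hp x ∈ q.submoduleOf p := fun x hx => hq x hx
  rw [detOn_eq h1, detOn_eq hq,
    ← LinearMap.det_conj _ (Submodule.submoduleOfEquivOfLe hqp)]
  congr 1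

/-- Induction on `b`: the map `e^b` sends `ker e^(b+1) ∩ im e^c` onto `ker e ∩ im e^(b+c)` with
kernel `ker e^b ∩ im e^c`. -/
theorem detOn_ker_inf_range {k : End ℂ V} (hk : Commute k e) (b c : ℕ) :
    detOn k (LinearMap.ker (e ^ b) ⊓ LinearMap.range (e ^ c)) =
      ∏ i ∈ Finset.range b, detOn k (kerRange e (i + c)) := by
  induction b with
  | zero =>
    rw [Finset.prod_range_zero]
    refine detOn_eq_one ?_
    rintro x ⟨hx, -⟩
    have : x = 0 := by simpa using hx
    rw [this, map_zero]
  | succ b ih =>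
    rw [Finset.prod_range_succ, ← ih,
      detOn_eq_mul_map (e ^ b) (ker_inf_range_stable hk (b + 1) c) (hk.pow_right b)]
    congr 2
    · ext x
      simp only [Submodule.mem_inf, LinearMap.mem_ker]
      constructor
      · rintro ⟨⟨-, hx⟩, hx'⟩
        exact ⟨hx', hx⟩
      · rintro ⟨hx, hx'⟩
        exact ⟨⟨pow_eq_zero_of_le hx b.le_succ, hx'⟩, hx⟩
    · ext x
      constructor
      · rintro ⟨_, ⟨hx, ⟨z, rfl⟩⟩, rfl⟩
        refine ⟨?_, ⟨z, by rw [pow_add_apply]⟩⟩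
        rw [SetLike.mem_coe, LinearMap.mem_ker] at hx ⊢
        rwa [← Module.End.mul_apply, ← pow_succ']
      · rintro ⟨hx, ⟨z, rfl⟩⟩
        refine ⟨(e ^ c) z, ⟨?_, ⟨z, rfl⟩⟩, by rw [pow_add_apply]⟩
        rw [SetLike.mem_coe, LinearMap.mem_ker] at hx ⊢
        rwa [pow_succ', Module.End.mul_apply, pow_add_apply]

theorem det_eq_prod_kerRange {k : End ℂ V} (hk : Commute k e) {N : ℕ} (hN : e ^ N = 0) :
    LinearMap.det k = ∏ i ∈ Finset.range N, detOn k (kerRange e i) := by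
  have := detOn_ker_inf_range hk N 0
  rw [← detOn_top]
  simpa [hN, LinearMap.range_eq_top_of_surjective (1 : End ℂ V) Function.surjective_id] using this

theorem kerRange_succ_le (b : ℕ) : kerRange e (b + 1) ≤ kerRange e b := by
  rintro x ⟨hx, ⟨z, rfl⟩⟩
  exact ⟨hx, ⟨e z, by rw [pow_succ, Module.End.mul_apply]⟩⟩

/-- The form `β (x, e^b z) = B x z` on `ker e ∩ im e^b` is preserved by `k` and has radical `ker e ∩
im e^(b+1)`, so `det_eq_det_radical` applies. -/
theorem detOn_kerRange_succ (h : IsSkewNilpotent B e) {k : End ℂ V} (hk : IsCentIsometry B e k)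
    (h1 : Function.Injective (1 + k : End ℂ V)) (b : ℕ) :
    detOn k (kerRange e b) = detOn k (kerRange e (b + 1)) := by
  have hst := kerRange_stable hk.comm b
  -- A linear section `s` of `e^b` turns `β` into a bilinear map; `hβ'` shows that any other
  -- preimage under `e^b` gives the same value.
  obtain ⟨s, hs⟩ := (e ^ b).rangeRestrict.exists_rightInverse_of_surjective
    (LinearMap.range_rangeRestrict _)
  have hs' : ∀ y (hy : y ∈ LinearMap.range (e ^ b)), (e ^ b) (s ⟨y, hy⟩) = y := fun y hy =>
    congrArg Subtype.val (LinearMap.congr_fun hs ⟨y, hy⟩)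
  have hwd : ∀ x ∈ LinearMap.range (e ^ b), ∀ y z, (e ^ b) y = (e ^ b) z → B x y = B x z := by
    rintro _ ⟨x, rfl⟩ y z hyz
    rw [h.skew_pow, hyz, ← h.skew_pow]
  let β : kerRange e b →ₗ[ℂ] kerRange e b →ₗ[ℂ] ℂ :=
    B.compl₁₂ (kerRange e b).subtype
      (s ∘ₗ Submodule.inclusion (inf_le_right : kerRange e b ≤ LinearMap.range (e ^ b)))
  have hβ : ∀ x y : kerRange e b, β x y = B x (s ⟨y, y.2.2⟩) := fun x y => rfl
  have hβ' : ∀ (x y : kerRange e b) (z : V), (e ^ b) z = y → β x y = B x z := by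
    intro x y z hz
    rw [hβ]
    exact hwd x x.2.2 _ _ ((hs' _ _).trans hz.symm)
  rw [detOn_eq hst, ← detOn_restrict hst (kerRange_stable hk.comm (b + 1)) (kerRange_succ_le b)]
  refine det_eq_det_radical β _ ?_ ?_ _ ?_ ?_ ?_
  · intro x hx
    refine ⟨x.2.1, (h.mem_range_pow_iff (b + 1) _).2 fun y hy => ?_⟩
    rw [← hx ⟨(e ^ b) y, ?_, ⟨y, rfl⟩⟩]
    · exact (hβ' _ _ y rfl).symm
    · rw [SetLike.mem_coe, LinearMap.mem_ker] at *
      rwa [← Module.End.mul_apply, ← pow_succ']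
  · rintro ⟨x, hx⟩ ⟨-, ⟨z, hz⟩⟩ y
    change (e ^ (b + 1)) z = x at hz
    have hker : ∀ t, (e ^ b) t = y → (e ^ (b + 1)) t = 0 := by
      intro t ht
      rw [pow_succ', Module.End.mul_apply, ht]
      exact y.2.1
    obtain ⟨t, ht⟩ := y.2.2
    constructor
    · rw [hβ' _ _ t ht]
      change B x t = 0
      rw [← hz, h.skew_pow, hker t ht, map_zero, mul_zero]
    · rw [hβ' y ⟨x, hx⟩ (e z) (by
        rw [← Module.End.mul_apply, ← pow_succ]; exact hz)]
      have hy : e y = 0 := y.2.1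
      rw [← neg_eq_zero, ← h.skew, hy, map_zero, LinearMap.zero_apply]
  · intro x y
    obtain ⟨t, ht⟩ := y.2.2
    rw [hβ' x y t ht, hβ' _ _ (k t)]
    · exact hk.isometry _ _
    · rw [← comm_pow_apply hk.comm, ht]
      rfl
  · intro x hx
    exact kerRange_stable hk.comm (b + 1) x hx
  · intro x y hxy
    exact Subtype.ext (h1 (congrArg Subtype.val hxy))

theorem kerRange_eq_bot {N : ℕ} (hN : e ^ N = 0) {b : ℕ} (hb : N ≤ b) : kerRange e b = ⊥ := by
  rw [eq_bot_iff]
  rintro x ⟨-, ⟨z, rfl⟩⟩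
  rw [pow_eq_zero_of_le (a := N) (by rw [hN]; rfl) hb]
  exact Submodule.zero_mem _

theorem detOn_kerRange_eq_one (h : IsSkewNilpotent B e) {k : End ℂ V} (hk : IsCentIsometry B e k)
    (h1 : Function.Injective (1 + k : End ℂ V)) (b : ℕ) : detOn k (kerRange e b) = 1 := by
  obtain ⟨N, hN⟩ := h.nil
  have key : ∀ i, detOn k (kerRange e b) = detOn k (kerRange e (b + i)) := by
    intro i
    induction i with
    | zero => rfl
    | succ i ih => rw [ih, detOn_kerRange_succ h hk h1, add_assoc]
  rw [key N, kerRange_eq_bot hN (Nat.le_add_left N b), detOn_bot]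

end Det

end Kernels

/-! ### Splitting off dual pairs of Jordan chains and nondegenerate cyclic subspaces -/

section ChainPairs

variable {V : Type*} [AddCommGroup V] [Module ℂ V]
variable {B : V →ₗ[ℂ] V →ₗ[ℂ] ℂ} {e : End ℂ V}

/-- `u` and `w` generate dual isotropic `e`-stable subspaces with bases `e^i u` and `e^i w`,
`i ≤ a`. -/
structure IsHyperbolicPair (B : V →ₗ[ℂ] V →ₗ[ℂ] ℂ) (e : End ℂ V) (a : ℕ) (u w : V) : Prop where
  left_nil : (e ^ (a + 1)) u = 0
  right_nil : (e ^ (a + 1)) w = 0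
  left_iso : ∀ i, B ((e ^ i) u) u = 0
  right_iso : ∀ i, B ((e ^ i) w) w = 0
  pairing : ∀ i, B ((e ^ i) u) w = if i = a then 1 else 0

/-- `u` generates a nondegenerate `e`-stable subspace with basis `e^i u`, `i ≤ a`. -/
structure IsCyclicVector (B : V →ₗ[ℂ] V →ₗ[ℂ] ℂ) (e : End ℂ V) (a : ℕ) (u : V) : Prop where
  nil : (e ^ (a + 1)) u = 0
  pairing : ∀ i, B ((e ^ i) u) u = if i = a then 1 else 0

namespace IsSkewNilpotent

variable (h : IsSkewNilpotent B e)
include h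

theorem swap_pairing (i : ℕ) (u w : V) : B ((e ^ i) w) u = (-1) ^ i * B ((e ^ i) u) w := by
  rw [h.skew_pow, h.symm]

theorem self_pairing_odd {i : ℕ} (hi : Odd i) (u : V) : B ((e ^ i) u) u = 0 := by
  have := h.swap_pairing i u u
  rw [hi.neg_one_pow] at this
  linear_combination this / 2

variable {a : ℕ} {W : Submodule ℂ V}

/-- The values `B (e^i u) u` are killed for `i = a, a - 1, …, 0` in turn, by adding to `u` multiples
of higher and higher `e^(k+1) w`; these do not disturb the values already killed. -/
theorem exists_isotropic (hW : ∀ x ∈ W, e x ∈ W) {u w : V} (hu : u ∈ W) (hw : w ∈ W)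
    (hu0 : (e ^ (a + 1)) u = 0) (hw0 : (e ^ (a + 1)) w = 0) (huu : B ((e ^ a) u) u = 0)
    (huw : B ((e ^ a) u) w ≠ 0) :
    ∃ u' ∈ W, (e ^ (a + 1)) u' = 0 ∧ B ((e ^ a) u') w ≠ 0 ∧ ∀ i, B ((e ^ i) u') u' = 0 := by
  have hWp : ∀ i, ∀ x ∈ W, (e ^ i) x ∈ W := fun i x hx => by
    induction i with
    | zero => exact hx
    | succ i ih => rw [pow_succ']; exact hW _ ih
  have key : ∀ k, ∃ u' ∈ W, (e ^ (a + 1)) u' = 0 ∧ B ((e ^ a) u') w ≠ 0 ∧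
      ∀ i, a < i + (k + 1) → B ((e ^ i) u') u' = 0 := by
    intro k
    induction k with
    | zero =>
      refine ⟨u, hu, hu0, huw, fun i hi => ?_⟩
      rcases Nat.lt_succ_iff_lt_or_eq.1 hi with hi | rfl
      · rw [pow_eq_zero_of_le hu0 hi]; simp
      · exact huu
    | succ k ih =>
      obtain ⟨u, hu, hu0, huw, huu⟩ := ih
      by_cases hk : a < k + 1
      · exact ⟨u, hu, hu0, huw, fun i _ => huu i (by omega)⟩
      set c := B ((e ^ a) u) w with hc
      -- At `i = a - (k + 1)` the correction contributes `l (-1)^(k+1) (1 + (-1)^i) c`. For even `i`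
      -- this `l` makes it cancel `B (e^i u) u`; for odd `i` both vanish. The term in `l^2` dies
      -- because `e^(a+1) w = 0`.
      set l : ℂ := -((-1) ^ (k + 1) * B ((e ^ (a - (k + 1))) u) u) / (2 * c) with hl
      refine ⟨u + l • (e ^ (k + 1)) w, W.add_mem hu (W.smul_mem _ (hWp _ _ hw)), ?_, ?_, ?_⟩
      · rw [map_add, map_smul, hu0, pow_add_apply, pow_eq_zero_of_le hw0 (by omega)]
        simp
      · rw [map_add, map_smul, pow_add_apply, pow_eq_zero_of_le hw0 (by omega)]
        simpa using huw
      · intro i hi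
        have e1 : B ((e ^ i) (u + l • (e ^ (k + 1)) w)) (u + l • (e ^ (k + 1)) w) =
            B ((e ^ i) u) u + l * ((-1) ^ (k + 1) * (1 + (-1) ^ i) *
              B ((e ^ (i + (k + 1))) u) w) +
            l ^ 2 * ((-1) ^ (k + 1) * B ((e ^ (i + (k + 1) + (k + 1))) w) w) := by
          simp only [map_add, map_smul, LinearMap.add_apply, LinearMap.smul_apply, smul_eq_mul,
            pow_add_apply, h.pow_pow]
          rw [h.swap_pairing (i + (k + 1)) u w]
          ring
        rw [e1, pow_eq_zero_of_le hw0 (by omega : a + 1 ≤ i + (k + 1) + (k + 1))]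
        rcases Nat.lt_or_ge a (i + (k + 1)) with hi' | hi'
        · rw [huu i hi', pow_eq_zero_of_le hu0 hi']
          simp
        · obtain rfl : i = a - (k + 1) := by omega
          rw [show a - (k + 1) + (k + 1) = a by omega, ← hc]
          rcases Nat.even_or_odd (a - (k + 1)) with hev | hod
          · rw [hev.neg_one_pow]
            have h2 : ((-1 : ℂ) ^ (k + 1)) * (-1) ^ (k + 1) = 1 := by rw [← mul_pow]; simp
            have h3 : l * (2 * c) = -((-1) ^ (k + 1) * B ((e ^ (a - (k + 1))) u) u) := by
              rw [hl]; field_simp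
            simp only [map_zero, LinearMap.zero_apply]
            linear_combination (-1) ^ (k + 1) * h3 - B ((e ^ (a - (k + 1))) u) u * h2
          · rw [h.self_pairing_odd hod, hod.neg_one_pow]
            simp
  obtain ⟨u', hu', h1, h2, h3⟩ := key a
  exact ⟨u', hu', h1, h2, fun i => h3 i (by omega)⟩

/-- After `exists_isotropic` has been applied to `u` and then to `w`, the pairing is normalised by
adding to `w` multiples of its own images `e^(k+1) w`, which keeps the chain of `w` isotropic. -/
theorem exists_hyperbolicPair (hW : ∀ x ∈ W, e x ∈ W) {u w : V} (hu : u ∈ W) (hw : w ∈ W)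
    (hu0 : (e ^ (a + 1)) u = 0) (hw0 : (e ^ (a + 1)) w = 0) (huu : B ((e ^ a) u) u = 0)
    (hww : B ((e ^ a) w) w = 0) (huw : B ((e ^ a) u) w ≠ 0) :
    ∃ u' ∈ W, ∃ w' ∈ W, IsHyperbolicPair B e a u' w' := by
  have hWp : ∀ i, ∀ x ∈ W, (e ^ i) x ∈ W := fun i x hx => by
    induction i with
    | zero => exact hx
    | succ i ih => rw [pow_succ']; exact hW _ ih
  obtain ⟨u, hu, hu0, huw, huu⟩ := h.exists_isotropic hW hu hw hu0 hw0 huu huw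
  obtain ⟨w, hw, hw0, hwu, hww⟩ := h.exists_isotropic hW hw hu hw0 hu0 hww (by
    rw [h.swap_pairing]
    exact mul_ne_zero (pow_ne_zero _ (by norm_num)) huw)
  have huw : B ((e ^ a) u) w ≠ 0 := by
    rw [h.swap_pairing] at hwu ⊢
    rw [h.swap_pairing]
    exact mul_ne_zero (pow_ne_zero _ (by norm_num)) hwu
  have key : ∀ k, ∃ w' ∈ W, (e ^ (a + 1)) w' = 0 ∧ (∀ i, B ((e ^ i) w') w' = 0) ∧
      ∀ i, a < i + (k + 1) → B ((e ^ i) u) w' = if i = a then 1 else 0 := by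
    intro k
    induction k with
    | zero =>
      refine ⟨(B ((e ^ a) u) w)⁻¹ • w, W.smul_mem _ hw, by simp [hw0], by simp [hww],
        fun i hi => ?_⟩
      rcases Nat.lt_succ_iff_lt_or_eq.1 hi with hi | rfl
      · rw [pow_eq_zero_of_le hu0 hi, if_neg (by omega)]; simp
      · simp [huw]
    | succ k ih =>
      obtain ⟨w, hw, hw0, hww, huw⟩ := ih
      by_cases hk : a < k + 1
      · exact ⟨w, hw, hw0, hww, fun i _ => huw i (by omega)⟩
      -- At `i = a - (k + 1)` the new term is `l (-1)^(k+1) B (e^a u) w = l (-1)^(k+1)`, as the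
      -- pairing at `a` is already `1`.
      set l : ℂ := -((-1) ^ (k + 1) * B ((e ^ (a - (k + 1))) u) w) with hl
      refine ⟨w + l • (e ^ (k + 1)) w, W.add_mem hw (W.smul_mem _ (hWp _ _ hw)), ?_, ?_, ?_⟩
      · rw [map_add, map_smul, hw0, pow_add_apply, pow_eq_zero_of_le hw0 (by omega)]
        simp
      · intro i
        simp only [map_add, map_smul, LinearMap.add_apply, LinearMap.smul_apply, smul_eq_mul,
            pow_add_apply, h.pow_pow, hww]
        simp
      · intro i hi
        simp only [map_add, map_smul, smul_eq_mul, h.pow_pow]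
        rcases Nat.lt_or_ge a (i + (k + 1)) with hi' | hi'
        · rw [huw i hi', huw _ (by omega), if_neg (by omega : ¬ i + (k + 1) = a)]
          simp
        · obtain rfl : i = a - (k + 1) := by omega
          rw [show a - (k + 1) + (k + 1) = a by omega, huw a (by omega), if_pos rfl,
            if_neg (by omega), hl]
          have h2 : ((-1 : ℂ) ^ (k + 1)) * (-1) ^ (k + 1) = 1 := by rw [← mul_pow]; simp
          linear_combination (-B ((e ^ (a - (k + 1))) u) w) * h2
  obtain ⟨w', hw', h1, h2, h3⟩ := key a
  exact ⟨u, hu, w', hw', hu0, h1, huu, h2, fun i => h3 i (by omega)⟩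

/-- The value at `i = a` is normalised by a square root, the lower ones by adding multiples of
`e^(k+1) u` to `u`. Only even `a` occur: `B (e^a u) u` vanishes for odd `a`. -/
theorem exists_cyclicVector (hW : ∀ x ∈ W, e x ∈ W) {u : V} (hu : u ∈ W)
    (hu0 : (e ^ (a + 1)) u = 0) (huu : B ((e ^ a) u) u ≠ 0) :
    ∃ u' ∈ W, IsCyclicVector B e a u' := by
  have hWp : ∀ i, ∀ x ∈ W, (e ^ i) x ∈ W := fun i x hx => by
    induction i with
    | zero => exact hx
    | succ i ih => rw [pow_succ']; exact hW _ ih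
  have ha : Even a := by
    by_contra hodd
    exact huu (h.self_pairing_odd (Nat.not_even_iff_odd.1 hodd) u)
  have key : ∀ k, ∃ u' ∈ W, (e ^ (a + 1)) u' = 0 ∧
      ∀ i, a < i + (k + 1) → B ((e ^ i) u') u' = if i = a then 1 else 0 := by
    intro k
    induction k with
    | zero =>
      obtain ⟨s, hs⟩ := IsAlgClosed.exists_pow_nat_eq (B ((e ^ a) u) u)⁻¹ two_pos
      refine ⟨s • u, W.smul_mem _ hu, by simp [hu0], fun i hi => ?_⟩
      rcases Nat.lt_succ_iff_lt_or_eq.1 hi with hi | rfl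
      · rw [if_neg (by omega)]
        simp [pow_eq_zero_of_le hu0 hi]
      · simp only [map_smul, LinearMap.smul_apply, smul_eq_mul, if_true]
        rw [← mul_assoc, ← pow_two, hs, inv_mul_cancel₀ huu]
    | succ k ih =>
      obtain ⟨u, hu, hu0, huu⟩ := ih
      by_cases hk : a < k + 1
      · exact ⟨u, hu, hu0, fun i _ => huu i (by omega)⟩
      -- The cross terms at `i = a - (k + 1)` sum to `l (1 + (-1)^(k+1))`, which is `2 l` for even
      -- `k + 1`; for odd `k + 1` the index `i` is odd and there is nothing to correct.
      set l : ℂ := -(B ((e ^ (a - (k + 1))) u) u) / 2 with hl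
      refine ⟨u + l • (e ^ (k + 1)) u, W.add_mem hu (W.smul_mem _ (hWp _ _ hu)), ?_, ?_⟩
      · rw [map_add, map_smul, hu0, pow_add_apply, pow_eq_zero_of_le hu0 (by omega)]
        simp
      · intro i hi
        have e1 : B ((e ^ i) (u + l • (e ^ (k + 1)) u)) (u + l • (e ^ (k + 1)) u) =
            B ((e ^ i) u) u + l * ((1 + (-1) ^ (k + 1)) * B ((e ^ (i + (k + 1))) u) u) +
            l ^ 2 * ((-1) ^ (k + 1) * B ((e ^ (i + (k + 1) + (k + 1))) u) u) := by
          simp only [map_add, map_smul, LinearMap.add_apply, LinearMap.smul_apply, smul_eq_mul,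
            pow_add_apply, h.pow_pow]
          ring
        rw [e1, huu (i + (k + 1) + (k + 1)) (by omega), if_neg (by omega)]
        rcases Nat.lt_or_ge a (i + (k + 1)) with hi' | hi'
        · rw [huu i hi', huu (i + (k + 1)) (by omega), if_neg (by omega : ¬ i + (k + 1) = a)]
          simp
        · obtain rfl : i = a - (k + 1) := by omega
          rw [show a - (k + 1) + (k + 1) = a by omega, huu a (by omega), if_pos rfl,
            if_neg (by omega)]
          rcases Nat.even_or_odd (k + 1) with hev | hod
          · rw [hl, hev.neg_one_pow]
            ring
          · have : Odd (a - (k + 1)) := Nat.Even.sub_odd (by omega) ha hod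
            rw [h.self_pairing_odd this, hod.neg_one_pow]
            ring
  obtain ⟨u', hu', h1, h2⟩ := key a
  exact ⟨u', hu', h1, fun i => h2 i (by omega)⟩

end IsSkewNilpotent

/-- `z ↦ ∑_{i ≤ a} (-1)^i B(e^i u, z) e^(a-i) w`. -/
def chainOp (B : V →ₗ[ℂ] V →ₗ[ℂ] ℂ) (e : End ℂ V) (a : ℕ) (u w : V) : End ℂ V :=
  ∑ i ∈ Finset.range (a + 1), (-1 : ℂ) ^ i • (B ((e ^ i) u)).smulRight ((e ^ (a - i)) w)

theorem chainOp_apply (a : ℕ) (u w z : V) :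
    chainOp B e a u w z =
      ∑ i ∈ Finset.range (a + 1), ((-1) ^ i * B ((e ^ i) u) z) • (e ^ (a - i)) w := by
  simp [chainOp, LinearMap.sum_apply, smul_smul]

theorem chainOp_smul (a : ℕ) (c : ℂ) (u w : V) :
    chainOp B e a u (c • w) = c • chainOp B e a u w := by
  ext z
  simp only [chainOp_apply, map_smul, LinearMap.smul_apply, Finset.smul_sum]
  exact Finset.sum_congr rfl fun i _ => smul_comm _ _ _

theorem chainOp_mem {W : Submodule ℂ V} (hW : ∀ x ∈ W, e x ∈ W) {a : ℕ} {u w : V} (hw : w ∈ W)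
    (z : V) : chainOp B e a u w z ∈ W := by
  have hWp : ∀ i, ∀ x ∈ W, (e ^ i) x ∈ W := fun i x hx => by
    induction i with
    | zero => exact hx
    | succ i ih => rw [pow_succ']; exact hW _ ih
  rw [chainOp_apply]
  exact W.sum_mem fun i _ => W.smul_mem _ (hWp _ _ hw)

/-- Moving `e` across `B` shifts the summation index by one, the alternating sign absorbing that of
skewness; the two boundary terms contain `e^(a+1) u` and `e^(a+1) w`. -/
theorem chainOp_commute (h : IsSkewNilpotent B e) {a : ℕ} {u w : V} (hu : (e ^ (a + 1)) u = 0)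
    (hw : (e ^ (a + 1)) w = 0) : Commute (chainOp B e a u w) e := by
  ext z
  simp only [Module.End.mul_apply, chainOp_apply, map_sum, map_smul]
  rw [Finset.sum_range_succ, Finset.sum_range_succ' (fun i => _ • e _)]
  have h1 : B ((e ^ a) u) (e z) = 0 := by
    rw [← neg_eq_zero, ← h.skew, ← Module.End.mul_apply, ← pow_succ', hu]
    simp
  have h2 : e ((e ^ (a - 0)) w) = 0 := by
    rw [← Module.End.mul_apply, ← pow_succ']
    exact hw
  rw [h1, h2]
  simp only [mul_zero, zero_smul, smul_zero, add_zero]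
  refine Finset.sum_congr rfl fun i hi => ?_
  rw [Finset.mem_range] at hi
  rw [← Module.End.mul_apply e, ← pow_succ', show a - (i + 1) + 1 = a - i by omega]
  congr 1
  rw [pow_succ' e, Module.End.mul_apply, h.skew]
  ring

theorem chainOp_adjoint (h : IsSkewNilpotent B e) (a : ℕ) (u w x y : V) :
    B (chainOp B e a u w x) y = (-1) ^ a * B x (chainOp B e a w u y) := by
  rw [chainOp_apply, chainOp_apply, ← Finset.sum_range_reflect]
  simp only [map_sum, map_smul, LinearMap.sum_apply, LinearMap.smul_apply, smul_eq_mul,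
    Finset.mul_sum]
  refine Finset.sum_congr rfl fun i hi => ?_
  rw [Finset.mem_range] at hi
  rw [show a + 1 - 1 - i = a - i by omega, show a - (a - i) = i by omega, h.symm x]
  have : (-1 : ℂ) ^ a = (-1) ^ (a - i) * (-1) ^ i := by rw [← pow_add]; congr 1; omega
  have h2 : ((-1 : ℂ) ^ i) * (-1) ^ i = 1 := by rw [← mul_pow]; simp
  rw [this]
  linear_combination (-(-1) ^ (a - i) * (B ((e ^ (a - i)) u)) x * B ((e ^ i) w) y) * h2

theorem mul_chainOp {T : End ℂ V} (hT : Commute T e) (a : ℕ) (u w : V) :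
    T * chainOp B e a u w = chainOp B e a u (T w) := by
  ext z
  rw [Module.End.mul_apply, chainOp_apply, chainOp_apply, map_sum]
  refine Finset.sum_congr rfl fun i _ => ?_
  rw [map_smul, comm_pow_apply hT]

theorem chainOp_apply_of_pairing {a : ℕ} {u w v : V} {c : ℂ}
    (hv : ∀ i, B ((e ^ i) u) v = if i = a then c else 0) :
    chainOp B e a u w v = ((-1) ^ a * c) • w := by
  rw [chainOp_apply, Finset.sum_eq_single a]
  · simp [hv]
  · intro i _ hi
    simp [hv, hi]
  · simp

/-- Complementary isotropic idempotents: `P₁` and `P₂` are adjoint orthogonal idempotents commuting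
with `e`. -/
structure IsHyperbolicSplitting (B : V →ₗ[ℂ] V →ₗ[ℂ] ℂ) (e P₁ P₂ : End ℂ V) : Prop where
  comm_left : Commute P₁ e
  comm_right : Commute P₂ e
  idem_left : P₁ * P₁ = P₁
  idem_right : P₂ * P₂ = P₂
  left_right : P₁ * P₂ = 0
  right_left : P₂ * P₁ = 0
  adjoint : ∀ x y, B (P₁ x) y = B x (P₂ y)

theorem IsHyperbolicPair.apply_left (h : IsSkewNilpotent B e) {a : ℕ} {u w : V}
    (hp : IsHyperbolicPair B e a u w) : chainOp B e a w u u = u := by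
  rw [chainOp_apply_of_pairing (c := (-1) ^ a)]
  · rw [← mul_pow]; simp
  · intro i
    rw [h.swap_pairing, hp.pairing]
    split_ifs with hi <;> simp [hi]

theorem IsHyperbolicPair.apply_right {a : ℕ} {u w : V}
    (hp : IsHyperbolicPair B e a u w) : chainOp B e a u w w = (-1 : ℂ) ^ a • w := by
  rw [chainOp_apply_of_pairing hp.pairing, mul_one]

/-- These are the projections onto the chains of `w` and of `u`. Since `T * chainOp u w = chainOp u
(T w)` for `T` commuting with `e`, each product identity reduces to a value at `u` or `w`. -/
theorem IsHyperbolicPair.splitting (h : IsSkewNilpotent B e) {a : ℕ} {u w : V}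
    (hp : IsHyperbolicPair B e a u w) :
    IsHyperbolicSplitting B e ((-1 : ℂ) ^ a • chainOp B e a u w) (chainOp B e a w u) := by
  have c1 := chainOp_commute h hp.left_nil hp.right_nil
  have c2 := chainOp_commute h hp.right_nil hp.left_nil
  have h2 : ((-1 : ℂ) ^ a) * (-1) ^ a = 1 := by rw [← mul_pow]; simp
  have z1 : chainOp B e a u w u = 0 := by
    rw [chainOp_apply_of_pairing (c := 0) fun i => by simp [hp.left_iso]]; simp
  have z2 : chainOp B e a w u w = 0 := by
    rw [chainOp_apply_of_pairing (c := 0) fun i => by simp [hp.right_iso]]; simp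
  have zz : ∀ v, chainOp B e a v 0 = 0 := fun v => by
    have := chainOp_smul (B := B) (e := e) a 0 v 0
    simpa using this
  refine ⟨c1.smul_left _, c2, ?_, ?_, ?_, ?_, ?_⟩
  · rw [smul_mul_smul_comm, mul_chainOp c1, hp.apply_right, chainOp_smul, smul_smul, h2, one_mul]
  · rw [mul_chainOp c2, hp.apply_left h]
  · rw [smul_mul_assoc, mul_chainOp c1, z1, zz, smul_zero]
  · rw [mul_smul_comm, mul_chainOp c2, z2, zz, smul_zero]
  · intro x y
    rw [LinearMap.smul_apply, map_smul, LinearMap.smul_apply, chainOp_adjoint h, smul_eq_mul,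
      ← mul_assoc, h2, one_mul]

/-- Take `k` to be `I` on the image of `P₁`, `-I` on that of `P₂` and `1` on the rest. It is an
isometry because the two images are isotropic and `I * (-I) = 1`. -/
theorem IsHyperbolicSplitting.exists_sqrt (h : IsSkewNilpotent B e) {P₁ P₂ : End ℂ V}
    (hP : IsHyperbolicSplitting B e P₁ P₂) :
    ∃ k : End ℂ V, IsCentIsometry B e k ∧ Function.Injective (1 + k : End ℂ V) ∧
      k * k = 1 - 2 * (P₁ + P₂) := by
  have hI : Complex.I * Complex.I = -1 := Complex.I_mul_I
  have hadj : ∀ x y, B (P₂ x) y = B x (P₁ y) := fun x y => by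
    rw [h.symm, ← hP.adjoint, h.symm]
  have a1 : ∀ x, P₁ (P₁ x) = P₁ x := fun x => LinearMap.congr_fun hP.idem_left x
  have a2 : ∀ x, P₂ (P₂ x) = P₂ x := fun x => LinearMap.congr_fun hP.idem_right x
  have a3 : ∀ x, P₁ (P₂ x) = 0 := fun x => LinearMap.congr_fun hP.left_right x
  have a4 : ∀ x, P₂ (P₁ x) = 0 := fun x => LinearMap.congr_fun hP.right_left x
  refine ⟨1 - (P₁ + P₂) + Complex.I • (P₁ - P₂), ⟨?_, ?_⟩, ?_, ?_⟩
  · intro x y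
    simp only [LinearMap.add_apply, LinearMap.sub_apply, LinearMap.smul_apply, map_add, map_sub,
      map_smul, Module.End.one_apply, smul_eq_mul, hP.adjoint, hadj, a1, a2, a3, a4,
      map_zero]
    linear_combination (-(B x (P₁ y)) - B x (P₂ y)) * hI
  · exact ((Commute.one_left e).sub_left (hP.comm_left.add_left hP.comm_right)).add_left
      ((hP.comm_left.sub_left hP.comm_right).smul_left _)
  · rw [injective_iff_map_eq_zero]
    intro x hx
    simp only [LinearMap.add_apply, LinearMap.sub_apply, LinearMap.smul_apply,
      Module.End.one_apply] at hx
    have h1 := congrArg P₁ hx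
    have h2 := congrArg P₂ hx
    simp only [map_add, map_sub, map_smul, a1, a2, a3, a4, map_zero, smul_zero, smul_sub,
      sub_zero, zero_sub, add_zero, zero_add, sub_self] at h1 h2
    have h1' : (1 + Complex.I) • P₁ x = 0 := by rw [add_smul, one_smul]; convert h1 using 1
    have h2' : (1 - Complex.I) • P₂ x = 0 := by
      rw [sub_smul, one_smul, sub_eq_add_neg]; convert h2 using 1
    have n1 : (1 + Complex.I) ≠ 0 := fun hh => by
      have := congrArg Complex.im hh; simp at this
    have n2 : (1 - Complex.I) ≠ 0 := fun hh => by
      have := congrArg Complex.im hh; simp at this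
    have p1 := (smul_eq_zero.1 h1').resolve_left n1
    have p2 := (smul_eq_zero.1 h2').resolve_left n2
    rw [p1, p2] at hx
    have : (2 : ℂ) • x = 0 := by rw [two_smul]; simpa using hx
    exact (smul_eq_zero.1 this).resolve_left two_ne_zero
  · ext x
    simp only [Module.End.mul_apply, LinearMap.add_apply, LinearMap.sub_apply,
      LinearMap.smul_apply, map_add, map_sub, map_smul, Module.End.one_apply, a1, a2, a3, a4,
      two_mul]
    have : ∀ v : V, Complex.I • Complex.I • v = -v := fun v => by rw [smul_smul, hI]; simp
    simp only [smul_sub, smul_add, smul_zero, this]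
    abel

theorem IsCyclicVector.even (h : IsSkewNilpotent B e) {a : ℕ} {u : V}
    (hu : IsCyclicVector B e a u) : Even a := by
  by_contra hodd
  have := hu.pairing a
  rw [h.self_pairing_odd (Nat.not_even_iff_odd.1 hodd) u, if_pos rfl] at this
  exact zero_ne_one this

theorem IsCyclicVector.apply_self (h : IsSkewNilpotent B e) {a : ℕ} {u : V}
    (hu : IsCyclicVector B e a u) : chainOp B e a u u u = u := by
  rw [chainOp_apply_of_pairing hu.pairing, (hu.even h).neg_one_pow]
  simp

theorem IsCyclicVector.idem (h : IsSkewNilpotent B e) {a : ℕ} {u : V}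
    (hu : IsCyclicVector B e a u) : chainOp B e a u u * chainOp B e a u u = chainOp B e a u u := by
  rw [mul_chainOp (chainOp_commute h hu.nil hu.nil), hu.apply_self h]

theorem IsCyclicVector.adjoint (h : IsSkewNilpotent B e) {a : ℕ} {u : V}
    (hu : IsCyclicVector B e a u) (x y : V) :
    B (chainOp B e a u u x) y = B x (chainOp B e a u u y) := by
  rw [chainOp_adjoint h, (hu.even h).neg_one_pow, one_mul]

/-- A self-adjoint idempotent commuting with `e`. -/
structure IsCentProjection (B : V →ₗ[ℂ] V →ₗ[ℂ] ℂ) (e P : End ℂ V) : Prop where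
  comm : Commute P e
  idem : P * P = P
  adjoint : ∀ x y, B (P x) y = B x (P y)

theorem IsCentProjection.isometry {P : End ℂ V} (hP : IsCentProjection B e P) :
    IsCentIsometry B e (1 - 2 * P) := by
  have a1 : ∀ x, P (P x) = P x := fun x => LinearMap.congr_fun hP.idem x
  refine ⟨fun x y => ?_, ?_⟩
  · simp only [LinearMap.sub_apply, map_sub, Module.End.one_apply, two_mul, LinearMap.add_apply,
      map_add, hP.adjoint, a1]
    ring
  · rw [two_mul]
    exact (Commute.one_left e).sub_left (hP.comm.add_left hP.comm)

theorem IsCyclicVector.projection (h : IsSkewNilpotent B e) {a : ℕ} {u : V}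
    (hu : IsCyclicVector B e a u) : IsCentProjection B e (chainOp B e a u u) :=
  ⟨chainOp_commute h hu.nil hu.nil, hu.idem h, hu.adjoint h⟩

theorem IsHyperbolicSplitting.projection (h : IsSkewNilpotent B e) {P₁ P₂ : End ℂ V}
    (hP : IsHyperbolicSplitting B e P₁ P₂) : IsCentProjection B e (P₁ + P₂) where
  comm := hP.comm_left.add_left hP.comm_right
  idem := by
    rw [mul_add, add_mul, add_mul, hP.idem_left, hP.idem_right, hP.left_right, hP.right_left]
    simp
  adjoint x y := by
    simp only [LinearMap.add_apply, map_add]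
    rw [h.symm (P₂ x) y, ← hP.adjoint y x, h.symm (P₁ y) x, hP.adjoint, add_comm]

/-- On `ker e` the projection is `z ↦ B u z • e^a u`, so the restriction is the reflection along
`e^a u` when that vector lies in `im e^b`. For `b > a` it is the identity, since `u` is then
orthogonal to `im e^b`. -/
theorem detOn_cyclic [FiniteDimensional ℂ V] (h : IsSkewNilpotent B e) {a : ℕ} {u : V}
    (hu : IsCyclicVector B e a u) (b : ℕ) :
    detOn (1 - 2 * chainOp B e a u u) (kerRange e b) = if b ≤ a then -1 else 1 := by
  have hst := kerRange_stable (hu.projection h).isometry.comm b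
  have hY : ∀ z, e z = 0 → chainOp B e a u u z = B u z • (e ^ a) u := by
    intro z hz
    rw [chainOp_apply, Finset.sum_eq_single 0]
    · simp
    · intro i _ hi
      obtain ⟨j, rfl⟩ := Nat.exists_eq_succ_of_ne_zero hi
      have : B ((e ^ (j + 1)) u) z = 0 := by
        rw [h.skew_pow, pow_succ e, Module.End.mul_apply, hz]
        simp
      simp [this]
    · simp
  split_ifs with hb
  · have hmem : (e ^ a) u ∈ kerRange e b := by
      refine ⟨?_, ⟨(e ^ (a - b)) u, by rw [pow_add_apply]; congr 2; omega⟩⟩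
      rw [SetLike.mem_coe, LinearMap.mem_ker, ← Module.End.mul_apply, ← pow_succ']
      exact hu.nil
    have : (1 - 2 * chainOp B e a u u).restrict hst =
        LinearMap.transvection ((-2 : ℂ) • (B u).domRestrict (kerRange e b)) ⟨(e ^ a) u, hmem⟩ := by
      ext x
      rw [LinearMap.transvection.apply]
      have hx : e x = 0 := x.2.1
      simp only [LinearMap.coe_restrict_apply, LinearMap.sub_apply, Module.End.one_apply, two_mul,
        LinearMap.add_apply, hY _ hx, Submodule.coe_add, Submodule.coe_smul, LinearMap.smul_apply,
        LinearMap.domRestrict_apply, smul_eq_mul]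
      module
    rw [detOn_eq hst, this, LinearMap.transvection.det]
    simp only [LinearMap.smul_apply, LinearMap.domRestrict_apply, smul_eq_mul]
    rw [h.symm, hu.pairing, if_pos rfl]
    norm_num
  · refine detOn_eq_one ?_
    rintro x ⟨hx, ⟨y, rfl⟩⟩
    rw [SetLike.mem_coe, LinearMap.mem_ker] at hx
    simp only [LinearMap.sub_apply, Module.End.one_apply, two_mul, LinearMap.add_apply, hY _ hx]
    rw [h.skew_pow', pow_eq_zero_of_le hu.nil (by omega)]
    simp

end ChainPairs

/-! ### Generators of the isometries commuting with `e` -/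

section Generation

variable {V : Type*} [AddCommGroup V] [Module ℂ V]
variable {B : V →ₗ[ℂ] V →ₗ[ℂ] ℂ} {e : End ℂ V}

/-- An isometry `k` commuting with `e` without eigenvalue `-1`. -/
structure IsCayley (B : V →ₗ[ℂ] V →ₗ[ℂ] ℂ) (e k : End ℂ V) : Prop extends
    IsCentIsometry B e k where
  injective : Function.Injective (1 + k : End ℂ V)

/-- The products of isometries without eigenvalue `-1`. -/
def cayleyMonoid (B : V →ₗ[ℂ] V →ₗ[ℂ] ℂ) (e : End ℂ V) : Submonoid (End ℂ V) :=
  Submonoid.closure {k | IsCayley B e k}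

/-- The reflections in nondegenerate cyclic subspaces. -/
def IsCyclicReflection (B : V →ₗ[ℂ] V →ₗ[ℂ] ℂ) (e k : End ℂ V) : Prop :=
  ∃ (a : ℕ) (u : V), IsCyclicVector B e a u ∧ k = 1 - 2 * chainOp B e a u u

/-- By `mem_reflectionMonoid` this contains every isometry commuting with `e`, so multiplicative
properties of `detOn` need checking only on the two kinds of generators. -/
def reflectionMonoid (B : V →ₗ[ℂ] V →ₗ[ℂ] ℂ) (e : End ℂ V) : Submonoid (End ℂ V) :=
  Submonoid.closure {k | IsCayley B e k ∨ IsCyclicReflection B e k}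

theorem cayleyMonoid_le : cayleyMonoid B e ≤ reflectionMonoid B e :=
  Submonoid.closure_mono fun _ hk => Or.inl hk

theorem isCentIsometry_one : IsCentIsometry B e 1 := ⟨fun _ _ => rfl, Commute.one_left e⟩

theorem IsCentIsometry.mul {k l : End ℂ V} (hk : IsCentIsometry B e k)
    (hl : IsCentIsometry B e l) : IsCentIsometry B e (k * l) :=
  ⟨fun x y => by rw [Module.End.mul_apply, Module.End.mul_apply, hk.isometry, hl.isometry],
    hk.comm.mul_left hl.comm⟩

theorem IsCyclicReflection.isCentIsometry (h : IsSkewNilpotent B e) {k : End ℂ V}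
    (hk : IsCyclicReflection B e k) : IsCentIsometry B e k := by
  obtain ⟨a, u, hu, rfl⟩ := hk
  exact (hu.projection h).isometry

theorem isCentIsometry_of_mem (h : IsSkewNilpotent B e) {k : End ℂ V}
    (hk : k ∈ reflectionMonoid B e) : IsCentIsometry B e k := by
  induction hk using Submonoid.closure_induction with
  | mem k hk => exact hk.elim (fun h' => h'.toIsCentIsometry) fun h' => h'.isCentIsometry h
  | one => exact isCentIsometry_one
  | mul k l _ _ hk hl => exact hk.mul hl

section Projections

variable {P R : End ℂ V}

theorem IsCentProjection.apply_apply (hP : IsCentProjection B e P) (x : V) : P (P x) = P x :=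
  LinearMap.congr_fun hP.idem x

theorem IsCentProjection.mul_eq (h : IsSkewNilpotent B e) (hP : IsCentProjection B e P)
    (hR : IsCentProjection B e R) (hRP : R * P = P) : P * R = P := by
  ext x
  rw [← sub_eq_zero]
  refine h.nondeg _ fun y => ?_
  rw [map_sub, LinearMap.sub_apply, Module.End.mul_apply, hP.adjoint, hR.adjoint, hP.adjoint,
    ← Module.End.mul_apply, hRP, sub_self]

theorem IsCentProjection.sub (h : IsSkewNilpotent B e) (hP : IsCentProjection B e P)
    (hR : IsCentProjection B e R) (hRP : R * P = P) : IsCentProjection B e (R - P) where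
  comm := hR.comm.sub_left hP.comm
  idem := by
    rw [mul_sub, sub_mul, sub_mul, hR.idem, hP.idem, hRP, hP.mul_eq h hR hRP]
    simp
  adjoint x y := by
    rw [LinearMap.sub_apply, LinearMap.sub_apply, map_sub, map_sub, LinearMap.sub_apply,
      hR.adjoint, hP.adjoint]

theorem IsCentProjection.reflection_eq (h : IsSkewNilpotent B e) (hP : IsCentProjection B e P)
    (hR : IsCentProjection B e R) (hRP : R * P = P) :
    1 - 2 * R = (1 - 2 * P) * (1 - 2 * (R - P)) := by
  have h2 := hP.idem
  have h3 := hP.mul_eq h hR hRP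
  simp only [two_mul, mul_sub, sub_mul, mul_add, add_mul, one_mul, mul_one, h2, h3]
  abel

theorem IsCentProjection.finrank_sub_lt [FiniteDimensional ℂ V]
    (h : IsSkewNilpotent B e) (hP : IsCentProjection B e P) (hR : IsCentProjection B e R) (hRP : R * P = P)
    {v : V} (hv : P v = v) (hv0 : v ≠ 0) :
    finrank ℂ (LinearMap.range (R - P)) < finrank ℂ (LinearMap.range R) := by
  have hRv : R v = v := by
    have := LinearMap.congr_fun hRP v
    rwa [Module.End.mul_apply, hv] at this
  apply Submodule.finrank_lt_finrank_of_lt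
  refine lt_of_le_of_ne ?_ fun heq => hv0 ?_
  · rintro _ ⟨x, rfl⟩
    refine ⟨(R - P) x, ?_⟩
    rw [LinearMap.sub_apply, map_sub, hR.apply_apply, ← Module.End.mul_apply, hRP]
  · have : v ∈ LinearMap.range (R - P) := by rw [heq]; exact ⟨v, hRv⟩
    obtain ⟨x, hx⟩ := this
    have h1 : P v = 0 := by
      rw [← hx, LinearMap.sub_apply, map_sub, hP.apply_apply, ← Module.End.mul_apply,
        hP.mul_eq h hR hRP, sub_self]
    rw [← hv, h1]

end Projections

variable [FiniteDimensional ℂ V]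

theorem detOn_kerRange_mul {k l : End ℂ V} (hk : IsCentIsometry B e k)
    (hl : IsCentIsometry B e l) (b : ℕ) :
    detOn (k * l) (kerRange e b) = detOn k (kerRange e b) * detOn l (kerRange e b) :=
  detOn_mul (kerRange_stable hk.comm b) (kerRange_stable hl.comm b)

theorem detOn_eq_one_of_mem_cayleyMonoid (h : IsSkewNilpotent B e) {k : End ℂ V}
    (hk : k ∈ cayleyMonoid B e) (b : ℕ) : detOn k (kerRange e b) = 1 := by
  induction hk using Submonoid.closure_induction with
  | mem k hk => exact detOn_kerRange_eq_one h hk.toIsCentIsometry hk.injective b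
  | one => exact detOn_eq_one fun _ _ => rfl
  | mul k l hk hl hk' hl' =>
    rw [detOn_kerRange_mul (isCentIsometry_of_mem h (cayleyMonoid_le hk))
      (isCentIsometry_of_mem h (cayleyMonoid_le hl)), hk', hl', one_mul]

theorem exists_pairing_ne_zero (h : IsSkewNilpotent B e) {R : End ℂ V}
    (hR : IsCentProjection B e R) {a : ℕ} (ha : (e ^ a) * R ≠ 0) :
    ∃ x y, B ((e ^ a) (R x)) (R y) ≠ 0 := by
  by_contra! hc
  refine ha (LinearMap.ext fun x => h.nondeg _ fun y => ?_)
  have := hc x y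
  rwa [← hR.adjoint, comm_pow_apply hR.comm, hR.apply_apply] at this

/-- Induction on the rank of `R`; the operator `1 - 2 * R` is `-1` on `im R`. Let `a` be the last
exponent with `e^a` nonzero on `im R`, and consider the form `B (e^a x) y` there. If two isotropic
vectors pair nontrivially, a pair of dual chains splits off, on which `-1` is the square of an
isometry without eigenvalue `-1`. Otherwise a cyclic subspace splits off and contributes a
reflection; the form then has rank one, so `e^a` vanishes on the rest and `d_a` equals `-1`, which
excludes this case from the second claim. -/
theorem reflection_mem (h : IsSkewNilpotent B e) (N : ℕ) : ∀ R : End ℂ V,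
    IsCentProjection B e R → finrank ℂ (LinearMap.range R) ≤ N →
    1 - 2 * R ∈ reflectionMonoid B e ∧
    ((∀ b, detOn (1 - 2 * R) (kerRange e b) = 1) → 1 - 2 * R ∈ cayleyMonoid B e) := by
  induction N with
  | zero =>
    intro R hR hN
    have : R = 0 := by
      rw [← LinearMap.range_eq_bot, ← Submodule.finrank_eq_zero (R := ℂ)]
      omega
    rw [this, mul_zero, sub_zero]
    exact ⟨Submonoid.one_mem _, fun _ => Submonoid.one_mem _⟩
  | succ N ih =>
    intro R hR hN
    by_cases hR0 : R = 0
    · rw [hR0, mul_zero, sub_zero]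
      exact ⟨Submonoid.one_mem _, fun _ => Submonoid.one_mem _⟩
    obtain ⟨a, ha, ha1⟩ : ∃ a, (e ^ a) * R ≠ 0 ∧ (e ^ (a + 1)) * R = 0 := by
      classical
      obtain ⟨M, hM⟩ := h.nil
      have hex : ∃ d, (e ^ d) * R = 0 := ⟨M, by rw [hM, zero_mul]⟩
      have hne : Nat.find hex ≠ 0 := fun h0 => hR0 (by
        have := Nat.find_spec hex
        rwa [h0, pow_zero, one_mul] at this)
      obtain ⟨d, hd⟩ := Nat.exists_eq_succ_of_ne_zero hne
      refine ⟨d, Nat.find_min hex (by omega), ?_⟩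
      have := Nat.find_spec hex
      rwa [hd] at this
    have hW : ∀ x ∈ LinearMap.range R, e x ∈ LinearMap.range R := by
      rintro _ ⟨x, rfl⟩
      exact ⟨e x, comm_apply hR.comm x⟩
    have hRfix : ∀ x ∈ LinearMap.range R, R x = x := by
      rintro _ ⟨x, rfl⟩
      exact hR.apply_apply x
    have hnil : ∀ x ∈ LinearMap.range R, (e ^ (a + 1)) x = 0 := by
      rintro _ ⟨x, rfl⟩
      exact LinearMap.congr_fun ha1 x
    have hmulR : ∀ T : End ℂ V, (∀ x, T x ∈ LinearMap.range R) → R * T = T := fun T hT =>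
      LinearMap.ext fun x => hRfix _ (hT x)
    by_cases hyp : ∃ u ∈ LinearMap.range R, ∃ w ∈ LinearMap.range R,
        B ((e ^ a) u) u = 0 ∧ B ((e ^ a) w) w = 0 ∧ B ((e ^ a) u) w ≠ 0
    · obtain ⟨u, hu, w, hw, huu, hww, huw⟩ := hyp
      obtain ⟨u, hu, w, hw, hp⟩ := h.exists_hyperbolicPair hW hu hw (hnil u hu) (hnil w hw)
        huu hww huw
      have hs := hp.splitting h
      set P₁ := (-1 : ℂ) ^ a • chainOp B e a u w with hP₁
      set P₂ := chainOp B e a w u with hP₂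
      have hP := hs.projection h
      have hRP : R * (P₁ + P₂) = P₁ + P₂ := hmulR _ fun x =>
        Submodule.add_mem _ (Submodule.smul_mem _ _ (chainOp_mem hW hw x)) (chainOp_mem hW hu x)
      have hu2 : P₂ u = u := hp.apply_left h
      have hu1 : (P₁ + P₂) u = u := by
        have : P₁ u = 0 := by
          rw [← hu2]
          exact LinearMap.congr_fun hs.left_right u
        rw [LinearMap.add_apply, this, hu2, zero_add]
      have hu0 : u ≠ 0 := by
        rintro rfl
        have := hp.pairing a
        simp at this
      have hlt := hP.finrank_sub_lt h hR hRP hu1 hu0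
      obtain ⟨i1, i2⟩ := ih _ (hP.sub h hR hRP) (by omega)
      obtain ⟨k, hk, hk1, hkk⟩ := hs.exists_sqrt h
      have hmem : 1 - 2 * (P₁ + P₂) ∈ cayleyMonoid B e := by
        rw [← hkk]
        have : k ∈ cayleyMonoid B e := Submonoid.subset_closure ⟨hk, hk1⟩
        exact Submonoid.mul_mem _ this this
      rw [hP.reflection_eq h hR hRP]
      refine ⟨Submonoid.mul_mem _ (cayleyMonoid_le hmem) i1, fun hd =>
        Submonoid.mul_mem _ hmem (i2 fun b => ?_)⟩
      have := hd b
      rwa [detOn_kerRange_mul hP.isometry (hP.sub h hR hRP).isometry,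
        detOn_eq_one_of_mem_cayleyMonoid h hmem, one_mul] at this
    · have hself : ∀ u ∈ LinearMap.range R, ∀ w ∈ LinearMap.range R, B ((e ^ a) u) w ≠ 0 →
          B ((e ^ a) u) u ≠ 0 ∨ B ((e ^ a) w) w ≠ 0 := by
        intro u hu w hw huw
        by_contra! hc
        exact hyp ⟨u, hu, w, hw, hc.1, hc.2, huw⟩
      obtain ⟨u₀, hu₀, huu₀⟩ : ∃ u ∈ LinearMap.range R, B ((e ^ a) u) u ≠ 0 := by
        obtain ⟨x, y, hxy⟩ := exists_pairing_ne_zero h hR ha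
        rcases hself _ ⟨x, rfl⟩ _ ⟨y, rfl⟩ hxy with h' | h'
        exacts [⟨_, ⟨x, rfl⟩, h'⟩, ⟨_, ⟨y, rfl⟩, h'⟩]
      obtain ⟨u, hu, hc⟩ := h.exists_cyclicVector hW hu₀ (hnil _ hu₀) huu₀
      have hP := hc.projection h
      have hPu := hc.apply_self h
      have hcyc : IsCyclicReflection B e (1 - 2 * chainOp B e a u u) := ⟨a, u, hc, rfl⟩
      have hdet := detOn_cyclic h hc a
      set P := chainOp B e a u u with hPdef
      have hRP : R * P = P := hmulR _ fun x => chainOp_mem hW hu x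
      have hu0 : u ≠ 0 := by
        rintro rfl
        have := hc.pairing a
        simp at this
      have hlt := hP.finrank_sub_lt h hR hRP hPu hu0
      have hR' := hP.sub h hR hRP
      obtain ⟨i1, i2⟩ := ih _ hR' (by omega)
      have hle : ∀ x, (R - P) x ∈ LinearMap.range R := fun x => ⟨(R - P) x, by
        rw [LinearMap.sub_apply, map_sub, hR.apply_apply, ← Module.End.mul_apply, hRP]⟩
      -- If not, the complement contains `v` with `B (e^a v) v ≠ 0`. Choosing `s^2 B (e^a v) v = -1`
      -- makes `u + s v` and `u - s v` isotropic with pairing `2`, contrary to the case assumption.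
      have hzero : (e ^ a) * (R - P) = 0 := by
        by_contra hne
        obtain ⟨x, y, hxy⟩ := exists_pairing_ne_zero h hR' hne
        obtain ⟨z, hz⟩ : ∃ z, B ((e ^ a) ((R - P) z)) ((R - P) z) ≠ 0 := by
          rcases hself _ (hle x) _ (hle y) hxy with h' | h'
          exacts [⟨x, h'⟩, ⟨y, h'⟩]
        set v := (R - P) z with hv
        obtain ⟨s, hs⟩ := IsAlgClosed.exists_pow_nat_eq (-(B ((e ^ a) v) v)⁻¹) two_pos
        have huv : B ((e ^ a) u) v = 0 := by
          rw [hv, ← hR'.adjoint, comm_pow_apply hR'.comm, LinearMap.sub_apply, hRfix u hu, hPu,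
            sub_self, map_zero, map_zero, LinearMap.zero_apply]
        have hvu : B ((e ^ a) v) u = 0 := by rw [h.swap_pairing, huv, mul_zero]
        have hsv : s ^ 2 * B ((e ^ a) v) v = -1 := by
          rw [hs, neg_mul, inv_mul_cancel₀ hz]
        have huu : B ((e ^ a) u) u = 1 := by rw [hc.pairing, if_pos rfl]
        have hsm : s • v ∈ LinearMap.range R := Submodule.smul_mem _ _ (hle z)
        refine hyp ⟨u + s • v, Submodule.add_mem _ hu hsm, u - s • v,
          Submodule.sub_mem _ hu hsm, ?_, ?_, ?_⟩
        all_goals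
          simp only [map_add, map_sub, map_smul, LinearMap.add_apply, LinearMap.sub_apply,
            LinearMap.smul_apply, smul_eq_mul, huu, huv, hvu]
        · linear_combination hsv
        · linear_combination hsv
        · intro h0
          have : (2 : ℂ) = 0 := by linear_combination h0 + hsv
          exact two_ne_zero this
      rw [hP.reflection_eq h hR hRP]
      refine ⟨Submonoid.mul_mem _ (Submonoid.subset_closure (Or.inr hcyc)) i1, fun hd => ?_⟩
      exfalso
      -- The reflection has `d_a = -1` and the remaining factor fixes `im e^a` pointwise.
      have h1 := hd a
      rw [detOn_kerRange_mul hP.isometry hR'.isometry, hdet, if_pos le_rfl,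
        detOn_eq_one (T := 1 - 2 * (R - P))] at h1
      · norm_num at h1
      · rintro _ ⟨-, ⟨y, rfl⟩⟩
        have : (R - P) ((e ^ a) y) = 0 := by
          rw [comm_pow_apply hR'.comm]
          exact LinearMap.congr_fun hzero y
        rw [LinearMap.sub_apply, two_mul, LinearMap.add_apply, this]
        simp

/-- Says that the adjoint of `1 + g` is `(1 + g) g⁻¹`, without inverting `g`. It gives the
orthogonality of the generalized `-1`-eigenspace of `g` to the image of `(1 + g)^n`. -/
theorem pow_one_add_adjoint {g : End ℂ V} (hg : ∀ x y, B (g x) (g y) = B x y) (n : ℕ) :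
    ∀ x t, B (((1 + g) ^ n) x) ((g ^ n) t) = B x (((1 + g) ^ n) t) := by
  induction n with
  | zero => intro x t; rfl
  | succ n ih =>
    intro x t
    have h1 : ∀ x t, B ((1 + g) x) (g t) = B x ((1 + g) t) := by
      intro x t
      simp only [LinearMap.add_apply, Module.End.one_apply, map_add, hg]
      ring
    have hc : Commute (1 + g) (g ^ n) :=
      ((Commute.one_left g).add_left (Commute.refl g)).pow_right n
    rw [pow_succ' (1 + g), Module.End.mul_apply, pow_succ' g, Module.End.mul_apply, h1,
      ← Module.End.mul_apply (1 + g) (g ^ n), hc.eq, Module.End.mul_apply, ih,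
      ← Module.End.mul_apply, ← pow_succ, ← pow_succ']

/-- Every isometry commuting with `e` is the product of one without eigenvalue `-1` and of a
reflection. -/
theorem exists_eq_cayley_mul_reflection (h : IsSkewNilpotent B e) {g : End ℂ V}
    (hg : IsCentIsometry B e g) :
    ∃ k R : End ℂ V, IsCayley B e k ∧ IsCentProjection B e R ∧ g = k * (1 - 2 * R) := by
  obtain ⟨q, hq, hdvd⟩ := Polynomial.exists_eq_pow_rootMultiplicity_mul_and_not_dvd g.charpoly
    g.charpoly_monic.ne_zero (-1)
  set n := g.charpoly.rootMultiplicity (-1) with hn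
  -- The exponent `n + 1` rather than `n` keeps the power positive even when `-1` is not an
  -- eigenvalue, so that vectors killed by `1 + g` are killed by it. The Bezout identity makes the
  -- projection `R` onto the generalized `-1`-eigenspace a polynomial in `g`, hence commuting with
  -- `e`.
  have hcop : IsCoprime ((Polynomial.X - Polynomial.C (-1 : ℂ)) ^ (n + 1)) q :=
    (((Polynomial.irreducible_X_sub_C (-1 : ℂ)).coprime_iff_not_dvd).2 hdvd).pow_left
  obtain ⟨c, d, hcd⟩ := hcop
  have hX : Polynomial.aeval g (Polynomial.X - Polynomial.C (-1 : ℂ)) = 1 + g := by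
    simp [add_comm]
  set R := Polynomial.aeval g (d * q) with hR
  set S := Polynomial.aeval g c with hS
  have hcomm : ∀ (p : Polynomial ℂ) (T : End ℂ V), Commute g T → Commute (Polynomial.aeval g p) T :=
    fun p T hT => (Polynomial.aeval_eq_sum_range (R := ℂ) (S := End ℂ V) (p := p) g) ▸
      Commute.sum_left _ _ _ fun i _ => (hT.pow_left i).smul_left _
  have h1 : S * (1 + g) ^ (n + 1) + R = 1 := by
    have := congrArg (Polynomial.aeval g) hcd
    rwa [map_add, map_mul, map_pow, hX, map_one] at this
  have h2 : (1 + g) ^ (n + 1) * R = 0 := by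
    rw [← hX, ← map_pow, hR, ← map_mul]
    have : (Polynomial.X - Polynomial.C (-1 : ℂ)) ^ (n + 1) * (d * q) =
        (Polynomial.X - Polynomial.C (-1)) * d * g.charpoly := by
      rw [hq]; ring
    rw [this, map_mul, LinearMap.aeval_self_charpoly, mul_zero]
  have hgR : Commute g R := (hcomm _ g (Commute.refl g)).symm
  have hSR : ∀ x, S (((1 + g) ^ (n + 1)) x) + R x = x := fun x => LinearMap.congr_fun h1 x
  have h1gR : Commute (1 + g) R := (Commute.one_left R).add_left hgR
  have hSg : Commute S (1 + g) :=
    hcomm _ _ ((Commute.one_right g).add_right (Commute.refl g))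
  have h2' : R * (1 + g) ^ (n + 1) = 0 := by rw [← (h1gR.pow_left _).eq, h2]
  have hidem : R * R = R := by
    have : R = (S * (1 + g) ^ (n + 1) + R) * R := by rw [h1, one_mul]
    conv_rhs => rw [this]
    rw [add_mul, mul_assoc, h2, mul_zero, zero_add]
  have hRR : ∀ x, R (R x) = R x := fun x => LinearMap.congr_fun hidem x
  have horth : ∀ x y, B (R x) (y - R y) = 0 := by
    intro x y
    have : y - R y = ((1 + g) ^ (n + 1)) (S y) := by
      rw [← Module.End.mul_apply, ← (hSg.pow_right (n + 1)).eq, sub_eq_iff_eq_add]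
      exact (hSR y).symm
    rw [this, ← pow_one_add_adjoint hg.isometry, ← Module.End.mul_apply _ R, h2]
    simp
  have hproj : IsCentProjection B e R := by
    refine ⟨hcomm _ _ hg.comm, hidem, fun x y => ?_⟩
    have h3 := horth x y
    have h4 := horth y x
    rw [map_sub, sub_eq_zero] at h3 h4
    rw [h3, h.symm, ← h4, h.symm]
  have hss : (1 - 2 * R) * (1 - 2 * R) = 1 := by
    have := hproj.idem
    simp only [two_mul, mul_sub, sub_mul, mul_add, add_mul, one_mul, mul_one, this]
    abel
  -- The operator `g (1 - 2R)` is `-g` on `im R`, where `g` has only the eigenvalue `-1`, and `g` on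
  -- the complement, where `-1` is not an eigenvalue.
  refine ⟨g * (1 - 2 * R), R, ⟨hg.mul hproj.isometry, ?_⟩, hproj, ?_⟩
  · rw [injective_iff_map_eq_zero]
    intro z hz
    have hz' : z + (g z - 2 • g (R z)) = 0 := by
      rw [two_smul, ← map_add, ← map_sub]
      simpa [two_mul] using hz
    have e1 : R z - g (R z) = 0 := by
      have := congrArg R hz'
      rw [map_add, map_sub, map_zero, map_nsmul, ← Module.End.mul_apply R g z,
        ← Module.End.mul_apply R g (R z), ← hgR.eq, Module.End.mul_apply, Module.End.mul_apply,
        hRR, two_smul] at this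
      rw [← this]; abel
    have e2 : ∀ j : ℕ, ((1 + g) ^ j) (R z) = (2 : ℂ) ^ j • R z := by
      intro j
      induction j with
      | zero => simp
      | succ j ih =>
        rw [pow_succ', Module.End.mul_apply, ih, map_smul, LinearMap.add_apply,
          Module.End.one_apply, ← sub_eq_zero.1 e1, ← two_smul ℂ (R z), smul_smul, pow_succ]
    have e3 : R z = 0 := by
      have h5 := e2 (n + 1)
      rw [← Module.End.mul_apply, h2, LinearMap.zero_apply] at h5
      exact (smul_eq_zero.1 h5.symm).resolve_left (pow_ne_zero _ two_ne_zero)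
    have e4 : (1 + g) z = 0 := by
      rw [e3, map_zero, smul_zero, sub_zero] at hz'
      exact hz'
    rw [← hSR z, e3, pow_succ, Module.End.mul_apply, e4]
    simp
  · rw [mul_assoc, hss, mul_one]

theorem mem_reflectionMonoid (h : IsSkewNilpotent B e) {g : End ℂ V}
    (hg : IsCentIsometry B e g) : g ∈ reflectionMonoid B e := by
  obtain ⟨k, R, hk, hR, rfl⟩ := exists_eq_cayley_mul_reflection h hg
  exact Submonoid.mul_mem _ (Submonoid.subset_closure (Or.inl hk)) (reflection_mem h _ R hR le_rfl).1

/-- In `g = k (1 - 2R)` the factor `k` has all `d_b = 1`, so the condition passes to `1 - 2R`, where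
`reflection_mem` applies. -/
theorem mem_cayleyMonoid_iff (h : IsSkewNilpotent B e) {g : End ℂ V}
    (hg : IsCentIsometry B e g) :
    g ∈ cayleyMonoid B e ↔ ∀ b, detOn g (kerRange e b) = 1 := by
  refine ⟨fun hg b => detOn_eq_one_of_mem_cayleyMonoid h hg b, fun hd => ?_⟩
  obtain ⟨k, R, hk, hR, rfl⟩ := exists_eq_cayley_mul_reflection h hg
  refine Submonoid.mul_mem _ (Submonoid.subset_closure hk)
    ((reflection_mem h _ R hR le_rfl).2 fun b => ?_)
  have := hd b
  rwa [detOn_kerRange_mul hk.toIsCentIsometry hR.isometry,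
    detOn_kerRange_eq_one h hk.toIsCentIsometry hk.injective, one_mul] at this

theorem detOn_sq_eq_one (h : IsSkewNilpotent B e) {g : End ℂ V} (hg : IsCentIsometry B e g)
    (b : ℕ) : detOn g (kerRange e b) = 1 ∨ detOn g (kerRange e b) = -1 := by
  have hg' := mem_reflectionMonoid h hg
  induction hg' using Submonoid.closure_induction with
  | mem k hk =>
    rcases hk with hk | ⟨a, u, hu, rfl⟩
    · exact Or.inl (detOn_kerRange_eq_one h hk.toIsCentIsometry hk.injective b)
    · rw [detOn_cyclic h hu]
      split_ifs <;> simp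
  | one => exact Or.inl (detOn_eq_one fun _ _ => rfl)
  | mul k l hk hl hk' hl' =>
    have ik := isCentIsometry_of_mem h hk
    have il := isCentIsometry_of_mem h hl
    rw [detOn_kerRange_mul ik il]
    rcases hk' ik with h1 | h1 <;> rcases hl' il with h2 | h2 <;> simp [h1, h2]

/-- The quotient for odd `b` is symplectic. On generators: a cyclic vector has even `a`, so `b ≤ a`
and `b + 1 ≤ a` are equivalent. -/
theorem detOn_kerRange_odd (h : IsSkewNilpotent B e) {g : End ℂ V} (hg : IsCentIsometry B e g)
    {b : ℕ} (hb : Odd b) : detOn g (kerRange e b) = detOn g (kerRange e (b + 1)) := by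
  have hg' := mem_reflectionMonoid h hg
  induction hg' using Submonoid.closure_induction with
  | mem k hk =>
    rcases hk with hk | ⟨a, u, hu, rfl⟩
    · exact detOn_kerRange_succ h hk.toIsCentIsometry hk.injective b
    · rw [detOn_cyclic h hu, detOn_cyclic h hu]
      have := hu.even h
      have : b ≤ a ↔ b + 1 ≤ a := by
        constructor
        · intro h1
          rcases h1.lt_or_eq with h1 | rfl
          · exact h1
          · exact absurd hb (Nat.not_odd_iff_even.2 this)
        · omega
      simp only [this]
  | one => rw [detOn_eq_one fun _ _ => rfl, detOn_eq_one fun _ _ => rfl]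
  | mul k l hk hl hk' hl' =>
    have ik := isCentIsometry_of_mem h hk
    have il := isCentIsometry_of_mem h hl
    rw [detOn_kerRange_mul ik il, detOn_kerRange_mul ik il, hk' ik, hl' il]

/-- In the product of all `d_i` the factors with indices `2M + 1` and `2M + 2` are equal signs and
cancel, leaving `d_0`. -/
theorem det_eq_detOn_ker (h : IsSkewNilpotent B e) {g : End ℂ V} (hg : IsCentIsometry B e g) :
    LinearMap.det g = detOn g (kerRange e 0) := by
  obtain ⟨N, hN⟩ := h.nil
  -- An odd number of factors, so that those after the zeroth pair up.
  have hN' : e ^ (2 * N + 1) = 0 := by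
    rw [show 2 * N + 1 = N + (N + 1) by ring, pow_add, hN, zero_mul]
  rw [det_eq_prod_kerRange hg.comm hN', Finset.prod_range_succ']
  suffices ∏ i ∈ Finset.range (2 * N), detOn g (kerRange e (i + 1)) = 1 by rw [this, one_mul]
  suffices ∀ M, ∏ i ∈ Finset.range (2 * M), detOn g (kerRange e (i + 1)) = 1 from this N
  intro M
  induction M with
  | zero => simp
  | succ M ih =>
    rw [show 2 * (M + 1) = 2 * M + 1 + 1 by ring, Finset.prod_range_succ, Finset.prod_range_succ,
      ih, one_mul, ← detOn_kerRange_odd h hg ⟨M, rfl⟩]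
    rcases detOn_sq_eq_one h hg (2 * M + 1) with h1 | h1 <;> rw [h1] <;> norm_num

end Generation

/-! ### Continuity in `SO(V)` tested by linear functionals -/

section FunctionalTopology

theorem tendsto_moduleTopology_iff {A X : Type*} [AddCommGroup A] [Module ℂ A]
    [FiniteDimensional ℂ A] {l : Filter X} {f : X → A} {a : A} :
    Tendsto f l (@nhds A (moduleTopology ℂ A) a) ↔
      ∀ φ : A →ₗ[ℂ] ℂ, Tendsto (fun x => φ (f x)) l (𝓝 (φ a)) := by
  let _ : TopologicalSpace A := moduleTopology ℂ A
  have : IsModuleTopology ℂ A := ⟨rfl⟩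
  have := IsModuleTopology.toContinuousAdd ℂ A
  constructor
  · intro hf φ
    exact ((IsModuleTopology.continuous_of_linearMap φ).tendsto a).comp hf
  · intro hf
    let b := finBasis ℂ A
    have h1 : Tendsto (fun x => b.equivFun (f x)) l (𝓝 (b.equivFun a)) :=
      tendsto_pi_nhds.2 fun i => hf (b.coord i)
    have h2 : Continuous b.equivFun.symm.toLinearMap :=
      IsModuleTopology.continuous_of_linearMap _
    have h3 := (h2.tendsto (b.equivFun a)).comp h1
    simpa [Function.comp_def] using h3

variable {V : Type u} [AddCommGroup V] [Module ℂ V] [FiniteDimensional ℂ V]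

theorem end_functional_eq_sum {ι : Type*} [Fintype ι] (b : Basis ι ℂ V) (ψ : End ℂ V →ₗ[ℂ] ℂ)
    (T : End ℂ V) :
    ψ T = ∑ j, ∑ i, b.coord i (T (b j)) * ψ ((b.coord j).smulRight (b i)) := by
  classical
  have : T = ∑ j, ∑ i, b.coord i (T (b j)) • (b.coord j).smulRight (b i) := by
    refine b.ext fun j => ?_
    simp only [LinearMap.sum_apply, LinearMap.smul_apply, LinearMap.smulRight_apply,
      Basis.coord_apply, Basis.repr_self, Finsupp.single_apply]
    rw [Finset.sum_eq_single j]
    · simp only [if_true, one_smul]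
      exact (b.sum_repr _).symm
    · intro k _ hk
      simp [hk.symm]
    · simp
  conv_lhs => rw [this]
  simp only [map_sum, map_smul, smul_eq_mul]

theorem tendsto_end_iff {X : Type*} {l : Filter X} {f : X → End ℂ V} {a : End ℂ V} :
    Tendsto f l (@nhds (End ℂ V) (moduleTopology ℂ (End ℂ V)) a) ↔
      ∀ (v : V) (φ : V →ₗ[ℂ] ℂ), Tendsto (fun x => φ (f x v)) l (𝓝 (φ (a v))) := by
  rw [tendsto_moduleTopology_iff]
  constructor
  · intro hf v φ
    exact hf (φ ∘ₗ LinearMap.applyₗ v)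
  · intro hf ψ
    rw [funext fun x => end_functional_eq_sum (finBasis ℂ V) ψ (f x),
      end_functional_eq_sum (finBasis ℂ V) ψ a]
    exact tendsto_finsetSum _ fun j _ => tendsto_finsetSum _ fun i _ => (hf _ _).mul_const _

variable {Q : QuadraticForm ℂ V}

/-- The underlying endomorphism. -/
def soEnd (g : SO Q) : End ℂ V := ((g : V ≃ₗ[ℂ] V) : V →ₗ[ℂ] V)

theorem soEnd_injective : Function.Injective (soEnd : SO Q → End ℂ V) := fun _ _ hgh =>
  Subtype.ext (LinearEquiv.toLinearMap_injective hgh)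

theorem soEnd_mul (g h : SO Q) : soEnd (g * h) = soEnd g * soEnd h := rfl

theorem soEnd_one : soEnd (1 : SO Q) = 1 := rfl

theorem SO.tendsto_iff {X : Type*} {l : Filter X} {f : X → SO Q} {a : SO Q} :
    Tendsto f l (𝓝 a) ↔
      ∀ (v : V) (φ : V →ₗ[ℂ] ℂ), Tendsto (fun x => φ (soEnd (f x) v)) l (𝓝 (φ (soEnd a v))) := by
  have h1 : 𝓝 a = comap soEnd (@nhds _ (moduleTopology ℂ (End ℂ V)) (soEnd a)) :=
    @nhds_induced _ _ (moduleTopology ℂ (End ℂ V)) soEnd a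
  rw [h1, tendsto_comap_iff]
  exact tendsto_end_iff

theorem SO.continuous_iff {X : Type*} [TopologicalSpace X] {f : X → SO Q} :
    Continuous f ↔ ∀ (v : V) (φ : V →ₗ[ℂ] ℂ), Continuous (fun x => φ (soEnd (f x) v)) := by
  simp only [continuous_iff_continuousAt, ContinuousAt, SO.tendsto_iff]
  exact ⟨fun h v φ x => h x v φ, fun h x v φ => h v φ x⟩

theorem SO.continuous_apply (v : V) (φ : V →ₗ[ℂ] ℂ) : Continuous fun g : SO Q => φ (soEnd g v) :=
  SO.continuous_iff.1 continuous_id v φ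

theorem continuous_detOn {X : Type*} [TopologicalSpace X] {f : X → SO Q} (hf : Continuous f)
    {p : Submodule ℂ V} (hp : ∀ x, ∀ v ∈ p, soEnd (f x) v ∈ p) :
    Continuous fun x => detOn (soEnd (f x)) p := by
  classical
  let c := finBasis ℂ p
  have h1 : (fun x => detOn (soEnd (f x)) p) =
      fun x => (LinearMap.toMatrix c c ((soEnd (f x)).restrict (hp x))).det := by
    funext x
    rw [detOn_eq (hp x), LinearMap.det_toMatrix]
  rw [h1]
  refine Continuous.matrix_det (continuous_matrix fun i j => ?_)
  obtain ⟨φ, hφ⟩ := LinearMap.exists_extend (c.coord i)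
  have h2 : (fun x => LinearMap.toMatrix c c ((soEnd (f x)).restrict (hp x)) i j) =
      fun x => φ (soEnd (f x) (c j)) := by
    funext x
    rw [LinearMap.toMatrix_apply, ← Basis.coord_apply, ← hφ]
    rfl
  rw [h2]
  exact SO.continuous_iff.1 hf _ _

end FunctionalTopology

/-! ### Pencils of endomorphisms -/

section Pencil

/-- The determinant is a polynomial in `t`, nonzero at `t = 0`, and the complement of its finitely
many roots in the real plane `ℂ` is path connected. -/
theorem isPreconnected_pencil {V : Type*} [AddCommGroup V] [Module ℂ V] [FiniteDimensional ℂ V]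
    (S T : End ℂ V) (h0 : LinearMap.det S ≠ 0) :
    IsPreconnected {t : ℂ | LinearMap.det (S + t • T) ≠ 0} := by
  classical
  let b := finBasis ℂ V
  let M := LinearMap.toMatrix b b S
  let N := LinearMap.toMatrix b b T
  let p : Polynomial ℂ := (M.map (Polynomial.C (R := ℂ)) + (Polynomial.X : Polynomial ℂ) • N.map (Polynomial.C (R := ℂ))).det
  have hp : ∀ t, p.eval t = LinearMap.det (S + t • T) := by
    intro t
    rw [← LinearMap.det_toMatrix b, ← Polynomial.coe_evalRingHom, RingHom.map_det]
    congr 1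
    ext i j
    simp [M, N, mul_comm t]
  have hp0 : p ≠ 0 := by
    intro h
    have := hp 0
    rw [h, zero_smul, add_zero] at this
    exact h0 (by rw [← this]; simp)
  have hset : {t : ℂ | LinearMap.det (S + t • T) ≠ 0} = {t | p.IsRoot t}ᶜ := by
    ext t
    simp [Polynomial.IsRoot, hp]
  rw [hset]
  refine (Set.Countable.isPathConnected_compl_of_one_lt_rank ?_ ?_).isConnected.isPreconnected
  · rw [Complex.rank_real_complex]
    norm_num
  · exact (Polynomial.finite_setOfPred_isRoot hp0).countable

/-- The inverse of a pencil of endomorphisms depends continuously on the parameter. -/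
theorem exists_continuous_inverse {V X : Type*} [AddCommGroup V] [Module ℂ V]
    [FiniteDimensional ℂ V] [TopologicalSpace X] (D N : X → End ℂ V)
    (hD : ∀ (v : V) (φ : V →ₗ[ℂ] ℂ), Continuous fun x => φ (D x v))
    (hN : ∀ (v : V) (φ : V →ₗ[ℂ] ℂ), Continuous fun x => φ (N x v))
    (hdet : ∀ x, LinearMap.det (D x) ≠ 0) :
    ∃ E : X → End ℂ V, (∀ x, D x * E x = 1) ∧
      ∀ (v : V) (φ : V →ₗ[ℂ] ℂ), Continuous fun x => φ ((N x * E x) v) := by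
  classical
  let b := finBasis ℂ V
  let M := fun x => LinearMap.toMatrix b b (D x)
  have hM : Continuous M := continuous_matrix fun i j => by
    simp only [M, LinearMap.toMatrix_apply, ← Basis.coord_apply]
    exact hD _ _
  have hMdet : ∀ x, (M x).det = LinearMap.det (D x) := fun x => LinearMap.det_toMatrix b _
  have hinv : Continuous fun x => (M x)⁻¹ := by
    simp only [Matrix.inv_def, Ring.inverse_eq_inv']
    exact (hM.matrix_det.inv₀ fun x => by rw [hMdet]; exact hdet x).smul hM.matrix_adjugate
  refine ⟨fun x => Matrix.toLin b b (M x)⁻¹, fun x => ?_, fun v φ => ?_⟩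
  · have h1 : D x = (Matrix.toLin b b (M x) : End ℂ V) := (Matrix.toLin_toMatrix b b _).symm
    rw [h1, Module.End.mul_eq_comp, ← Matrix.toLin_mul b b b, Matrix.mul_nonsing_inv,
      Matrix.toLin_one]
    · rfl
    · rw [hMdet]
      exact (hdet x).isUnit
  · have h2 : (fun x => φ ((N x * Matrix.toLin b b (M x)⁻¹) v)) = fun x =>
        ∑ i, ((M x)⁻¹.mulVec (b.repr v)) i * φ (N x (b i)) := by
      funext x
      rw [Module.End.mul_apply, Matrix.toLin_apply]
      simp
    rw [h2]
    refine continuous_finsetSum _ fun i _ => Continuous.mul ?_ (hN _ _)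
    exact (continuous_apply i).comp (hinv.matrix_mulVec continuous_const)

end Pencil

/-! ### The identity component of the centralizer in `SO(V)` -/

section ComponentSO

variable {V : Type u} [AddCommGroup V] [Module ℂ V] [FiniteDimensional ℂ V]
variable {Q : QuadraticForm ℂ V} {e : End ℂ V}

theorem isSkewNilpotent_of_mem_soAlgebra (hQ : (QuadraticMap.polarBilin Q).Nondegenerate)
    (he : e ∈ soAlgebra Q) (hnil : IsNilpotent e) :
    IsSkewNilpotent (QuadraticMap.polarBilin Q) e where
  symm x y := QuadraticMap.polar_comm Q x y
  nondeg := hQ.1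
  skew x y := by
    have := (LinearMap.mem_skewAdjointSubmodule e).1 he x y
    rw [this]
    simp
  nil := hnil

theorem quadratic_eq_half_polar (x : V) : Q x = QuadraticMap.polarBilin Q x x / 2 := by
  rw [QuadraticMap.polarBilin_apply_apply, QuadraticMap.polar_self]
  ring

theorem isCentIsometry_toEnd (g : centralizerSO Q e) :
    IsCentIsometry (QuadraticMap.polarBilin Q) e (soEnd (g : SO Q)) where
  isometry x y := by
    have h1 : ∀ v, Q (soEnd (g : SO Q) v) = Q v := (g : SO Q).2.1
    simp only [QuadraticMap.polarBilin_apply_apply, QuadraticMap.polar, ← map_add, h1]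
  comm := LinearMap.ext g.2

theorem det_toEnd (g : SO Q) : LinearMap.det (soEnd g) = 1 := g.2.2

theorem exists_centralizerSO {k : End ℂ V}
    (hk : IsCentIsometry (QuadraticMap.polarBilin Q) e k) (hdet : LinearMap.det k = 1) :
    ∃ g : centralizerSO Q e, soEnd (g : SO Q) = k := by
  have hu : IsUnit (LinearMap.det k) := by rw [hdet]; exact isUnit_one
  refine ⟨⟨⟨LinearMap.equivOfDetNeZero k hu.ne_zero, ?_, ?_⟩, ?_⟩, ?_⟩
  · intro v
    rw [quadratic_eq_half_polar, quadratic_eq_half_polar v]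
    exact congrArg (· / 2) (hk.isometry v v)
  · exact hdet
  · intro v
    exact comm_apply hk.comm v
  · rfl

theorem det_ne_zero_of_injective {T : End ℂ V} (hT : Function.Injective T) :
    LinearMap.det T ≠ 0 :=
  ((LinearMap.isUnit_iff_isUnit_det T).1 ((Module.End.isUnit_iff T).2
    ⟨hT, LinearMap.injective_iff_surjective.1 hT⟩)).ne_zero

theorem IsCayley.det_eq_one (h : IsSkewNilpotent (QuadraticMap.polarBilin Q) e) {k : End ℂ V}
    (hk : IsCayley (QuadraticMap.polarBilin Q) e k) : LinearMap.det k = 1 :=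
  det_eq_one_of_isometry _ h.nondeg k hk.isometry (det_ne_zero_of_injective hk.injective)

/-- The Cayley path `t ↦ ((1 + k) - t (1 - k)) ((1 + k) + t (1 - k))⁻¹` joins `1` to `k`. -/
theorem mem_identityComponent_of_isCayley (h : IsSkewNilpotent (QuadraticMap.polarBilin Q) e)
    (g : centralizerSO Q e) (hg : Function.Injective (1 + soEnd (g : SO Q) : End ℂ V)) :
    g ∈ identityComponent (centralizerSO Q e) := by
  set k := soEnd (g : SO Q) with hk
  have hkc := isCentIsometry_toEnd g
  rw [← hk] at hkc
  set U := {t : ℂ | LinearMap.det ((1 + k) + t • (1 - k)) ≠ 0} with hU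
  have hUc : IsPreconnected U := isPreconnected_pencil _ _ (det_ne_zero_of_injective hg)
  have : PreconnectedSpace U := Subtype.preconnectedSpace hUc
  obtain ⟨E, hE, hcont⟩ := exists_continuous_inverse (X := U)
    (fun t => (1 + k) + (t : ℂ) • (1 - k)) (fun t => (1 + k) - (t : ℂ) • (1 - k))
    (fun v φ => by
      simp only [LinearMap.add_apply, LinearMap.smul_apply, map_add, map_smul, smul_eq_mul]
      fun_prop)
    (fun v φ => by
      simp only [LinearMap.sub_apply, LinearMap.smul_apply, map_sub, map_smul, smul_eq_mul]
      fun_prop) (fun t => t.2)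
  set N : U → End ℂ V := fun t => (1 + k) - (t : ℂ) • (1 - k) with hN
  set D : U → End ℂ V := fun t => (1 + k) + (t : ℂ) • (1 - k) with hD
  have hE' : ∀ t, E t * D t = 1 := fun t => mul_eq_one_comm.1 (hE t)
  -- Numerator and denominator pull back the form to the same form, so their quotient is an
  -- isometry.
  have hND : ∀ t x y, QuadraticMap.polarBilin Q (N t x) (N t y) =
      QuadraticMap.polarBilin Q (D t x) (D t y) := by
    intro t x y
    have h3 := hkc.isometry x y
    simp only [hN, hD, LinearMap.add_apply, LinearMap.sub_apply, LinearMap.smul_apply,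
      Module.End.one_apply, map_add, map_sub, map_smul, smul_eq_mul]
    linear_combination (4 * (t : ℂ)) * h3
  have hDE : ∀ t x, D t (E t x) = x := fun t x => LinearMap.congr_fun (hE t) x
  have hED : ∀ t x, E t (D t x) = x := fun t x => LinearMap.congr_fun (hE' t) x
  have h1c : Commute (1 + k) e := (Commute.one_left e).add_left hkc.comm
  have h2c : Commute (1 - k) e := (Commute.one_left e).sub_left hkc.comm
  have hDc : ∀ t, Commute (D t) e := fun t => h1c.add_left (h2c.smul_left _)
  have hNc : ∀ t, Commute (N t) e := fun t => h1c.sub_left (h2c.smul_left _)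
  have hEc : ∀ t, Commute (E t) e := by
    intro t
    refine LinearMap.ext fun x => ?_
    rw [Module.End.mul_apply, Module.End.mul_apply]
    rw [← hED t (e (E t x)), comm_apply (hDc t), hDE]
  have hiso : ∀ t, IsCentIsometry (QuadraticMap.polarBilin Q) e (N t * E t) := fun t =>
    ⟨fun x y => by rw [Module.End.mul_apply, Module.End.mul_apply, hND, hDE, hDE],
      (hNc t).mul_left (hEc t)⟩
  -- From `D + N = 2 (1 + k)` one gets `1 + N D⁻¹ = 2 (1 + k) D⁻¹`, which is invertible; thus the
  -- whole path avoids the eigenvalue `-1` and has determinant `1`.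
  have hcay : ∀ t, IsCayley (QuadraticMap.polarBilin Q) e (N t * E t) := by
    intro t
    refine ⟨hiso t, ?_⟩
    rw [injective_iff_map_eq_zero]
    intro x hx
    have h1 : (2 : ℂ) • (1 + k) (E t x) = 0 := by
      have h2 : D t (E t x) + N t (E t x) = 0 := by rw [hDE]; exact hx
      rw [← h2]
      simp only [hN, hD, LinearMap.add_apply, LinearMap.sub_apply, two_smul]
      abel
    have h2 : E t x = 0 := hg (by
      rw [map_zero]
      exact (smul_eq_zero.1 h1).resolve_left two_ne_zero)
    rw [← hDE t x, h2, map_zero]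
  choose f hf using fun t => exists_centralizerSO (hiso t) ((hcay t).det_eq_one h)
  have hfc : Continuous f := by
    rw [continuous_induced_rng, SO.continuous_iff]
    intro v φ
    simp only [Function.comp_apply, hf]
    exact hcont v φ
  -- At `t = 0` the two pencils coincide; at `t = 1` they are `2k` and `2`.
  have m0 : (0 : ℂ) ∈ U := by
    simpa [hU] using det_ne_zero_of_injective hg
  have m1 : (1 : ℂ) ∈ U := by
    have : (1 + k) + (1 : ℂ) • (1 - k) = (2 : ℂ) • 1 := by
      rw [one_smul, two_smul]; abel
    rw [hU, Set.mem_ofPred_eq, this, LinearMap.det_smul]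
    simp
  have f0 : f ⟨0, m0⟩ = 1 := by
    refine Subtype.ext (soEnd_injective ?_)
    have e0 : N ⟨0, m0⟩ = D ⟨0, m0⟩ := by simp [hN, hD]
    rw [hf, e0]
    exact hE _
  have f1 : f ⟨1, m1⟩ = g := by
    refine Subtype.ext (soEnd_injective ?_)
    rw [hf, ← hk]
    have e1 : N ⟨1, m1⟩ = k * D ⟨1, m1⟩ := by
      simp only [hN, hD, one_smul]
      rw [mul_add, mul_add, mul_sub]
      simp only [mul_one]
      abel
    rw [e1, mul_assoc, hE, mul_one]
  have hpre : IsPreconnected (Set.range f) := isPreconnected_range hfc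
  have := hpre.subset_connectedComponent ⟨_, f0⟩ ⟨_, f1⟩
  exact this

theorem exists_identityComponent_of_mem_cayleyMonoid
    (h : IsSkewNilpotent (QuadraticMap.polarBilin Q) e) {k : End ℂ V}
    (hk : k ∈ cayleyMonoid (QuadraticMap.polarBilin Q) e) :
    ∃ g ∈ identityComponent (centralizerSO Q e), soEnd (g : SO Q) = k := by
  induction hk using Submonoid.closure_induction with
  | mem k hk =>
    obtain ⟨g, rfl⟩ := exists_centralizerSO hk.toIsCentIsometry (IsCayley.det_eq_one h hk)
    exact ⟨g, mem_identityComponent_of_isCayley h g hk.injective, rfl⟩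
  | one => exact ⟨1, Subgroup.one_mem _, rfl⟩
  | mul k l _ _ hk hl =>
    obtain ⟨g, hg, rfl⟩ := hk
    obtain ⟨g', hg', rfl⟩ := hl
    exact ⟨g * g', Subgroup.mul_mem _ hg hg', rfl⟩

/-- Each `d_b` is continuous with values in `{1, -1}`, hence constant on the connected component of
`1`. Conversely `mem_cayleyMonoid_iff` writes `g` as a product of elements joined to `1` by Cayley
paths. -/
theorem mem_identityComponent_iff (h : IsSkewNilpotent (QuadraticMap.polarBilin Q) e)
    (g : centralizerSO Q e) :
    g ∈ identityComponent (centralizerSO Q e) ↔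
      ∀ b, detOn (soEnd (g : SO Q)) (kerRange e b) = 1 := by
  constructor
  · intro hg b
    have hc : Continuous fun g : centralizerSO Q e =>
        detOn (soEnd (g : SO Q)) (kerRange e b) :=
      continuous_detOn continuous_subtype_val
        fun g => kerRange_stable (isCentIsometry_toEnd g).comm b
    have h1 : IsPreconnected (connectedComponent (1 : centralizerSO Q e)) :=
      isPreconnected_connectedComponent
    have hfin : ({1, -1} : Set ℂ).Finite := by simp
    have := h1.constant_of_mapsTo (T := ({1, -1} : Set ℂ)) hfin.isDiscrete hc.continuousOn
      (fun x _ => detOn_sq_eq_one h (isCentIsometry_toEnd x) b) hg mem_connectedComponent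
    rw [this]
    exact detOn_eq_one fun _ _ => rfl
  · intro hd
    obtain ⟨g', hg', hgg⟩ := exists_identityComponent_of_mem_cayleyMonoid h
      ((mem_cayleyMonoid_iff h (isCentIsometry_toEnd g)).2 hd)
    rwa [← Subtype.ext (soEnd_injective hgg)]

end ComponentSO

/-! ### Jumps of the determinants at the odd block sizes -/

section OddSizes

variable {V : Type*} [AddCommGroup V] [Module ℂ V] [FiniteDimensional ℂ V]
variable {B : V →ₗ[ℂ] V →ₗ[ℂ] ℂ} {e : End ℂ V}

theorem blockCount_succ (a : ℕ) :
    blockCount e (a + 1) = finrank ℂ (kerRange e a) - finrank ℂ (kerRange e (a + 1)) := rfl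

theorem kerRange_eq_of_blockCount {a : ℕ} (h : blockCount e (a + 1) = 0) :
    kerRange e (a + 1) = kerRange e a := by
  rw [blockCount_succ] at h
  exact Submodule.eq_of_le_of_finrank_le (kerRange_succ_le a) (by omega)

theorem finite_blockCount_pos (hnil : IsNilpotent e) :
    {j : ℕ | Odd j ∧ 0 < blockCount e j}.Finite := by
  obtain ⟨N, hN⟩ := hnil
  refine (Set.finite_le_nat N).subset ?_
  rintro j ⟨hj, hpos⟩
  by_contra hlt
  obtain ⟨a, rfl⟩ := Nat.exists_eq_succ_of_ne_zero hj.pos.ne'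
  have hlt : N < a + 1 := not_le.1 hlt
  rw [Nat.succ_eq_add_one, blockCount_succ, kerRange_eq_bot hN (by omega : N ≤ a)] at hpos
  simp at hpos

/-- The form induced on `ker e^(a+1)` separates vectors of `ker e ∩ im e^a` from
`ker e ∩ im e^(a+1)`. -/
theorem exists_pairing_of_notMem (h : IsSkewNilpotent B e) {a : ℕ} {p : V}
    (hp : p ∈ kerRange e a) (hp' : p ∉ kerRange e (a + 1)) :
    ∃ u w, (e ^ (a + 1)) u = 0 ∧ (e ^ (a + 1)) w = 0 ∧ (e ^ a) u = p ∧ B p w ≠ 0 := by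
  have h1 : ¬ ∀ y ∈ LinearMap.ker (e ^ (a + 1)), B p y = 0 := fun hall =>
    hp' ⟨hp.1, (h.mem_range_pow_iff (a + 1) p).2 hall⟩
  push Not at h1
  obtain ⟨w, hw, hpw⟩ := h1
  obtain ⟨hker, ⟨u, rfl⟩⟩ := hp
  refine ⟨u, w, ?_, hw, rfl, hpw⟩
  rw [pow_succ', Module.End.mul_apply]
  exact hker

/-- Polarization: for even `a` the form `B (e^a x) y` is symmetric. -/
theorem exists_self_pairing (h : IsSkewNilpotent B e) {a : ℕ} (ha : Even a) {u w : V}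
    (hu : (e ^ (a + 1)) u = 0) (hw : (e ^ (a + 1)) w = 0) (huw : B ((e ^ a) u) w ≠ 0) :
    ∃ v ∈ Submodule.span ℂ {u, w}, (e ^ (a + 1)) v = 0 ∧ B ((e ^ a) v) v ≠ 0 := by
  by_contra! hc
  have mu : u ∈ Submodule.span ℂ {u, w} := Submodule.subset_span (by simp)
  have mw : w ∈ Submodule.span ℂ {u, w} := Submodule.subset_span (by simp)
  have h1 := hc u mu hu
  have h2 := hc w mw hw
  have h3 := hc (u + w) (add_mem mu mw) (by rw [map_add, hu, hw, add_zero])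
  rw [map_add, map_add, map_add, LinearMap.add_apply, LinearMap.add_apply, h1, h2,
    h.swap_pairing a u w, ha.neg_one_pow] at h3
  apply huw
  linear_combination h3 / 2

theorem exists_cyclicVector_of_blockCount (h : IsSkewNilpotent B e) {a : ℕ} (ha : Even a)
    (hpos : 0 < blockCount e (a + 1)) : ∃ u, IsCyclicVector B e a u := by
  have hne : ¬ kerRange e a ≤ kerRange e (a + 1) := fun hle => by
    rw [blockCount_succ, le_antisymm (kerRange_succ_le a) hle] at hpos
    simp at hpos
  obtain ⟨p, hp, hp'⟩ := SetLike.not_le_iff_exists.1 hne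
  obtain ⟨u, w, hu, hw, rfl, huw⟩ := exists_pairing_of_notMem h hp hp'
  obtain ⟨v, -, hv, hvv⟩ := exists_self_pairing h ha hu hw huw
  obtain ⟨v', -, hv'⟩ := h.exists_cyclicVector (W := ⊤) (fun _ _ => trivial) trivial hv hvv
  exact ⟨v', hv'⟩

/-- The jump of `det (g | ker e ∩ im e^b)` at `b = a`. -/
noncomputable def jump (e g : End ℂ V) (a : ℕ) : ℂ :=
  detOn g (kerRange e a) * detOn g (kerRange e (a + 1))

theorem jump_eq (h : IsSkewNilpotent B e) {g : End ℂ V} (hg : IsCentIsometry B e g) (a : ℕ) :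
    jump e g a = 1 ∨ jump e g a = -1 := by
  rw [jump]
  rcases detOn_sq_eq_one h hg a with h1 | h1 <;>
    rcases detOn_sq_eq_one h hg (a + 1) with h2 | h2 <;> simp [h1, h2]

theorem jump_mul {g k : End ℂ V} (hg : IsCentIsometry B e g) (hk : IsCentIsometry B e k) (a : ℕ) :
    jump e (g * k) a = jump e g a * jump e k a := by
  simp only [jump, detOn_kerRange_mul hg hk]
  ring

theorem jump_cyclic (h : IsSkewNilpotent B e) {a : ℕ} {u : V} (hu : IsCyclicVector B e a u)
    (b : ℕ) : jump e (1 - 2 * chainOp B e a u u) b = if b = a then -1 else 1 := by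
  rw [jump, detOn_cyclic h hu, detOn_cyclic h hu]
  rcases lt_trichotomy b a with hb | rfl | hb
  · rw [if_pos hb.le, if_pos (by omega : b + 1 ≤ a), if_neg hb.ne]; norm_num
  · simp
  · rw [if_neg (by omega), if_neg (by omega), if_neg (by omega)]; norm_num

theorem detOn_succ_of_jump (h : IsSkewNilpotent B e) {g : End ℂ V} (hg : IsCentIsometry B e g)
    {b : ℕ} (hj : Even b → 0 < blockCount e (b + 1) → jump e g b = 1) :
    detOn g (kerRange e b) = detOn g (kerRange e (b + 1)) := by
  rcases Nat.even_or_odd b with hb | hb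
  · rcases Nat.eq_zero_or_pos (blockCount e (b + 1)) with h0 | hpos
    · rw [kerRange_eq_of_blockCount h0]
    · have := hj hb hpos
      rw [jump] at this
      rcases detOn_sq_eq_one h hg b with h1 | h1 <;>
        rcases detOn_sq_eq_one h hg (b + 1) with h2 | h2 <;> rw [h1, h2] at this ⊢ <;>
        norm_num at this
  · exact detOn_kerRange_odd h hg hb

theorem detOn_eq_one_of_jump_of_lt (h : IsSkewNilpotent B e) {g : End ℂ V}
    (hg : IsCentIsometry B e g) {c : ℕ}
    (hj : ∀ b, c ≤ b → Even b → 0 < blockCount e (b + 1) → jump e g b = 1) {b : ℕ} (hb : c ≤ b) :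
    detOn g (kerRange e b) = 1 := by
  obtain ⟨N, hN⟩ := h.nil
  have key : ∀ i, detOn g (kerRange e b) = detOn g (kerRange e (b + i)) := by
    intro i
    induction i with
    | zero => rfl
    | succ i ih => rw [ih, detOn_succ_of_jump h hg (hj (b + i) (by omega)), add_assoc]
  rw [key N, kerRange_eq_bot hN (Nat.le_add_left N b), detOn_bot]

/-- One unknown jump is harmless: beyond `c` the `d_b` agree with their eventual value `1`, and up
to `c` they agree with `d_0 = det g = 1`. -/
theorem detOn_eq_one_of_det (h : IsSkewNilpotent B e) {g : End ℂ V}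
    (hg : IsCentIsometry B e g) (hdet : LinearMap.det g = 1) {c : ℕ}
    (hj : ∀ b, b ≠ c → Even b → 0 < blockCount e (b + 1) → jump e g b = 1) (b : ℕ) :
    detOn g (kerRange e b) = 1 := by
  rcases Nat.lt_or_ge c b with hb | hb
  · exact detOn_eq_one_of_jump_of_lt h hg (c := c + 1) (fun b' h' => hj b' (by omega)) hb
  · induction b with
    | zero => rw [← det_eq_detOn_ker h hg, hdet]
    | succ b ih =>
      rw [← detOn_succ_of_jump h hg (hj b (by omega)), ih (by omega)]

end OddSizes

/-! ### The component group for `SO(V)` -/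

section ComponentGroupSO

variable {V : Type u} [AddCommGroup V] [Module ℂ V] [FiniteDimensional ℂ V]
variable {Q : QuadraticForm ℂ V} {e : End ℂ V}

open Classical in
/-- A sign as an element of `ℤ/2`. -/
noncomputable def signClass (c : ℂ) : Multiplicative (ZMod 2) :=
  if c = 1 then 1 else Multiplicative.ofAdd 1

theorem signClass_mul {c d : ℂ} (hc : c = 1 ∨ c = -1) (hd : d = 1 ∨ d = -1) :
    signClass (c * d) = signClass c * signClass d := by
  have h1 : (-1 : ℂ) ≠ 1 := by norm_num
  have h2 : (Multiplicative.ofAdd 1 : Multiplicative (ZMod 2)) * Multiplicative.ofAdd 1 = 1 := by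
    decide
  rcases hc with rfl | rfl <;> rcases hd with rfl | rfl <;> simp [signClass, h1, h2]

theorem signClass_eq_one {c : ℂ} : signClass c = 1 ↔ c = 1 := by
  unfold signClass
  split_ifs with h
  · simp [h]
  · simp [h]

/-- The jumps at a family of block sizes. -/
noncomputable def jumpHom (h : IsSkewNilpotent (QuadraticMap.polarBilin Q) e) {I : Type*}
    (a : I → ℕ) : centralizerSO Q e →* (I → Multiplicative (ZMod 2)) where
  toFun g i := signClass (jump e (soEnd (g : SO Q)) (a i))
  map_one' := by
    funext i
    rw [Pi.one_apply, signClass_eq_one, jump]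
    change detOn 1 _ * detOn 1 _ = 1
    rw [detOn_eq_one fun _ _ => rfl, detOn_eq_one fun _ _ => rfl, one_mul]
  map_mul' g k := by
    funext i
    rw [Pi.mul_apply, ← signClass_mul (jump_eq h (isCentIsometry_toEnd g) _)
      (jump_eq h (isCentIsometry_toEnd k) _),
      ← jump_mul (isCentIsometry_toEnd g) (isCentIsometry_toEnd k)]
    rfl

theorem cyclicReflection_det (h : IsSkewNilpotent (QuadraticMap.polarBilin Q) e) {a : ℕ} {u : V}
    (hu : IsCyclicVector (QuadraticMap.polarBilin Q) e a u) :
    LinearMap.det (1 - 2 * chainOp (QuadraticMap.polarBilin Q) e a u u) = -1 := by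
  rw [det_eq_detOn_ker h (hu.projection h).isometry, detOn_cyclic h hu, if_pos a.zero_le]

/-- A single reflection at size `a i + 1` has determinant `-1`. Multiplying it by one at the spare
size `c + 1`, not in the family, restores determinant `1` and leaves the recorded jumps unchanged.
-/
theorem jumpHom_surjective (h : IsSkewNilpotent (QuadraticMap.polarBilin Q) e) {I : Type*}
    [Finite I] {a : I → ℕ} (ha : Function.Injective a) (hev : ∀ i, Even (a i))
    (hpos : ∀ i, 0 < blockCount e (a i + 1)) {c : ℕ} (hc : Even c)
    (hcpos : 0 < blockCount e (c + 1)) (hac : ∀ i, a i ≠ c) :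
    Function.Surjective (jumpHom h a) := by
  classical
  rw [← MonoidHom.range_eq_top, eq_top_iff]
  rintro f -
  refine Subgroup.pi_mem_of_mulSingle_mem f fun i => ?_
  have hcases : f i = 1 ∨ f i = Multiplicative.ofAdd 1 := by
    generalize f i = x
    revert x
    decide
  rcases hcases with hf | hf
  · rw [hf, Pi.mulSingle_one]
    exact Subgroup.one_mem _
  · obtain ⟨u, hu⟩ := exists_cyclicVector_of_blockCount h (hev i) (hpos i)
    obtain ⟨w, hw⟩ := exists_cyclicVector_of_blockCount h hc hcpos
    have iu := (hu.projection h).isometry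
    have iw := (hw.projection h).isometry
    obtain ⟨g, hg⟩ := exists_centralizerSO (iu.mul iw) (by
      rw [map_mul, cyclicReflection_det h hu, cyclicReflection_det h hw]; norm_num)
    refine ⟨g, funext fun j => ?_⟩
    change signClass (jump e (soEnd (g : SO Q)) (a j)) = _
    rw [hg, jump_mul iu iw, jump_cyclic h hu, jump_cyclic h hw, if_neg (hac j), mul_one, hf]
    by_cases hij : j = i
    · subst hij
      rw [if_pos rfl, Pi.mulSingle_eq_same, signClass, if_neg (by norm_num)]
    · rw [if_neg (fun h' => hij (ha h')), Pi.mulSingle_eq_of_ne hij, signClass_eq_one]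

theorem componentGroupSO_equiv (h : IsSkewNilpotent (QuadraticMap.polarBilin Q) e)
    (hm : 0 < numOddSizes e) :
    Nonempty (componentGroupSO Q e ≃*
        (Fin (numOddSizes e - 1) → Multiplicative (ZMod 2))) := by
  set J := {j : ℕ | Odd j ∧ 0 < blockCount e j} with hJ
  have hfin : J.Finite := finite_blockCount_pos h.nil
  -- One odd size `j₀` is left out, its jump being determined by the others through `det g = 1`;
  -- this accounts for `m - 1`.
  obtain ⟨j₀, hj₀⟩ : J.Nonempty := by
    rw [← Set.ncard_pos hfin]
    exact hm
  have hcard : (J \ {j₀}).ncard = numOddSizes e - 1 := Set.ncard_sdiff_singleton_of_mem hj₀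
  have hfin' : (J \ {j₀}).Finite := hfin.sdiff
  have := hfin'.to_subtype
  obtain E : Fin (numOddSizes e - 1) ≃ ↥(J \ {j₀}) :=
    (Finite.equivFinOfCardEq (by rw [Nat.card_coe_set_eq, hcard])).symm
  let a : Fin (numOddSizes e - 1) → ℕ := fun i => (E i : ℕ) - 1
  have hodd : ∀ j ∈ J, j - 1 + 1 = j := fun j hj => by have := hj.1.pos; omega
  have hevJ : ∀ j ∈ J, Even (j - 1) := fun j hj => by
    obtain ⟨k, rfl⟩ := hj.1
    simp
  have hpred : ∀ i ∈ J, ∀ j ∈ J, i - 1 = j - 1 → i = j := fun i hi j hj hij => by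
    rw [← hodd i hi, ← hodd j hj, hij]
  have hinj : Function.Injective a := fun i j hij =>
    E.injective (Subtype.ext (hpred _ (E i).2.1 _ (E j).2.1 hij))
  have hsurj := jumpHom_surjective h hinj (fun i => hevJ _ (E i).2.1)
    (fun i => by simp only [a]; rw [hodd _ (E i).2.1]; exact (E i).2.1.2)
    (hevJ j₀ hj₀) (by rw [hodd _ hj₀]; exact hj₀.2)
    (fun i hi => (E i).2.2 (hpred _ (E i).2.1 _ hj₀ hi))
  have hker : identityComponent (centralizerSO Q e) = (jumpHom h a).ker := by
    ext g
    have hg := isCentIsometry_toEnd g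
    rw [mem_identityComponent_iff h, MonoidHom.mem_ker]
    constructor
    · intro hd
      funext i
      change signClass (jump e (soEnd (g : SO Q)) (a i)) = 1
      rw [signClass_eq_one, jump, hd, hd, one_mul]
    · intro hk
      refine detOn_eq_one_of_det h hg (det_toEnd _) (c := j₀ - 1) fun b hb hbev hbpos => ?_
      have hmem : b + 1 ∈ J \ {j₀} := ⟨⟨hbev.add_one, hbpos⟩, fun h' => hb (by
        rw [← Set.mem_singleton_iff.1 h', Nat.add_sub_cancel])⟩
      obtain ⟨i, hi⟩ := E.surjective ⟨b + 1, hmem⟩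
      have h1 := congrFun hk i
      change signClass (jump e (soEnd (g : SO Q)) (a i)) = 1 at h1
      rw [signClass_eq_one] at h1
      have h2 : a i = b := by simp [a, hi]
      rwa [h2] at h1
  exact ⟨(QuotientGroup.quotientMulEquivOfEq hker).trans
    (QuotientGroup.quotientKerEquivOfSurjective _ hsurj)⟩

theorem identityComponent_eq_top (h : IsSkewNilpotent (QuadraticMap.polarBilin Q) e)
    (hm : numOddSizes e = 0) : identityComponent (centralizerSO Q e) = ⊤ := by
  have hempty : {j : ℕ | Odd j ∧ 0 < blockCount e j} = ∅ :=
    (Set.ncard_eq_zero (finite_blockCount_pos h.nil)).1 hm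
  rw [eq_top_iff]
  rintro g -
  rw [mem_identityComponent_iff h]
  intro b
  refine detOn_eq_one_of_jump_of_lt h (isCentIsometry_toEnd g) (c := 0)
    (fun b' _ hev hpos => ?_) b.zero_le
  have : b' + 1 ∈ ({j : ℕ | Odd j ∧ 0 < blockCount e j} : Set ℕ) := ⟨hev.add_one, hpos⟩
  rw [hempty] at this
  exact this.elim

theorem subsingleton_componentGroupSO (h : IsSkewNilpotent (QuadraticMap.polarBilin Q) e)
    (hm : numOddSizes e = 0) : Subsingleton (componentGroupSO Q e) := by
  refine ⟨fun x y => ?_⟩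
  obtain ⟨x, rfl⟩ := QuotientGroup.mk_surjective x
  obtain ⟨y, rfl⟩ := QuotientGroup.mk_surjective y
  rw [QuotientGroup.eq, identityComponent_eq_top h hm]
  trivial

/-- `SO(V)` is connected. -/
theorem mem_connectedComponent_one_SO (hQ : (QuadraticMap.polarBilin Q).Nondegenerate)
    (g : SO Q) : g ∈ connectedComponent (1 : SO Q) := by
  -- For `e = 0` the centralizer is all of `SO(V)`, and the only nontrivial `d_b` is `d_0 = det`.
  have h0 : IsSkewNilpotent (QuadraticMap.polarBilin Q) (0 : End ℂ V) :=
    isSkewNilpotent_of_mem_soAlgebra hQ (Submodule.zero_mem _) IsNilpotent.zero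
  let g' : centralizerSO Q (0 : End ℂ V) := ⟨g, fun v => by simp⟩
  have hg := isCentIsometry_toEnd g'
  have h1 : g' ∈ identityComponent (centralizerSO Q (0 : End ℂ V)) := by
    rw [mem_identityComponent_iff h0]
    intro b
    rcases Nat.eq_zero_or_pos b with rfl | hb
    · rw [← det_eq_detOn_ker h0 hg, det_toEnd]
    · rw [kerRange_eq_bot (N := 1) (by simp) hb, detOn_bot]
  exact continuous_subtype_val.image_connectedComponent_subset (1 : centralizerSO Q (0 : End ℂ V))
    ⟨g', h1, rfl⟩

end ComponentGroupSO

/-! ### Finite dimensionality of the Clifford algebra -/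

section FiniteDimension

variable {V : Type u} [AddCommGroup V] [Module ℂ V] {Q : QuadraticForm ℂ V}

/-- The span of the products of sublists of a list of vectors. -/
def sublistSpan (Q : QuadraticForm ℂ V) : List V → Submodule ℂ (CliffordAlgebra Q)
  | [] => Submodule.span ℂ {1}
  | v :: l => sublistSpan Q l ⊔ (sublistSpan Q l).map (LinearMap.mulLeft ℂ (ι Q v))

theorem one_mem_sublistSpan (l : List V) : (1 : CliffordAlgebra Q) ∈ sublistSpan Q l := by
  induction l with
  | nil => exact Submodule.mem_span_singleton_self 1
  | cons v l ih => exact Submodule.mem_sup_left ih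

theorem finiteDimensional_sublistSpan (l : List V) : FiniteDimensional ℂ (sublistSpan Q l) := by
  induction l with
  | nil => exact FiniteDimensional.span_singleton ℂ _
  | cons v l ih => exact Submodule.finiteDimensional_sup _ _

theorem ι_mul_mem_sublistSpan {l : List V} {v : V} (hv : v ∈ l) :
    ∀ x ∈ sublistSpan Q l, ι Q v * x ∈ sublistSpan Q l := by
  induction l with
  | nil => simp at hv
  | cons w l ih =>
    intro x hx
    obtain ⟨y, hy, z, ⟨t, ht, rfl⟩, rfl⟩ := Submodule.mem_sup.1 hx
    rw [LinearMap.mulLeft_apply, mul_add]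
    rcases List.mem_cons.1 hv with rfl | hv
    · rw [← mul_assoc, ι_sq_scalar, ← Algebra.smul_def]
      exact Submodule.add_mem _ (Submodule.mem_sup_right ⟨y, hy, rfl⟩)
        (Submodule.mem_sup_left (Submodule.smul_mem _ _ ht))
    · rw [← mul_assoc, ι_mul_ι_comm, sub_mul, mul_assoc, ← Algebra.smul_def]
      refine Submodule.add_mem _ (Submodule.mem_sup_left (ih hv y hy)) (Submodule.sub_mem _
        (Submodule.mem_sup_left (Submodule.smul_mem _ _ ht))
        (Submodule.mem_sup_right ⟨_, ih hv t ht, rfl⟩))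

theorem mem_of_forall_ι_mul {S : Submodule ℂ (CliffordAlgebra Q)}
    (hS : ∀ v, ∀ x ∈ S, ι Q v * x ∈ S) {s : CliffordAlgebra Q} (hs : s ∈ S)
    (x : CliffordAlgebra Q) : x * s ∈ S := by
  induction x using CliffordAlgebra.induction generalizing s with
  | algebraMap r => rw [← Algebra.smul_def]; exact S.smul_mem _ hs
  | ι v => exact hS v s hs
  | mul a b ha hb => rw [mul_assoc]; exact ha (hb hs)
  | add a b ha hb => rw [add_mul]; exact S.add_mem (ha hs) (hb hs)

/-- The products of sublists of a basis span a subspace that contains `1` and is stable under left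
multiplication by vectors, hence everything. -/
instance finiteDimensional_cliffordAlgebra [FiniteDimensional ℂ V] :
    FiniteDimensional ℂ (CliffordAlgebra Q) := by
  let b := finBasis ℂ V
  let l := List.ofFn b
  have htop : sublistSpan Q l = ⊤ := by
    rw [eq_top_iff]
    rintro x -
    rw [← mul_one x]
    refine mem_of_forall_ι_mul (fun v y hy => ?_) (one_mem_sublistSpan l) x
    rw [← b.sum_repr v, map_sum, Finset.sum_mul]
    refine Submodule.sum_mem _ fun i _ => ?_
    rw [map_smul, smul_mul_assoc]
    exact Submodule.smul_mem _ _ (ι_mul_mem_sublistSpan (by simp [l]) y hy)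
  have := finiteDimensional_sublistSpan (Q := Q) l
  rw [htop] at this
  exact Module.Finite.equiv (Submodule.topEquiv (R := ℂ) (M := CliffordAlgebra Q))

end FiniteDimension

/-! ### Topology of `Spin(V)` and continuity of the covering -/

section Topology

variable {V : Type u} [AddCommGroup V] [Module ℂ V] [FiniteDimensional ℂ V]
variable {Q : QuadraticForm ℂ V}

theorem spin_tendsto_iff {X : Type*} {l : Filter X} {f : X → spinGroup Q} {a : spinGroup Q} :
    Tendsto f l (𝓝 a) ↔ ∀ φ : CliffordAlgebra Q →ₗ[ℂ] ℂ,
      Tendsto (fun x => φ (f x)) l (𝓝 (φ a)) := by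
  have h1 : 𝓝 a = comap Subtype.val
      (@nhds _ (moduleTopology ℂ (CliffordAlgebra Q)) (a : CliffordAlgebra Q)) :=
    @nhds_induced _ _ (moduleTopology ℂ (CliffordAlgebra Q)) Subtype.val a
  rw [h1, tendsto_comap_iff]
  exact tendsto_moduleTopology_iff

theorem spin_continuous_iff {X : Type*} [TopologicalSpace X] {f : X → spinGroup Q} :
    Continuous f ↔ ∀ φ : CliffordAlgebra Q →ₗ[ℂ] ℂ, Continuous (fun x => φ (f x)) := by
  simp only [continuous_iff_continuousAt, ContinuousAt, spin_tendsto_iff]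
  exact ⟨fun h φ x => h x φ, fun h x φ => h φ x⟩

theorem spin_continuous_functional (φ : CliffordAlgebra Q →ₗ[ℂ] ℂ) :
    Continuous fun x : spinGroup Q => φ x :=
  spin_continuous_iff.1 continuous_id φ

theorem spin_continuous_bilinear
    (β : CliffordAlgebra Q →ₗ[ℂ] CliffordAlgebra Q →ₗ[ℂ] ℂ) :
    Continuous fun p : spinGroup Q × spinGroup Q => β p.1 p.2 := by
  let _ : TopologicalSpace (CliffordAlgebra Q) := moduleTopology ℂ (CliffordAlgebra Q)
  have : IsModuleTopology ℂ (CliffordAlgebra Q) := ⟨rfl⟩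
  have h1 : Continuous (Subtype.val : spinGroup Q → CliffordAlgebra Q) := continuous_induced_dom
  exact (IsModuleTopology.continuous_bilinear_of_finite_left β).comp
    ((h1.comp continuous_fst).prodMk (h1.comp continuous_snd))

instance spin_continuousMul : ContinuousMul (spinGroup Q) where
  continuous_mul := spin_continuous_iff.2 fun φ =>
    spin_continuous_bilinear ((LinearMap.mul ℂ (CliffordAlgebra Q)).compr₂ φ)

theorem star_functional (φ : CliffordAlgebra Q →ₗ[ℂ] ℂ) :
    ∃ ψ : CliffordAlgebra Q →ₗ[ℂ] ℂ, ∀ x, ψ x = φ (star x) :=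
  ⟨φ ∘ₗ reverse ∘ₗ involute.toLinearMap, fun _ => rfl⟩

theorem spin_continuous_inv : Continuous fun x : spinGroup Q => x⁻¹ := by
  rw [spin_continuous_iff]
  intro φ
  obtain ⟨ψ, hψ⟩ := star_functional φ
  have : (fun x : spinGroup Q => φ ((x⁻¹ : spinGroup Q) : CliffordAlgebra Q)) =
      fun x : spinGroup Q => ψ x := by
    funext x
    rw [hψ]
    rfl
  rw [this]
  exact spin_continuous_functional ψ

theorem soEnd_covering (x : spinGroup Q) (v : V) :
    soEnd (covering Q x) v = vectorAction Q x v := rfl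

/-- A coefficient of the image of `v` has the form `ψ (x v x⁻¹)`, bilinear in the pair `(x, x⁻¹)`.
-/
theorem covering_continuous : Continuous (covering Q) := by
  rw [SO.continuous_iff]
  intro v φ
  obtain ⟨ψ, hψ⟩ : ∃ ψ : CliffordAlgebra Q →ₗ[ℂ] ℂ, ∀ w, ψ (ι Q w) = φ w := by
    obtain ⟨π, hπ⟩ := (ι Q).exists_leftInverse_of_injective
      (LinearMap.ker_eq_bot.2 (cliffordι_injective Q))
    exact ⟨φ ∘ₗ π, fun w => congrArg φ (LinearMap.congr_fun hπ w)⟩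
  let β : CliffordAlgebra Q →ₗ[ℂ] CliffordAlgebra Q →ₗ[ℂ] ℂ :=
    (LinearMap.mul ℂ (CliffordAlgebra Q) ∘ₗ LinearMap.mulRight ℂ (ι Q v)).compr₂ ψ
  have h1 : (fun x : spinGroup Q => φ (soEnd (covering Q x) v)) =
      fun x : spinGroup Q => β x ((x⁻¹ : spinGroup Q) : CliffordAlgebra Q) := by
    funext x
    rw [← hψ]
    exact congrArg ψ (ι_covering Q x v)
  rw [h1]
  exact (spin_continuous_bilinear β).comp (continuous_id.prodMk spin_continuous_inv)

instance SO_continuousMul : ContinuousMul (SO Q) where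
  continuous_mul := by
    let _ : TopologicalSpace (End ℂ V) := moduleTopology ℂ (End ℂ V)
    have : IsModuleTopology ℂ (End ℂ V) := ⟨rfl⟩
    have h1 : Continuous (soEnd : SO Q → End ℂ V) := continuous_induced_dom
    refine continuous_induced_rng.2 ?_
    exact (IsModuleTopology.continuous_mul_of_finite ℂ (End ℂ V)).comp
      ((h1.comp continuous_fst).prodMk (h1.comp continuous_snd))

end Topology

/-! ### Products of two vectors in `Spin(V)` -/

section Reflections

variable {V : Type u} [AddCommGroup V] [Module ℂ V]
variable {Q : QuadraticForm ℂ V}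

theorem ι_mul_ι_mem_spinGroup {a b : V} (hab : Q a * Q b = 1) : ι Q a * ι Q b ∈ spinGroup Q := by
  have hunit : ∀ v : V, Q v ≠ 0 → ∃ x ∈ lipschitzGroup Q, (x : CliffordAlgebra Q) = ι Q v := by
    intro v hv
    obtain ⟨x, hx⟩ := isUnit_ι_of_isUnit (Q := Q) hv.isUnit
    exact ⟨x, Subgroup.subset_closure ⟨v, hx.symm⟩, hx⟩
  obtain ⟨x, hx, hxa⟩ := hunit a (left_ne_zero_of_mul_eq_one hab)
  obtain ⟨y, hy, hyb⟩ := hunit b (right_ne_zero_of_mul_eq_one hab)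
  have h1 : star (ι Q a * ι Q b) = ι Q b * ι Q a := by
    rw [star_mul, star_ι, star_ι, neg_mul_neg]
  rw [spinGroup.mem_iff, pinGroup.mem_iff, Unitary.mem_iff]
  refine ⟨⟨⟨x * y, Subgroup.mul_mem _ hx hy, ?_⟩, ?_, ?_⟩, ι_mul_ι_mem_evenOdd_zero Q a b⟩
  · simp [hxa, hyb]
  · rw [h1, mul_assoc, ← mul_assoc (ι Q a), ι_sq_scalar, ← mul_assoc, ← Algebra.commutes,
      mul_assoc, ι_sq_scalar, ← map_mul, hab, map_one]
  · rw [h1, mul_assoc, ← mul_assoc (ι Q b), ι_sq_scalar, ← mul_assoc, ← Algebra.commutes,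
      mul_assoc, ι_sq_scalar, ← map_mul, mul_comm, hab, map_one]

variable [FiniteDimensional ℂ V]

/-- The element `a b` acts by `z ↦ a (b z b) a`, a product of two reflections up to scaling, each
evaluated by `a z a = polar(a, z) a - Q(a) z`. -/
theorem covering_ι_mul_ι {a b : V} (hab : Q a * Q b = 1) (z : V) :
    soEnd (covering Q ⟨ι Q a * ι Q b, ι_mul_ι_mem_spinGroup hab⟩) z =
      QuadraticMap.polar Q a (QuadraticMap.polar Q b z • b - Q b • z) • a -
        Q a • (QuadraticMap.polar Q b z • b - Q b • z) := by
  rw [soEnd_covering]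
  refine vectorAction_of_eq Q ?_
  rw [star_mul, star_ι, star_ι, neg_mul_neg, ← ι_mul_ι_mul_ι, ← ι_mul_ι_mul_ι]
  simp only [mul_assoc]

end Reflections

/-! ### The covering is open and surjective -/

section OpenMap

variable {V : Type u} [AddCommGroup V] [Module ℂ V] [FiniteDimensional ℂ V]
variable {Q : QuadraticForm ℂ V}

/-- A local lift of the rotation taking the unit vector `v` to `g v`. -/
theorem exists_local_lift (v : V) (hv : Q v = 1) :
    ∃ Y : SO Q → spinGroup Q, Tendsto Y (𝓝 1) (𝓝 1) ∧ ∀ᶠ g in 𝓝 (1 : SO Q),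
      soEnd (covering Q (Y g)) v = soEnd g v ∧
      ∀ z, QuadraticMap.polar Q v z = 0 → QuadraticMap.polar Q (soEnd g v) z = 0 →
        soEnd (covering Q (Y g)) z = z := by
  classical
  let q : SO Q → ℂ := fun g => Q (soEnd g v + v)
  -- The constant is the inverse square root of `q g = Q (g v + v)`, so that `c (g v + v)` has `Q =
  -- 1`. As `q 1 = 4`, the principal branch at `q / 4` is continuous near `g = 1`, and there the
  -- lift `c (g v + v) v` specialises to `v v = 1`.
  let c : SO Q → ℂ := fun g => (q g / 4) ^ (-(1 / 2) : ℂ) / 2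
  have hQg : ∀ g : SO Q, Q (soEnd g v) = 1 := fun g => (g.2.1 v).trans hv
  have hq : ∀ g, q g = 2 + QuadraticMap.polar Q (soEnd g v) v := by
    intro g
    simp only [q, QuadraticMap.map_add Q, hQg, hv]
    ring
  have hcq : ∀ g, q g ≠ 0 → Q (c g • (soEnd g v + v)) * Q v = 1 := by
    intro g hg
    have h4 : q g / 4 ≠ 0 := div_ne_zero hg (by norm_num)
    have h1 : ((q g / 4) ^ (-(1 / 2) : ℂ)) ^ 2 = (q g / 4)⁻¹ := by
      rw [← Complex.cpow_nat_mul, ← Complex.cpow_neg_one]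
      congr 1
      norm_num
    rw [hv, mul_one, QuadraticMap.map_smul, smul_eq_mul]
    change c g * c g * q g = 1
    have h2 : c g * c g = (q g / 4)⁻¹ / 4 := by
      rw [← h1]; simp only [c]; ring
    rw [h2]
    field_simp
  let Y : SO Q → spinGroup Q := fun g =>
    if hg : q g ≠ 0 then ⟨_, ι_mul_ι_mem_spinGroup (hcq g hg)⟩ else 1
  have hqc : Continuous q := by
    have : q = fun g => 2 + (QuadraticMap.polarBilin Q).flip v (soEnd g v) := funext hq
    rw [this]
    exact continuous_const.add (SO.continuous_apply v _)
  have hone : soEnd (1 : SO Q) v = v := rfl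
  have hq1 : q 1 = 4 := by
    rw [hq, hone, QuadraticMap.polar_self, hv]
    norm_num
  have hev : ∀ᶠ g in 𝓝 (1 : SO Q), q g ≠ 0 :=
    hqc.continuousAt.eventually_ne (by rw [hq1]; norm_num)
  refine ⟨Y, ?_, ?_⟩
  · rw [spin_tendsto_iff]
    intro φ
    have hc : Tendsto c (𝓝 1) (𝓝 (1 / 2)) := by
      have h1 : ContinuousAt (fun g => (q g / 4) ^ (-(1 / 2) : ℂ)) (1 : SO Q) :=
        (hqc.div_const 4).continuousAt.cpow continuousAt_const (by rw [hq1]; norm_num)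
      have h2 : ContinuousAt c 1 := h1.div_const 2
      have h3 : c 1 = 1 / 2 := by simp [c, hq1]
      rw [← h3]
      exact h2
    have h2 : Tendsto (fun g : SO Q => c g *
        ((φ ∘ₗ LinearMap.mulRight ℂ (ι Q v) ∘ₗ ι Q) (soEnd g v) + φ 1)) (𝓝 1)
        (𝓝 (1 / 2 * ((φ ∘ₗ LinearMap.mulRight ℂ (ι Q v) ∘ₗ ι Q) (soEnd (1 : SO Q) v) + φ 1))) :=
      hc.mul (((SO.continuous_apply v _).tendsto 1).add_const _)
    have h3 : ι Q v * ι Q v = 1 := by rw [ι_sq_scalar, hv, map_one]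
    have h4 : (1 / 2 * ((φ ∘ₗ LinearMap.mulRight ℂ (ι Q v) ∘ₗ ι Q) (soEnd (1 : SO Q) v) + φ 1)) =
        φ ((1 : spinGroup Q) : CliffordAlgebra Q) := by
      rw [hone]
      simp only [LinearMap.comp_apply, LinearMap.mulRight_apply, h3]
      change _ = φ 1
      ring
    rw [h4] at h2
    refine h2.congr' ?_
    filter_upwards [hev] with g hg
    simp only [Y, dif_pos hg, LinearMap.comp_apply, LinearMap.mulRight_apply, map_smul, map_add,
      smul_mul_assoc, add_mul, h3, smul_eq_mul]
  · filter_upwards [hev] with g hg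
    have hY : Y g = ⟨_, ι_mul_ι_mem_spinGroup (hcq g hg)⟩ := dif_pos hg
    have hcc : c g * c g * q g = 1 := by
      have := hcq g hg
      rwa [hv, mul_one, QuadraticMap.map_smul, smul_eq_mul] at this
    have hQc : Q (c g • (soEnd g v + v)) = 1 := by
      have := hcq g hg
      rwa [hv, mul_one] at this
    constructor
    · rw [hY, covering_ι_mul_ι (hcq g hg), QuadraticMap.polar_self, hv, hQc]
      have h5 : (2 • (1 : ℂ)) • v - (1 : ℂ) • v = v := by
        rw [two_smul, add_smul, one_smul]; abel
      rw [h5, QuadraticMap.polar_smul_left, QuadraticMap.polar_add_left, QuadraticMap.polar_self,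
        hv, smul_smul, smul_eq_mul]
      have h6 : c g * (QuadraticMap.polar Q (soEnd g v) v + 2 • 1) * c g = 1 := by
        rw [hq] at hcc
        simp only [nsmul_eq_mul, Nat.cast_ofNat, mul_one]
        linear_combination hcc
      rw [h6, one_smul, one_smul]
      abel
    · intro z hz1 hz2
      rw [hY, covering_ι_mul_ι (hcq g hg), hz1, hv, hQc, QuadraticMap.polar_smul_left,
        QuadraticMap.polar_add_left]
      have h5 : (0 : ℂ) • v - (1 : ℂ) • z = -z := by simp
      rw [h5, QuadraticMap.polar_neg_right, QuadraticMap.polar_neg_right, hz1, hz2]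
      simp

theorem exists_orthonormal_basis (hQ : (QuadraticMap.polarBilin Q).Nondegenerate) :
    ∃ b : Basis (Fin (finrank ℂ V)) ℂ V,
      (∀ i, Q (b i) = 1) ∧ ∀ i j, i ≠ j → QuadraticMap.polar Q (b i) (b j) = 0 := by
  have hsep : (QuadraticMap.associated (R := ℂ) Q).SeparatingLeft := by
    intro x hx
    refine hQ.1 x fun y => ?_
    have := hx y
    rw [QuadraticMap.associated_apply] at this
    change QuadraticMap.polar Q x y = 0
    rw [QuadraticMap.polar]
    simpa using this
  obtain ⟨E⟩ := QuadraticForm.equivalent_weightedSumSquares_of_isAlgClosed Q hsep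
  have hE : ∀ x, Q (E.symm x) = ∑ i, x i * x i := by
    intro x
    rw [E.symm.map_app]
    simp [QuadraticMap.weightedSumSquares_apply]
  have hb : ∀ i, (Basis.ofEquivFun E.toLinearEquiv) i = E.symm (Pi.single i 1) := fun i => by
    rw [Basis.coe_ofEquivFun]; rfl
  refine ⟨Basis.ofEquivFun E.toLinearEquiv, fun i => ?_, fun i j hij => ?_⟩
  · rw [hb, hE, Finset.sum_eq_single i]
    · simp
    · intro j _ hj; simp [hj]
    · simp
  · rw [QuadraticMap.polar, hb, hb, ← map_add, hE, hE, hE, ← Finset.sum_sub_distrib,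
      ← Finset.sum_sub_distrib]
    refine Finset.sum_eq_zero fun k _ => ?_
    simp only [Pi.add_apply, Pi.single_apply]
    split_ifs with h1 h2 h2
    · exact absurd (h1.symm.trans h2) hij
    · simp
    · simp
    · simp

theorem polar_soEnd (g : SO Q) (x y : V) :
    QuadraticMap.polar Q (soEnd g x) (soEnd g y) = QuadraticMap.polar Q x y := by
  have h1 : ∀ v, Q (soEnd g v) = Q v := g.2.1
  simp only [QuadraticMap.polar, ← map_add, h1]

/-- An element near `1` that fixes an initial segment of an orthonormal basis is corrected by the
local lift moving the next vector `b j` to `g (b j)`. The lift fixes the earlier vectors, so one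
more vector becomes fixed; once all are fixed, the element is `1`. -/
theorem covering_image_mem_nhds_one (hQ : (QuadraticMap.polarBilin Q).Nondegenerate)
    {U : Set (spinGroup Q)} (hU : U ∈ 𝓝 1) : covering Q '' U ∈ 𝓝 1 := by
  obtain ⟨b, hb1, hb0⟩ := exists_orthonormal_basis hQ
  have key : ∀ k, k ≤ finrank ℂ V → ∀ U ∈ 𝓝 (1 : spinGroup Q), ∀ᶠ g in 𝓝 (1 : SO Q),
      (∀ i : Fin (finrank ℂ V), (i : ℕ) < finrank ℂ V - k → soEnd g (b i) = b i) → ∃ x ∈ U, covering Q x = g := by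
    intro k
    induction k with
    | zero =>
      intro _ U hU
      refine Eventually.of_forall fun g hg => ⟨1, mem_of_mem_nhds hU, ?_⟩
      rw [map_one]
      exact soEnd_injective (b.ext fun i => (hg i (by simp)).symm)
    | succ k ih =>
      intro hk U hU
      let j : Fin (finrank ℂ V) := ⟨finrank ℂ V - (k + 1), by omega⟩
      obtain ⟨Y, hY, hYev⟩ := exists_local_lift (b j) (hb1 j)
      have hmul : Tendsto (fun p : spinGroup Q × spinGroup Q => p.1 * p.2) (𝓝 1 ×ˢ 𝓝 1) (𝓝 1) := by
        have := (continuous_mul (M := spinGroup Q)).tendsto (1, 1)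
        rwa [mul_one, nhds_prod_eq] at this
      obtain ⟨U₁, hU₁, U₂, hU₂, hUU⟩ := mem_prod_iff.1 (hmul hU)
      have hg' : Tendsto (fun g : SO Q => covering Q (Y g)⁻¹ * g) (𝓝 1) (𝓝 1) := by
        have h1 : Tendsto (fun g : SO Q => covering Q (Y g)⁻¹) (𝓝 1) (𝓝 1) := by
          have h2 := (covering_continuous.comp spin_continuous_inv).tendsto (1 : spinGroup Q)
          simp only [Function.comp_apply, inv_one, map_one] at h2
          exact h2.comp hY
        have h3 := h1.mul (tendsto_id (x := 𝓝 (1 : SO Q)))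
        rwa [mul_one] at h3
      filter_upwards [hYev, hY hU₁, hg' (ih (by omega) U₂ hU₂)] with g hYg hgU hgih hfix
      obtain ⟨x, hx, hxg⟩ := hgih (by
        intro i hi
        have hsplit : soEnd g (b i) = soEnd (covering Q (Y g)) (b i) := by
          rcases Nat.lt_or_ge i (finrank ℂ V - (k + 1)) with hlt | hge
          · have hij : j ≠ i := fun h => by
              have := congrArg Fin.val h
              simp only [j] at this
              omega
            rw [hfix i hlt, hYg.2 (b i) (hb0 j i hij)]
            rw [← hfix i hlt, polar_soEnd, hb0 j i hij]
          · have hij : i = j := Fin.ext (by simp only [j]; omega)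
            rw [hij, hYg.1]
        change soEnd (covering Q (Y g)⁻¹ * g) (b i) = b i
        rw [soEnd_mul, Module.End.mul_apply, hsplit, ← Module.End.mul_apply, ← soEnd_mul,
          ← map_mul, inv_mul_cancel, map_one]
        rfl)
      refine ⟨Y g * x, hUU (Set.mk_mem_prod hgU hx), ?_⟩
      rw [map_mul, hxg, ← mul_assoc, ← map_mul, mul_inv_cancel, map_one, one_mul]
  filter_upwards [key (finrank ℂ V) le_rfl U hU] with g hg
  exact hg fun i hi => by omega

theorem covering_isOpenMap (hQ : (QuadraticMap.polarBilin Q).Nondegenerate) :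
    IsOpenMap (covering Q) := by
  rw [isOpenMap_iff_nhds_le]
  intro x U hU
  rw [mem_map] at hU
  have h1 : (fun y : spinGroup Q => x * y) ⁻¹' (covering Q ⁻¹' U) ∈ 𝓝 1 := by
    refine (continuous_const_mul x).continuousAt.preimage_mem_nhds ?_
    rwa [mul_one]
  have h2 := covering_image_mem_nhds_one hQ h1
  have h3 : (fun g : SO Q => (covering Q x)⁻¹ * g) ⁻¹' (covering Q ''
      ((fun y : spinGroup Q => x * y) ⁻¹' (covering Q ⁻¹' U))) ∈ 𝓝 (covering Q x) := by
    refine (continuous_const_mul (covering Q x)⁻¹).continuousAt.preimage_mem_nhds ?_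
    rwa [inv_mul_cancel]
  refine mem_of_superset h3 ?_
  rintro g ⟨y, hy, hyg⟩
  have : covering Q (x * y) = g := by rw [map_mul, hyg, mul_inv_cancel_left]
  rw [← this]
  exact hy

/-- The image is an open, hence closed, subgroup of the connected group `SO(V)`. -/
theorem covering_surjective (hQ : (QuadraticMap.polarBilin Q).Nondegenerate) :
    Function.Surjective (covering Q) := by
  have hopen : IsOpen ((covering Q).range : Set (SO Q)) := by
    rw [MonoidHom.coe_range]
    exact (covering_isOpenMap hQ).isOpen_range
  have hclosed := Subgroup.isClosed_of_isOpen _ hopen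
  intro g
  exact IsClopen.connectedComponent_subset ⟨hclosed, hopen⟩ (Subgroup.one_mem _)
    (mem_connectedComponent_one_SO hQ g)

variable (e : End ℂ V)

theorem coveringCentralizer_surjective (hQ : (QuadraticMap.polarBilin Q).Nondegenerate) :
    Function.Surjective (coveringCentralizer Q e) := by
  intro g
  obtain ⟨x, hx⟩ := covering_surjective hQ (g : SO Q)
  exact ⟨⟨x, by change covering Q x ∈ centralizerSO Q e; rw [hx]; exact g.2⟩, Subtype.ext hx⟩

theorem coveringCentralizer_continuous : Continuous (coveringCentralizer Q e) :=
  (covering_continuous.comp continuous_subtype_val).subtype_mk _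

theorem coveringCentralizer_isOpenMap (hQ : (QuadraticMap.polarBilin Q).Nondegenerate) :
    IsOpenMap (coveringCentralizer Q e) :=
  (covering_isOpenMap hQ).restrictPreimage (centralizerSO Q e : Set (SO Q))

end OpenMap

/-! ### Products of mutually orthogonal vectors -/

section Lists

variable {V : Type u} [AddCommGroup V] [Module ℂ V] {Q : QuadraticForm ℂ V}

theorem ι_anticomm {a b : V} (h : QuadraticMap.polar Q a b = 0) :
    ι Q a * ι Q b = -(ι Q b * ι Q a) := by
  rw [ι_mul_ι_comm, h, map_zero, zero_sub]

theorem ι_mul_prod_of_orthogonal {a : V} {l : List V}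
    (h : ∀ b ∈ l, QuadraticMap.polar Q a b = 0) :
    ι Q a * (l.map (ι Q)).prod = (-1 : ℂ) ^ l.length • ((l.map (ι Q)).prod * ι Q a) := by
  induction l with
  | nil => simp
  | cons b l ih =>
    rw [List.map_cons, List.prod_cons, ← mul_assoc, ι_anticomm (h b (by simp)), neg_mul, mul_assoc,
      ih fun c hc => h c (by simp [hc]), mul_smul_comm, List.length_cons, pow_succ, mul_neg_one,
      neg_smul, mul_assoc]

/-- The vector `a` anticommutes up to its own copy in the list, where `a^2 = Q(a) = 0`. -/
theorem ι_mul_prod_eq_zero {a : V} {l : List V} (ha : a ∈ l)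
    (h : ∀ b ∈ l, QuadraticMap.polar Q a b = 0) : ι Q a * (l.map (ι Q)).prod = 0 := by
  induction l with
  | nil => simp at ha
  | cons b l ih =>
    rw [List.map_cons, List.prod_cons]
    rcases List.mem_cons.1 ha with rfl | ha
    · have h1 := h a (by simp)
      rw [QuadraticMap.polar_self, nsmul_eq_mul] at h1
      have h2 : Q a = 0 := by simpa using h1
      rw [← mul_assoc, ι_sq_scalar, h2, map_zero, zero_mul]
    · rw [← mul_assoc, ι_anticomm (h b (by simp)), neg_mul, mul_assoc,
        ih ha fun c hc => h c (by simp [hc]), mul_zero, neg_zero]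

theorem prod_perm {l₁ l₂ : List V} (hp : l₁.Perm l₂)
    (h : ∀ a ∈ l₁, ∀ b ∈ l₁, QuadraticMap.polar Q a b = 0) :
    ∃ s : ℂ, s * s = 1 ∧ (l₂.map (ι Q)).prod = s • (l₁.map (ι Q)).prod := by
  induction hp with
  | nil => exact ⟨1, by simp, by simp⟩
  | cons x _ ih =>
    obtain ⟨s, hs, hl⟩ := ih fun a ha b hb => h a (by simp [ha]) b (by simp [hb])
    exact ⟨s, hs, by simp [hl]⟩
  | swap x y l =>
    refine ⟨-1, by norm_num, ?_⟩
    simp only [List.map_cons, List.prod_cons, neg_smul, one_smul]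
    rw [← mul_assoc, ι_anticomm (h x (by simp) y (by simp)), neg_mul, mul_assoc]
  | trans h1 _ ih1 ih2 =>
    obtain ⟨s, hs, hl⟩ := ih1 h
    obtain ⟨t, ht, hl'⟩ := ih2 fun a ha b hb => h a (h1.mem_iff.2 ha) b (h1.mem_iff.2 hb)
    exact ⟨t * s, by linear_combination hs * t * t + ht, by rw [hl', hl, smul_smul]⟩

theorem star_prod_of_isotropic {l : List V}
    (h : ∀ a ∈ l, ∀ b ∈ l, QuadraticMap.polar Q a b = 0) :
    ∃ s : ℂ, s * s = 1 ∧ star (l.map (ι Q)).prod = s • (l.map (ι Q)).prod := by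
  obtain ⟨s, hs, hl⟩ := prod_perm l.reverse_perm.symm h
  refine ⟨(-1) ^ l.length * s, ?_, ?_⟩
  · rw [mul_mul_mul_comm, hs, ← mul_pow]
    norm_num
  · rw [star_def, involute_prod_map_ι, map_smul, reverse_prod_map_ι, ← List.map_reverse, hl,
      smul_smul]

end Lists

/-! ### The vacuum vector, the spinor module and the kernel of the covering -/

/-- A basis of `V` consisting of dual bases of two complementary isotropic subspaces. -/
structure IsHyperbolicBasis {V : Type u} [AddCommGroup V] [Module ℂ V] (Q : QuadraticForm ℂ V)
    {n : ℕ} (u w : Fin n → V) : Prop where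
  left : ∀ i j, QuadraticMap.polar Q (u i) (u j) = 0
  right : ∀ i j, QuadraticMap.polar Q (w i) (w j) = 0
  pairing : ∀ i j, QuadraticMap.polar Q (u i) (w j) = if i = j then 1 else 0
  expand : ∀ v, v = ∑ i, QuadraticMap.polar Q v (w i) • u i + ∑ i, QuadraticMap.polar Q v (u i) • w i

/-- The product of the vectors `u i` in the Clifford algebra. -/
noncomputable def vacuum {V : Type u} [AddCommGroup V] [Module ℂ V] (Q : QuadraticForm ℂ V)
    {n : ℕ} (u : Fin n → V) : CliffordAlgebra Q := ((List.ofFn u).map (ι Q)).prod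

namespace IsHyperbolicBasis

variable {V : Type u} [AddCommGroup V] [Module ℂ V] {Q : QuadraticForm ℂ V} {n : ℕ}
variable {u w : Fin n → V} (h : IsHyperbolicBasis Q u w)
include h

theorem left_mul_vacuum (i : Fin n) : ι Q (u i) * vacuum Q u = 0 := by
  refine ι_mul_prod_eq_zero (by simp) fun b hb => ?_
  obtain ⟨j, rfl⟩ := List.mem_ofFn.1 hb
  exact h.left i j

theorem add_swap (i : Fin n) : ι Q (u i) * ι Q (w i) + ι Q (w i) * ι Q (u i) = 1 := by
  rw [ι_mul_ι_add_swap, h.pairing, if_pos rfl, map_one]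

theorem right_mul_self (i : Fin n) : ι Q (w i) * ι Q (w i) = 0 := by
  have h1 := h.right i i
  rw [QuadraticMap.polar_self, nsmul_eq_mul] at h1
  have h2 : Q (w i) = 0 := by simpa using h1
  rw [ι_sq_scalar, h2, map_zero]

/-- The spinor module `C(V) ω` is spanned by products of the `w i` applied to `ω`: a factor `u i`
can be moved to the right by the anticommutation relations until it meets `ω` and kills it. -/
theorem mul_vacuum_mem (x : CliffordAlgebra Q) :
    x * vacuum Q u ∈ (sublistSpan Q (List.ofFn w)).map (LinearMap.mulRight ℂ (vacuum Q u)) := by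
  have hω : vacuum Q u ∈
      (sublistSpan Q (List.ofFn w)).map (LinearMap.mulRight ℂ (vacuum Q u)) :=
    ⟨1, one_mem_sublistSpan _, by simp⟩
  have key : ∀ l : List V, ∀ i, ∀ y ∈ sublistSpan Q l, ∃ z ∈ sublistSpan Q l,
      ι Q (u i) * (y * vacuum Q u) = z * vacuum Q u := by
    intro l i
    induction l with
    | nil =>
      intro y hy
      obtain ⟨c, rfl⟩ := Submodule.mem_span_singleton.1 hy
      exact ⟨0, Submodule.zero_mem _, by simp [h.left_mul_vacuum]⟩
    | cons v l ih =>
      intro y hy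
      obtain ⟨y₁, hy₁, _, ⟨t, ht, rfl⟩, rfl⟩ := Submodule.mem_sup.1 hy
      obtain ⟨z₁, hz₁, h1⟩ := ih y₁ hy₁
      obtain ⟨z₂, hz₂, h2⟩ := ih t ht
      refine ⟨z₁ + (QuadraticMap.polar Q (u i) v • t - ι Q v * z₂), Submodule.add_mem _
        (Submodule.mem_sup_left hz₁) (Submodule.sub_mem _ (Submodule.mem_sup_left
          (Submodule.smul_mem _ _ ht)) (Submodule.mem_sup_right ⟨z₂, hz₂, rfl⟩)), ?_⟩
      rw [LinearMap.mulLeft_apply, add_mul, mul_add, h1, mul_assoc, ← mul_assoc (ι Q (u i)),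
        ι_mul_ι_comm, sub_mul, mul_assoc (ι Q v), h2, ← Algebra.smul_def, add_mul, sub_mul,
        smul_mul_assoc, mul_assoc]
  refine mem_of_forall_ι_mul (fun v s hs => ?_) hω x
  obtain ⟨y, hy, rfl⟩ := hs
  rw [h.expand v, map_add, map_sum, map_sum, add_mul, Finset.sum_mul, Finset.sum_mul]
  refine Submodule.add_mem _ (Submodule.sum_mem _ fun i _ => ?_)
    (Submodule.sum_mem _ fun i _ => ?_)
  · rw [map_smul, smul_mul_assoc]
    refine Submodule.smul_mem _ _ ?_
    obtain ⟨z, hz, h1⟩ := key _ i y hy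
    exact ⟨z, hz, h1.symm⟩
  · rw [map_smul, smul_mul_assoc]
    refine Submodule.smul_mem _ _ ⟨ι Q (w i) * y, ?_, by simp [mul_assoc]⟩
    exact ι_mul_mem_sublistSpan (by simp) y hy

/-- The vacuum is, up to scalars, the only vector of the spinor module killed by all `u i`. -/
theorem mul_vacuum_eq_smul {x : CliffordAlgebra Q}
    (hx : ∀ i, ι Q (u i) * (x * vacuum Q u) = 0) : ∃ c : ℂ, x * vacuum Q u = c • vacuum Q u := by
  -- The product of all `u i * w i` is the projector onto the vacuum line: it fixes every vector
  -- killed by all `u i`, because `u w = 1 - w u`, and it annihilates every product beginning with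
  -- some `w j`.
  let P : List (Fin n) → CliffordAlgebra Q :=
    fun l => (l.map fun i => ι Q (u i) * ι Q (w i)).prod
  have hfix : ∀ ψ, (∀ i, ι Q (u i) * ψ = 0) → ∀ l, P l * ψ = ψ := by
    intro ψ hψ l
    induction l with
    | nil => simp [P]
    | cons i l ih =>
      change (ι Q (u i) * ι Q (w i) * P l) * ψ = ψ
      rw [mul_assoc, ih, eq_sub_of_add_eq (h.add_swap i), sub_mul, one_mul, mul_assoc, hψ,
        mul_zero, sub_zero]
  have hkill : ∀ l : List (Fin n), ∀ j ∈ l, P l * ι Q (w j) = 0 := by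
    intro l j
    induction l with
    | nil => simp
    | cons i l ih =>
      intro hj
      change (ι Q (u i) * ι Q (w i) * P l) * ι Q (w j) = 0
      rw [mul_assoc]
      by_cases hjl : j ∈ l
      · rw [ih hjl, mul_zero]
      · obtain rfl : j = i := (List.mem_cons.1 hj).resolve_right hjl
        have hcomm : Commute (P l) (ι Q (w j)) := by
          refine Commute.list_prod_left _ _ fun y hy => ?_
          obtain ⟨i, hi, rfl⟩ := List.mem_map.1 hy
          have hij : i ≠ j := fun h => hjl (h ▸ hi)
          have h1 : ι Q (u i) * ι Q (w j) = -(ι Q (w j) * ι Q (u i)) :=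
            ι_anticomm (by rw [h.pairing, if_neg hij])
          have h2 : ι Q (w i) * ι Q (w j) = -(ι Q (w j) * ι Q (w i)) := ι_anticomm (h.right i j)
          rw [Commute, SemiconjBy, mul_assoc, h2, mul_neg, ← mul_assoc, h1, neg_mul, neg_neg,
            mul_assoc]
        rw [hcomm.eq, mul_assoc, ← mul_assoc (ι Q (w j)), h.right_mul_self, zero_mul, mul_zero]
  have hspan : ∀ l : List V, (∀ v ∈ l, ∃ j, v = w j) → ∀ y ∈ sublistSpan Q l,
      ∃ c : ℂ, P (List.finRange n) * (y * vacuum Q u) = c • vacuum Q u := by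
    intro l hl
    induction l with
    | nil =>
      intro y hy
      obtain ⟨c, rfl⟩ := Submodule.mem_span_singleton.1 hy
      refine ⟨c, ?_⟩
      rw [smul_mul_assoc, one_mul, mul_smul_comm, hfix _ h.left_mul_vacuum]
    | cons v l ih =>
      intro y hy
      obtain ⟨y₁, hy₁, _, ⟨t, ht, rfl⟩, rfl⟩ := Submodule.mem_sup.1 hy
      obtain ⟨c, hc⟩ := ih (fun v hv => hl v (by simp [hv])) y₁ hy₁
      obtain ⟨j, rfl⟩ := hl v (by simp)
      refine ⟨c, ?_⟩
      rw [LinearMap.mulLeft_apply, add_mul, mul_add, hc, mul_assoc, ← mul_assoc (P _),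
        hkill _ j (List.mem_finRange j), zero_mul, add_zero]
  obtain ⟨y, hy, hyx⟩ := h.mul_vacuum_mem x
  rw [LinearMap.mulRight_apply] at hyx
  obtain ⟨c, hc⟩ := hspan _ (fun v hv => by
    obtain ⟨j, rfl⟩ := List.mem_ofFn.1 hv
    exact ⟨j, rfl⟩) y hy
  exact ⟨c, by rw [← hc, hyx, hfix _ hx]⟩

/-- The factors of `ω` are stripped off one at a time. If `y u L = 0` with `L` the product of the
later factors, insert `1 = u w + w u` in `y L`. In the first term `w` moves past `L` up to sign, in
the second past the central `y`, and both vanish. -/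
theorem eq_zero_of_mul_vacuum {y : CliffordAlgebra Q} (hy : ∀ v, y * ι Q v = ι Q v * y)
    (h0 : y * vacuum Q u = 0) : y = 0 := by
  have key : ∀ l : List (Fin n), l.Nodup → y * ((l.map u).map (ι Q)).prod = 0 → y = 0 := by
    intro l
    induction l with
    | nil => intro _ h1; simpa using h1
    | cons i l ih =>
      intro hn h1
      obtain ⟨hil, hn⟩ := List.nodup_cons.1 hn
      refine ih hn ?_
      simp only [List.map_cons, List.prod_cons] at h1
      have h2 := ι_mul_prod_of_orthogonal (Q := Q) (a := w i) (l := l.map u) (by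
        intro b hb
        obtain ⟨j, hj, rfl⟩ := List.mem_map.1 hb
        rw [QuadraticMap.polar_comm, h.pairing, if_neg]
        rintro rfl
        exact hil hj)
      rw [← one_mul (List.prod _), ← h.add_swap i, add_mul, mul_add, mul_assoc (ι Q (w i)),
        ← mul_assoc y (ι Q (w i)), hy, mul_assoc (ι Q (w i)) y, h1, mul_zero, add_zero, mul_assoc, h2,
        mul_smul_comm, mul_smul_comm, ← mul_assoc (ι Q (u i)), ← mul_assoc y, h1, zero_mul,
        smul_zero]
  refine key (List.finRange n) (List.nodup_finRange n) ?_
  rwa [← List.ofFn_eq_map]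

theorem vacuum_ne_zero : vacuum Q u ≠ 0 := fun h0 =>
  one_ne_zero (h.eq_zero_of_mul_vacuum (y := 1) (fun v => by rw [one_mul, mul_one])
    (by rw [h0, mul_zero]))

theorem star_vacuum : ∃ s : ℂ, s * s = 1 ∧ star (vacuum Q u) = s • vacuum Q u := by
  refine star_prod_of_isotropic fun a ha b hb => ?_
  obtain ⟨i, rfl⟩ := List.mem_ofFn.1 ha
  obtain ⟨j, rfl⟩ := List.mem_ofFn.1 hb
  exact h.left i j

/-- For central `x`, the vector `x ω` is still killed by all `u i`, so `x ω = c ω`; then the central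
element `x - c` annihilates `ω` and is zero. -/
theorem eq_algebraMap_of_commute {x : CliffordAlgebra Q} (hx : ∀ v, x * ι Q v = ι Q v * x) :
    ∃ c : ℂ, x = algebraMap ℂ _ c := by
  obtain ⟨c, hc⟩ := h.mul_vacuum_eq_smul (x := x) fun i => by
    rw [← mul_assoc, ← hx, mul_assoc, h.left_mul_vacuum, mul_zero]
  refine ⟨c, sub_eq_zero.1 (h.eq_zero_of_mul_vacuum (fun v => ?_) ?_)⟩
  · rw [sub_mul, mul_sub, hx, Algebra.commutes]
  · rw [sub_mul, hc, Algebra.smul_def, sub_self]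

theorem covering_eq_one [FiniteDimensional ℂ V] {x : spinGroup Q} (hx : covering Q x = 1) :
    (x : CliffordAlgebra Q) = 1 ∨ (x : CliffordAlgebra Q) = -1 := by
  obtain ⟨c, hc⟩ := h.eq_algebraMap_of_commute (x := x) fun v => by
    have h1 := ι_covering Q x v
    rw [hx] at h1
    change ι Q v = _ at h1
    have h2 := congrArg (· * (x : CliffordAlgebra Q)) h1
    simp only [mul_assoc, spinGroup.star_mul_self_of_mem x.2, mul_one] at h2
    exact h2.symm
  have h2 := spinGroup.mul_star_self_of_mem x.2
  rw [hc, star_algebraMap, ← map_mul, ← map_one (algebraMap ℂ (CliffordAlgebra Q))] at h2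
  have h3 : c * c = 1 := (algebraMap ℂ (CliffordAlgebra Q)).injective h2
  rcases mul_self_eq_one_iff.1 h3 with rfl | rfl
  · left; rw [hc, map_one]
  · right; rw [hc, map_neg, map_one]

end IsHyperbolicBasis

/-! ### Lagrangian subspaces and hyperbolic bases -/

section Lagrangian

variable {V : Type u} [AddCommGroup V] [Module ℂ V] [FiniteDimensional ℂ V]
variable {Q : QuadraticForm ℂ V}

/-- Every totally isotropic subspace lies in one that is its own orthogonal complement. -/
theorem exists_lagrangian (hQ : (QuadraticMap.polarBilin Q).Nondegenerate) {n : ℕ}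
    (hV : finrank ℂ V = 2 * n) {L : Submodule ℂ V} (hL : ∀ x ∈ L, Q x = 0) :
    ∃ M : Submodule ℂ V, L ≤ M ∧ (∀ x ∈ M, Q x = 0) ∧
      ∀ v, (∀ x ∈ M, QuadraticMap.polar Q x v = 0) → v ∈ M := by
  have hex : ∃ m, ∃ M : Submodule ℂ V, L ≤ M ∧ (∀ x ∈ M, Q x = 0) ∧ finrank ℂ M = m :=
    ⟨_, L, le_rfl, hL, rfl⟩
  have hbd : ∀ m, (∃ M : Submodule ℂ V, L ≤ M ∧ (∀ x ∈ M, Q x = 0) ∧ finrank ℂ M = m) →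
      m ≤ finrank ℂ V := by
    rintro m ⟨M, -, -, rfl⟩
    exact Submodule.finrank_le M
  classical
  obtain ⟨M, hLM, hM, hMm⟩ := Nat.findGreatest_spec (P := fun m => ∃ M : Submodule ℂ V, L ≤ M ∧
    (∀ x ∈ M, Q x = 0) ∧ finrank ℂ M = m) (hbd _ hex.choose_spec) hex.choose_spec
  have hmax : ∀ M' : Submodule ℂ V, L ≤ M' → (∀ x ∈ M', Q x = 0) → finrank ℂ M' ≤ finrank ℂ M := by
    intro M' h1 h2
    rw [hMm]
    exact Nat.le_findGreatest (Submodule.finrank_le M') ⟨M', h1, h2, rfl⟩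
  refine ⟨M, hLM, hM, fun v hv => ?_⟩
  have hpol : ∀ x ∈ M, ∀ y ∈ M, QuadraticMap.polar Q x y = 0 := fun x hx y hy => by
    rw [QuadraticMap.polar, hM _ (M.add_mem hx hy), hM x hx, hM y hy]; simp
  let M' : Submodule ℂ V := LinearMap.BilinForm.orthogonal (QuadraticMap.polarBilin Q) M
  have hMle : M ≤ M' := fun y hy x hx => hpol x hx y hy
  have hiso : ∀ v ∈ M', Q v = 0 → v ∈ M := by
    intro v hv hv0
    have h1 : ∀ x ∈ M ⊔ Submodule.span ℂ {v}, Q x = 0 := by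
      intro x hx
      obtain ⟨y, hy, z, hz, rfl⟩ := Submodule.mem_sup.1 hx
      obtain ⟨c, rfl⟩ := Submodule.mem_span_singleton.1 hz
      have h2 : QuadraticMap.polar Q y v = 0 := hv y hy
      rw [QuadraticMap.map_add Q, hM y hy, QuadraticMap.map_smul, hv0,
        QuadraticMap.polar_smul_right, h2]
      simp
    have h2 := Submodule.eq_of_le_of_finrank_le le_sup_left (hmax _ (hLM.trans le_sup_left) h1)
    rw [h2]
    exact Submodule.mem_sup_right (Submodule.mem_span_singleton_self v)
  have hdim : finrank ℂ M' = finrank ℂ V - finrank ℂ M :=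
    LinearMap.BilinForm.finrank_orthogonal hQ M
  have hle := Submodule.finrank_le M
  by_contra hvM
  have hvQ : Q v ≠ 0 := fun h0 => hvM (hiso v hv h0)
  -- For `x` in `M^⊥` a root `t` of the quadratic `Q (x + t v)` gives an isotropic vector of `M^⊥`,
  -- which lies in `M` by maximality.
  have hsup : M ⊔ Submodule.span ℂ {v} = M' := by
    refine le_antisymm (sup_le hMle ((Submodule.span_singleton_le_iff_mem v M').2 hv)) fun x hx => ?_
    obtain ⟨s, hs⟩ := IsAlgClosed.exists_eq_mul_self
      (discrim (Q v) (QuadraticMap.polar Q x v) (Q x))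
    obtain ⟨t, ht⟩ := exists_quadratic_eq_zero hvQ ⟨s, hs⟩
    have h1 : x + t • v ∈ M := by
      refine hiso _ (M'.add_mem hx (M'.smul_mem t hv)) ?_
      rw [QuadraticMap.map_add Q, QuadraticMap.map_smul, QuadraticMap.polar_smul_right, smul_eq_mul,
        smul_eq_mul]
      linear_combination ht
    have h2 : x = (x + t • v) + (-t) • v := by rw [neg_smul, add_neg_cancel_right]
    rw [h2]
    exact Submodule.add_mem _ (Submodule.mem_sup_left h1) (Submodule.mem_sup_right
      (Submodule.smul_mem _ _ (Submodule.mem_span_singleton_self v)))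
  have h3 : M ⊓ Submodule.span ℂ {v} = ⊥ := by
    rw [eq_bot_iff]
    rintro x ⟨hx, hx'⟩
    obtain ⟨c, rfl⟩ := Submodule.mem_span_singleton.1 hx'
    by_cases hc : c = 0
    · simp [hc]
    · exact absurd ((M.smul_mem_iff hc).1 hx) hvM
  have h4 := Submodule.finrank_sup_add_finrank_inf_eq M (Submodule.span ℂ {v})
  have hv0 : v ≠ 0 := fun h0 => hvM (h0 ▸ M.zero_mem)
  rw [h3, hsup, finrank_bot, finrank_span_singleton hv0] at h4
  -- Now `2n - dim M = dim M + 1`, impossible by parity.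
  omega

theorem exists_hyperbolicBasis (hQ : (QuadraticMap.polarBilin Q).Nondegenerate)
    {M : Submodule ℂ V} (hM : ∀ x ∈ M, Q x = 0)
    (hM' : ∀ v, (∀ x ∈ M, QuadraticMap.polar Q x v = 0) → v ∈ M) :
    ∃ (b : Basis (Fin (finrank ℂ M)) ℂ M) (w : Fin (finrank ℂ M) → V),
      IsHyperbolicBasis Q (fun i => (b i : V)) w := by
  let b := finBasis ℂ M
  have hpol : ∀ x ∈ M, ∀ y ∈ M, QuadraticMap.polar Q x y = 0 := fun x hx y hy => by
    rw [QuadraticMap.polar, hM _ (M.add_mem hx hy), hM x hx, hM y hy]; simp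
  have hdual : ∀ f : M →ₗ[ℂ] ℂ, ∃ v, ∀ x : M, QuadraticMap.polar Q x v = f x := by
    intro f
    obtain ⟨g, hg⟩ := f.exists_extend
    obtain ⟨v, hv⟩ := (LinearMap.BilinForm.toDual _ hQ).surjective g
    refine ⟨v, fun x => ?_⟩
    rw [← hg, ← hv, QuadraticMap.polar_comm]
    rfl
  choose w₀ hw₀ using fun j => hdual (b.coord j)
  have hp₀ : ∀ i j, QuadraticMap.polar Q (b i) (w₀ j) = if i = j then 1 else 0 := by
    intro i j
    rw [hw₀, Basis.coord_apply, Basis.repr_self, Finsupp.single_apply]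
  -- Subtracting half of the Gram matrix of the `w₀ i` makes the `w i` isotropic and mutually
  -- orthogonal; vectors of `M` do not affect the pairing with `M`.
  let w : Fin (finrank ℂ M) → V := fun i =>
    w₀ i - ∑ k, (QuadraticMap.polar Q (w₀ i) (w₀ k) / 2) • (b k : V)
  have hsumM : ∀ c : Fin (finrank ℂ M) → ℂ, ∑ k, c k • (b k : V) ∈ M := fun c =>
    Submodule.sum_mem _ fun k _ => M.smul_mem _ (b k).2
  have hsum : ∀ (c : Fin (finrank ℂ M) → ℂ) y, QuadraticMap.polar Q (∑ k, c k • (b k : V)) y =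
      ∑ k, c k * QuadraticMap.polar Q (b k) y := by
    intro c y
    change QuadraticMap.polarBilin Q _ y = ∑ k, c k * QuadraticMap.polarBilin Q _ y
    rw [map_sum, LinearMap.sum_apply]
    simp
  have hsub : ∀ x y z, QuadraticMap.polar Q (x - y) z =
      QuadraticMap.polar Q x z - QuadraticMap.polar Q y z := fun x y z =>
    QuadraticMap.polar_sub_left Q x y z
  have hsub' : ∀ x y z, QuadraticMap.polar Q z (x - y) =
      QuadraticMap.polar Q z x - QuadraticMap.polar Q z y := fun x y z =>
    QuadraticMap.polar_sub_right Q z x y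
  have hadd : ∀ x y z, QuadraticMap.polar Q (x + y) z =
      QuadraticMap.polar Q x z + QuadraticMap.polar Q y z := fun x y z =>
    QuadraticMap.polar_add_left Q x y z
  have hpair : ∀ i j, QuadraticMap.polar Q (b i) (w j) = if i = j then 1 else 0 := by
    intro i j
    rw [hsub', hp₀, hpol _ (b i).2 _ (hsumM _), sub_zero]
  have hright : ∀ i j, QuadraticMap.polar Q (w i) (w j) = 0 := by
    intro i j
    rw [hsub (w₀ i), hsum, hsub' (w₀ j), QuadraticMap.polar_comm Q (w₀ i) (∑ _, _), hsum]
    simp only [hpair]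
    simp only [hp₀]
    simp only [mul_ite, mul_one, mul_zero, Finset.sum_ite_eq', Finset.mem_univ, if_true]
    rw [QuadraticMap.polar_comm Q (w₀ j) (w₀ i)]
    ring
  refine ⟨b, w, fun i j => hpol _ (b i).2 _ (b j).2, hright, hpair, fun v => ?_⟩
  have hsumw : ∀ (c : Fin (finrank ℂ M) → ℂ) y, QuadraticMap.polar Q (∑ k, c k • w k) y =
      ∑ k, c k * QuadraticMap.polar Q (w k) y := by
    intro c y
    change QuadraticMap.polarBilin Q _ y = ∑ k, c k * QuadraticMap.polarBilin Q _ y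
    rw [map_sum, LinearMap.sum_apply]
    simp
  have hwb : ∀ i j, QuadraticMap.polar Q (w i) (b j) = if i = j then 1 else 0 := by
    intro i j
    rw [QuadraticMap.polar_comm, hpair]
    simp only [eq_comm]
  -- The remainder `t` is orthogonal to `M`, so it lies in `M`; being orthogonal to the dual vectors
  -- `w j`, it is zero.
  set t := v - (∑ i, QuadraticMap.polar Q v (w i) • (b i : V) +
    ∑ i, QuadraticMap.polar Q v (b i) • w i) with ht
  have htb : ∀ j, QuadraticMap.polar Q t (b j) = 0 := by
    intro j
    rw [ht, hsub, hadd, hsum, hsumw]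
    simp [hwb, hpol _ (b _).2 _ (b j).2]
  have htw : ∀ j, QuadraticMap.polar Q t (w j) = 0 := by
    intro j
    rw [ht, hsub, hadd, hsum, hsumw]
    simp [hpair, hright]
  have htM : t ∈ M := by
    refine hM' t fun x hx => ?_
    have h1 := congrArg Subtype.val (b.sum_repr ⟨x, hx⟩)
    rw [Submodule.coe_sum] at h1
    simp only [Submodule.coe_smul] at h1
    rw [← h1, hsum]
    refine Finset.sum_eq_zero fun k _ => ?_
    rw [QuadraticMap.polar_comm, htb, mul_zero]
  have ht0 : t = 0 := by
    have h1 := congrArg Subtype.val (b.sum_repr ⟨t, htM⟩)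
    rw [Submodule.coe_sum] at h1
    simp only [Submodule.coe_smul] at h1
    rw [← h1]
    refine Finset.sum_eq_zero fun j _ => ?_
    have h2 := htw j
    rw [← h1, hsum] at h2
    simp only [hpair, mul_ite, mul_one, mul_zero, Finset.sum_ite_eq', Finset.mem_univ,
      if_true] at h2
    rw [h2, zero_smul]
  exact sub_eq_zero.1 (ht.symm.trans ht0)

end Lagrangian

/-! ### Identity components under open surjections -/

section ComponentMaps

variable {G H : Type u} [Group G] [TopologicalSpace G] [SeparatelyContinuousMul G]
variable [Group H] [TopologicalSpace H] [SeparatelyContinuousMul H]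

theorem identityComponent_le_comap {f : G →* H} (hf : Continuous f) :
    identityComponent G ≤ (identityComponent H).comap f := fun x hx => by
  have h1 := hf.image_connectedComponent_subset 1 ⟨x, hx, rfl⟩
  rwa [map_one] at h1

theorem connectedComponent_eq_of_inv_mul_mem {x y : G} (h : x⁻¹ * y ∈ identityComponent G) :
    connectedComponent x = connectedComponent y := by
  have h1 := (continuous_const_mul x).image_connectedComponent_subset 1 ⟨_, h, rfl⟩
  simp only [mul_one, mul_inv_cancel_left] at h1
  exact connectedComponent_eq h1

/-- Fibres of `f` lie in single components of `G`, so the map from `G` to its space of components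
factors continuously through the quotient map `f`. That space is totally disconnected, so the
factored map is constant on the identity component of `H`. -/
theorem comap_identityComponent_le {f : G →* H} (hf : Continuous f) (hopen : IsOpenMap f)
    (hsurj : Function.Surjective f) (hker : f.ker ≤ identityComponent G) :
    (identityComponent H).comap f ≤ identityComponent G := by
  have hq : IsQuotientMap f := hopen.isQuotientMap hf hsurj
  let c : G → ConnectedComponents G := ConnectedComponents.mk
  have hc : ∀ x y, f x = f y → c x = c y := fun x y hxy => by
    refine ConnectedComponents.coe_eq_coe.2 (connectedComponent_eq_of_inv_mul_mem (hker ?_))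
    rw [MonoidHom.mem_ker, map_mul, map_inv, hxy, inv_mul_cancel]
  let g : H → ConnectedComponents G := fun h => c (hsurj h).choose
  have hg : g ∘ f = c := funext fun x => hc _ _ (hsurj (f x)).choose_spec
  have hgc : Continuous g := by
    rw [hq.continuous_iff, hg]
    exact ConnectedComponents.continuous_coe
  intro x hx
  have h1 : g (f x) = g (f 1) := by
    rw [map_one]
    exact (isPreconnected_connectedComponent.image g hgc.continuousOn).subsingleton
      ⟨f x, hx, rfl⟩ ⟨1, mem_connectedComponent, rfl⟩
  have h2 : c x = c 1 := by
    rw [← hg]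
    exact h1
  change x ∈ connectedComponent 1
  rw [← ConnectedComponents.coe_eq_coe.1 h2]
  exact mem_connectedComponent

end ComponentMaps

/-! ### A repeated odd block size gives a hyperbolic pair -/

section HyperbolicPairs

variable {V : Type*} [AddCommGroup V] [Module ℂ V] [FiniteDimensional ℂ V]
variable {B : V →ₗ[ℂ] V →ₗ[ℂ] ℂ} {e : End ℂ V}

/-- The symmetric form `B (e^a x) y` has rank at least two on `ker e^(a+1)`. With `u` and `z`
orthogonal and nonisotropic for it, suitable `u + s z` and `u - s z` are isotropic and pair
nontrivially. -/
theorem exists_hyperbolicPair_of_blockCount (h : IsSkewNilpotent B e) {a : ℕ} (ha : Even a)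
    (hpos : 1 < blockCount e (a + 1)) : ∃ u w, IsHyperbolicPair B e a u w := by
  obtain ⟨u, hu⟩ := exists_cyclicVector_of_blockCount h ha (by omega)
  have huu : B ((e ^ a) u) u = 1 := by rw [hu.pairing, if_pos rfl]
  have hsymm : ∀ x y, B ((e ^ a) x) y = B ((e ^ a) y) x := fun x y => by
    rw [h.swap_pairing a y x, ha.neg_one_pow, one_mul]
  have hne : ¬ kerRange e a ≤ kerRange e (a + 1) ⊔ Submodule.span ℂ {(e ^ a) u} := by
    intro hle
    have h1 := Submodule.finrank_mono hle
    have h2 := Submodule.finrank_add_le_finrank_add_finrank (kerRange e (a + 1))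
      (Submodule.span ℂ {(e ^ a) u})
    have h3 : finrank ℂ (Submodule.span ℂ {(e ^ a) u}) ≤ 1 :=
      (finrank_span_le_card {(e ^ a) u}).trans (by simp)
    rw [blockCount_succ] at hpos
    omega
  obtain ⟨p, ⟨hpk, ⟨v, rfl⟩⟩, hp'⟩ := SetLike.not_le_iff_exists.1 hne
  have hker : ∀ x, (e ^ (a + 1)) x = 0 ↔ e ((e ^ a) x) = 0 := fun x => by
    rw [pow_succ', Module.End.mul_apply]
  have huK : (e ^ a) u ∈ kerRange e a := ⟨(hker u).1 hu.nil, ⟨u, rfl⟩⟩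
  -- Projection along `u` onto its orthogonal for the form `B (e^a x) y`.
  let pr : V →ₗ[ℂ] V := LinearMap.id - (B ((e ^ a) u)).smulRight u
  have hpr : ∀ x, pr x = x - B ((e ^ a) u) x • u := fun x => rfl
  have hprB : ∀ x, B ((e ^ a) u) (pr x) = 0 := fun x => by
    rw [hpr, map_sub, map_smul, huu, smul_eq_mul, mul_one, sub_self]
  have hprk : ∀ x, (e ^ (a + 1)) x = 0 → (e ^ (a + 1)) (pr x) = 0 := fun x hx => by
    rw [hpr, map_sub, map_smul, hx, hu.nil, smul_zero, sub_zero]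
  have hv : (e ^ (a + 1)) (pr v) = 0 := hprk v ((hker v).2 hpk)
  have hpv : (e ^ a) (pr v) ∉ kerRange e (a + 1) := fun hmem => hp' (by
    have : (e ^ a) v = (e ^ a) (pr v) + B ((e ^ a) u) v • (e ^ a) u := by
      rw [hpr, map_sub, map_smul, sub_add_cancel]
    rw [this]
    exact Submodule.add_mem _ (Submodule.mem_sup_left hmem) (Submodule.mem_sup_right
      (Submodule.smul_mem _ _ (Submodule.mem_span_singleton_self _))))
  obtain ⟨-, w, -, hw, -, hvw⟩ := exists_pairing_of_notMem h
    (p := (e ^ a) (pr v)) ⟨(hker _).1 hv, ⟨_, rfl⟩⟩ hpv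
  have hvw' : B ((e ^ a) (pr v)) (pr w) ≠ 0 := by
    rw [hpr w, map_sub, map_smul, hsymm _ u, hprB, smul_zero, sub_zero]
    exact hvw
  obtain ⟨z, hz, hz0, hzz⟩ := exists_self_pairing h ha hv (hprk w hw) hvw'
  have huz : B ((e ^ a) u) z = 0 := by
    have : Submodule.span ℂ {pr v, pr w} ≤ LinearMap.ker (B ((e ^ a) u)) := by
      rw [Submodule.span_le]
      rintro x (rfl | rfl) <;> exact hprB _
    exact this hz
  have hzu : B ((e ^ a) z) u = 0 := by rw [hsymm, huz]
  obtain ⟨s, hs⟩ := IsAlgClosed.exists_pow_nat_eq (-(B ((e ^ a) z) z)⁻¹) two_pos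
  have hsv : s ^ 2 * B ((e ^ a) z) z = -1 := by
    rw [hs, neg_mul, inv_mul_cancel₀ hzz]
  obtain ⟨u', -, w', -, hp⟩ := h.exists_hyperbolicPair (a := a) (W := ⊤) (fun _ _ => trivial)
    (u := u + s • z) (w := u - s • z) trivial trivial (by simp [hu.nil, hz0])
    (by simp [hu.nil, hz0]) (by
      simp only [map_add, map_smul, LinearMap.add_apply, LinearMap.smul_apply, smul_eq_mul, huu,
        huz, hzu]
      linear_combination hsv) (by
      simp only [map_sub, map_smul, LinearMap.sub_apply, LinearMap.smul_apply, smul_eq_mul, huu,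
        huz, hzu]
      linear_combination hsv) (by
      simp only [map_add, map_sub, map_smul, LinearMap.add_apply, LinearMap.smul_apply,
        smul_eq_mul, huu, huz, hzu]
      intro h0
      have : (2 : ℂ) = 0 := by linear_combination h0 + hsv
      exact two_ne_zero this)
  exact ⟨u', w', hp⟩

end HyperbolicPairs

/-! ### Lifting one-parameter tori to `Spin(V)` -/

section Torus

variable {V : Type u} [AddCommGroup V] [Module ℂ V] [FiniteDimensional ℂ V]
variable {Q : QuadraticForm ℂ V}

/-- The one-parameter group of `Spin` scaling the vectors `u` and `w` of a hyperbolic plane. -/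
theorem exists_torus_of_plane {u w : V} (hu : Q u = 0) (hw : Q w = 0)
    (huw : QuadraticMap.polar Q u w = 1) :
    ∃ Y : {z : ℂ // z ≠ 0} → spinGroup Q, Continuous Y ∧
      (∀ z : {z : ℂ // z ≠ 0}, (z : ℂ) = 1 → Y z = 1) ∧
      (∀ z : {z : ℂ // z ≠ 0}, (z : ℂ) = -1 → (Y z : CliffordAlgebra Q) = -1) ∧
      ∀ z v, soEnd (covering Q (Y z)) v = v +
        (((z : ℂ) ^ 2 - 1) * QuadraticMap.polar Q w v) • u +
        (((z : ℂ)⁻¹ ^ 2 - 1) * QuadraticMap.polar Q u v) • w := by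
  have hwu : QuadraticMap.polar Q w u = 1 := by rw [QuadraticMap.polar_comm, huw]
  have hQ : ∀ z : ℂ, z ≠ 0 → Q (z⁻¹ • u + z • w) = 1 := fun z hz => by
    rw [QuadraticMap.map_add Q, QuadraticMap.map_smul, QuadraticMap.map_smul, hu, hw,
      QuadraticMap.polar_smul_left, QuadraticMap.polar_smul_right, huw]
    simp [hz]
  have hQ1 : Q (u + w) = 1 := by
    have := hQ 1 one_ne_zero
    simpa using this
  have hab : ∀ z : ℂ, z ≠ 0 → Q (u + w) * Q (z⁻¹ • u + z • w) = 1 := fun z hz => by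
    rw [hQ z hz, hQ1, one_mul]
  have hsq : ι Q (u + w) * ι Q (u + w) = 1 := by rw [ι_sq_scalar, hQ1, map_one]
  -- The lift is `(u + w) (z⁻¹ u + z w)`, a product of two vectors with `Q = 1`. It scales `u` by
  -- `z^2` and `w` by `z^(-2)`, so `z = -1` acts trivially on `V` although the lift is `-(u + w)^2 =
  -- -1`.
  refine ⟨fun z => ⟨_, ι_mul_ι_mem_spinGroup (hab z z.2)⟩, ?_, ?_, ?_, ?_⟩
  · rw [spin_continuous_iff]
    intro φ
    have : ∀ z : {z : ℂ // z ≠ 0}, φ (ι Q (u + w) * ι Q ((z : ℂ)⁻¹ • u + (z : ℂ) • w)) =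
        (z : ℂ)⁻¹ * φ (ι Q (u + w) * ι Q u) + (z : ℂ) * φ (ι Q (u + w) * ι Q w) := fun z => by
      rw [map_add (ι Q) ((z : ℂ)⁻¹ • u), map_smul, map_smul, mul_add, mul_smul_comm, mul_smul_comm,
        map_add, map_smul, map_smul, smul_eq_mul, smul_eq_mul]
    simp only [this]
    exact ((continuous_subtype_val.inv₀ fun z => z.2).mul continuous_const).add
      (continuous_subtype_val.mul continuous_const)
  · rintro ⟨z, hz⟩ (rfl : z = 1)
    apply Subtype.ext
    simp only [inv_one, one_smul]
    exact hsq
  · rintro ⟨z, hz⟩ (rfl : z = -1)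
    have : (-1 : ℂ)⁻¹ • u + (-1 : ℂ) • w = -(u + w) := by
      rw [inv_neg, inv_one, neg_smul, neg_smul, one_smul, one_smul, neg_add]
    simp only [this]
    rw [map_neg, mul_neg, hsq]
  · rintro ⟨z, hz⟩ v
    rw [covering_ι_mul_ι (hab z hz), hQ z hz, hQ1, QuadraticMap.polar_sub_right,
      QuadraticMap.polar_smul_right, QuadraticMap.polar_smul_right]
    have h1 : QuadraticMap.polar Q (u + w) (z⁻¹ • u + z • w) = z + z⁻¹ := by
      rw [QuadraticMap.polar_add_left, QuadraticMap.polar_add_right, QuadraticMap.polar_add_right]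
      simp only [QuadraticMap.polar_smul_right, QuadraticMap.polar_self, hu, hw, huw, hwu]
      simp
    rw [h1]
    simp only [QuadraticMap.polar_add_left, QuadraticMap.polar_smul_left]
    have h2 : z * z⁻¹ = 1 := mul_inv_cancel₀ hz
    set p := QuadraticMap.polar Q u v
    set q := QuadraticMap.polar Q w v
    simp only [smul_eq_mul, one_smul, one_mul]
    match_scalars
    · linear_combination p * h2
    · linear_combination q * h2
    · ring

/-- The plane tori for mutually orthogonal planes are multiplied together, each contributing a
factor `-1` at `z = -1`. -/
theorem exists_torus {u w : ℕ → V} (m : ℕ)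
    (huu : ∀ i < m, ∀ j < m, QuadraticMap.polar Q (u i) (u j) = 0)
    (hww : ∀ i < m, ∀ j < m, QuadraticMap.polar Q (w i) (w j) = 0)
    (huw : ∀ i < m, ∀ j < m, QuadraticMap.polar Q (u i) (w j) = if i = j then 1 else 0) :
    ∃ Y : {z : ℂ // z ≠ 0} → spinGroup Q, Continuous Y ∧
      (∀ z : {z : ℂ // z ≠ 0}, (z : ℂ) = 1 → Y z = 1) ∧
      (∀ z : {z : ℂ // z ≠ 0}, (z : ℂ) = -1 → (Y z : CliffordAlgebra Q) = (-1) ^ m) ∧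
      ∀ z v, soEnd (covering Q (Y z)) v = v +
        ((z : ℂ) ^ 2 - 1) • ∑ i ∈ Finset.range m, QuadraticMap.polar Q (w i) v • u i +
        ((z : ℂ)⁻¹ ^ 2 - 1) • ∑ i ∈ Finset.range m, QuadraticMap.polar Q (u i) v • w i := by
  induction m with
  | zero =>
    refine ⟨fun _ => 1, continuous_const, fun _ _ => rfl, fun _ _ => by simp, fun z v => ?_⟩
    rw [map_one]
    simp [soEnd_one]
  | succ m ih =>
    obtain ⟨Y, hYc, hY1, hYn, hYv⟩ := ih (fun i hi j hj => huu i (by omega) j (by omega))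
      (fun i hi j hj => hww i (by omega) j (by omega))
      (fun i hi j hj => huw i (by omega) j (by omega))
    have hiso : ∀ x : V, QuadraticMap.polar Q x x = 0 → Q x = 0 := fun x hx => by
      rw [QuadraticMap.polar_self, nsmul_eq_mul] at hx
      simpa using hx
    obtain ⟨Z, hZc, hZ1, hZn, hZv⟩ := exists_torus_of_plane
      (hiso _ (huu m (by omega) m (by omega))) (hiso _ (hww m (by omega) m (by omega)))
      (by rw [huw m (by omega) m (by omega), if_pos rfl])
    refine ⟨fun z => Y z * Z z, hYc.mul hZc, fun z hz => by
      simp only [hY1 z hz, hZ1 z hz, one_mul],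
      fun z hz => ?_, fun z v => ?_⟩
    · change (Y z : CliffordAlgebra Q) * Z z = _
      rw [hYn z hz, hZn z hz, pow_succ]
    · have h1 : ∀ i ∈ Finset.range m, QuadraticMap.polar Q (w i) (soEnd (covering Q (Z z)) v) =
          QuadraticMap.polar Q (w i) v := by
        intro i hi
        have hi := Finset.mem_range.1 hi
        rw [hZv]
        simp only [QuadraticMap.polar_add_right, QuadraticMap.polar_smul_right]
        rw [hww i (by omega) m (by omega), QuadraticMap.polar_comm Q (w i) (u m),
          huw m (by omega) i (by omega), if_neg (by omega)]
        simp
      have h2 : ∀ i ∈ Finset.range m, QuadraticMap.polar Q (u i) (soEnd (covering Q (Z z)) v) =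
          QuadraticMap.polar Q (u i) v := by
        intro i hi
        have hi := Finset.mem_range.1 hi
        rw [hZv]
        simp only [QuadraticMap.polar_add_right, QuadraticMap.polar_smul_right]
        rw [huu i (by omega) m (by omega), huw i (by omega) m (by omega), if_neg (by omega)]
        simp
      rw [map_mul, soEnd_mul, Module.End.mul_apply, hYv,
        Finset.sum_congr rfl fun i hi => congrArg (· • u i) (h1 i hi),
        Finset.sum_congr rfl fun i hi => congrArg (· • w i) (h2 i hi), hZv, Finset.sum_range_succ, Finset.sum_range_succ]
      module

end Torus

/-! ### A repeated odd block size connects `-1` to `1` -/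

section FirstCase

variable {V : Type u} [AddCommGroup V] [Module ℂ V] [FiniteDimensional ℂ V]
variable {Q : QuadraticForm ℂ V} {e : End ℂ V}

/-- The torus acts as `1 + (z^2 - 1) P_u + (z^(-2) - 1) P_w` with `P_u`, `P_w` the projections onto
the two chains, so it commutes with `e`. It runs over the connected set `ℂ \ {0}` from `1` to
`(-1)^(a+1)`, which is `-1` as `a` is even. -/
theorem neg_one_mem_identityComponent_of_hyperbolicPair
    (h : IsSkewNilpotent (QuadraticMap.polarBilin Q) e) {a : ℕ} (ha : Even a) {u w : V}
    (hp : IsHyperbolicPair (QuadraticMap.polarBilin Q) e a u w) :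
    ∃ x : centralizerSpin Q e, x ∈ identityComponent (centralizerSpin Q e) ∧
      ((x : spinGroup Q) : CliffordAlgebra Q) = -1 := by
  set B := QuadraticMap.polarBilin Q with hB
  have hBp : ∀ x y, QuadraticMap.polar Q x y = B x y := fun _ _ => rfl
  -- The vectors `(-1)^i e^(a-i) w` form the basis dual to the `e^i u`; here `(-1)^a = 1` is used.
  obtain ⟨Y, hYc, hY1, hYn, hYv⟩ := exists_torus (Q := Q) (u := fun i => (e ^ i) u)
    (w := fun i => (-1 : ℂ) ^ i • (e ^ (a - i)) w) (a + 1)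
    (fun i _ j _ => by
      rw [hBp, h.skew_pow', pow_add_apply, hp.left_iso, mul_zero])
    (fun i _ j _ => by
      rw [hBp, map_smul, map_smul, LinearMap.smul_apply, h.skew_pow', pow_add_apply,
        hp.right_iso]
      simp)
    (fun i hi j hj => by
      rw [hBp, map_smul, h.skew_pow', pow_add_apply, hp.pairing, smul_eq_mul, ← mul_assoc,
        ← pow_add, show j + (a - j) = a by omega, ha.neg_one_pow, one_mul]
      split_ifs <;> first | rfl | omega)
  have hc1 := chainOp_commute h hp.left_nil hp.right_nil
  have hc2 := chainOp_commute h hp.right_nil hp.left_nil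
  have hY : ∀ z, soEnd (covering Q (Y z)) = 1 + ((z : ℂ) ^ 2 - 1) • chainOp B e a w u +
      ((z : ℂ)⁻¹ ^ 2 - 1) • chainOp B e a u w := by
    intro z
    ext v
    rw [hYv]
    simp only [LinearMap.add_apply, LinearMap.smul_apply, Module.End.one_apply, chainOp_apply]
    refine congrArg₂ _ (congrArg _ (congrArg _ ?_)) (congrArg _ ?_)
    · rw [← Finset.sum_range_reflect]
      refine Finset.sum_congr rfl fun i hi => ?_
      have hi := Finset.mem_range.1 hi
      have h1 : (-1 : ℂ) ^ (a - i) = (-1) ^ i := by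
        have h2 : (-1 : ℂ) ^ (a - i) * (-1) ^ i = 1 := by
          rw [← pow_add, show a - i + i = a by omega, ha.neg_one_pow]
        have h3 : (-1 : ℂ) ^ i * (-1) ^ i = 1 := by rw [← mul_pow]; simp
        exact mul_right_cancel₀ (pow_ne_zero i (by norm_num)) (h2.trans h3.symm)
      rw [show a + 1 - 1 - i = a - i by omega, show a - (a - i) = i by omega, hBp, map_smul,
        LinearMap.smul_apply, smul_eq_mul, h1]
    · refine Finset.sum_congr rfl fun i hi => ?_
      rw [hBp, smul_smul, mul_comm]
  have hmem : ∀ z, Y z ∈ centralizerSpin Q e := by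
    intro z
    change covering Q (Y z) ∈ centralizerSO Q e
    have hcomm : Commute (soEnd (covering Q (Y z))) e := by
      rw [hY]
      exact ((Commute.one_left e).add_left (hc2.smul_left _)).add_left (hc1.smul_left _)
    exact fun v => LinearMap.congr_fun hcomm v
  have hconn : PreconnectedSpace {z : ℂ // z ≠ 0} := by
    refine isPreconnected_iff_preconnectedSpace.1 ?_
    exact (isConnected_compl_singleton_of_one_lt_rank (by
      rw [Complex.rank_real_complex]; exact Nat.one_lt_ofNat) (0 : ℂ)).isPreconnected
  have hcont : Continuous fun z => (⟨Y z, hmem z⟩ : centralizerSpin Q e) := hYc.subtype_mk _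
  refine ⟨⟨Y ⟨-1, by norm_num⟩, hmem _⟩, ?_, ?_⟩
  · refine (isPreconnected_range hcont).subset_connectedComponent ⟨⟨1, one_ne_zero⟩, ?_⟩ ⟨_, rfl⟩
    exact Subtype.ext (hY1 _ rfl)
  · change (Y _ : CliffordAlgebra Q) = -1
    rw [hYn _ rfl, pow_succ, ha.neg_one_pow, one_mul]

end FirstCase

/-! ### The isotropic core `∑ ker e^k ∩ im e^k` and its orthogonal -/

section Core

variable {V : Type*} [AddCommGroup V] [Module ℂ V]
variable {B : V →ₗ[ℂ] V →ₗ[ℂ] ℂ} {e : End ℂ V}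

/-- The sum of the subspaces `ker e^k ∩ im e^k` for `k ≤ m`. -/
def coreSum (e : End ℂ V) : ℕ → Submodule ℂ V
  | 0 => ⊥
  | m + 1 => coreSum e m ⊔ (LinearMap.ker (e ^ (m + 1)) ⊓ LinearMap.range (e ^ (m + 1)))

theorem coreSum_le {S : Submodule ℂ V}
    (hS : ∀ k, LinearMap.ker (e ^ k) ⊓ LinearMap.range (e ^ k) ≤ S) (m : ℕ) : coreSum e m ≤ S := by
  induction m with
  | zero => exact bot_le
  | succ m ih => exact sup_le ih (hS _)

theorem ker_inf_range_le_coreSum {k m : ℕ} (hk : k ≤ m) :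
    LinearMap.ker (e ^ k) ⊓ LinearMap.range (e ^ k) ≤ coreSum e m := by
  induction m with
  | zero =>
    obtain rfl : k = 0 := by omega
    rintro x ⟨hx, -⟩
    have hx : x = 0 := hx
    rw [hx]
    exact Submodule.zero_mem _
  | succ m ih =>
    rcases Nat.lt_or_ge m k with hlt | hge
    · obtain rfl : k = m + 1 := by omega
      exact le_sup_right
    · exact (ih hge).trans le_sup_left

theorem ker_inf_range_le_coreSum_of_pow {N : ℕ} (hN : e ^ N = 0) (k : ℕ) :
    LinearMap.ker (e ^ k) ⊓ LinearMap.range (e ^ k) ≤ coreSum e N := by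
  rcases le_total k N with hk | hk
  · exact ker_inf_range_le_coreSum hk
  · rintro x ⟨-, ⟨z, rfl⟩⟩
    rw [pow_eq_zero_of_le (a := N) (by rw [hN]; rfl) hk]
    exact Submodule.zero_mem _

theorem coreSum_stable {k : End ℂ V} (hk : Commute k e) (m : ℕ) :
    ∀ x ∈ coreSum e m, k x ∈ coreSum e m := by
  induction m with
  | zero =>
    intro x hx
    have hx : x = 0 := hx
    rw [hx, map_zero]
    exact Submodule.zero_mem _
  | succ m ih =>
    intro x hx
    obtain ⟨y, hy, z, hz, rfl⟩ := Submodule.mem_sup.1 hx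
    rw [map_add]
    exact Submodule.add_mem_sup (ih y hy) (ker_inf_range_stable hk _ _ z hz)

theorem coreSum_le_ker (m : ℕ) : coreSum e m ≤ LinearMap.ker (e ^ m) := by
  induction m with
  | zero => exact bot_le
  | succ m ih =>
    refine sup_le (fun x hx => ?_) inf_le_left
    exact pow_eq_zero_of_le (ih hx) m.le_succ

/-- For `j ≤ k`, a vector killed by `e^j` is orthogonal to `im e^k`, as `e^k` can be moved across
`B`. -/
theorem coreSum_isotropic (h : IsSkewNilpotent B e) (m : ℕ) :
    ∀ x ∈ coreSum e m, ∀ y ∈ coreSum e m, B x y = 0 := by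
  have key : ∀ j k : ℕ, j ≤ k → ∀ x ∈ LinearMap.ker (e ^ j) ⊓ LinearMap.range (e ^ j),
      ∀ y ∈ LinearMap.ker (e ^ k) ⊓ LinearMap.range (e ^ k), B x y = 0 := by
    rintro j k hjk x ⟨hx, -⟩ _ ⟨-, ⟨y, rfl⟩⟩
    rw [h.skew_pow', pow_eq_zero_of_le hx hjk]
    simp
  have key2 : ∀ j k : ℕ, ∀ x ∈ LinearMap.ker (e ^ j) ⊓ LinearMap.range (e ^ j),
      ∀ y ∈ LinearMap.ker (e ^ k) ⊓ LinearMap.range (e ^ k), B x y = 0 := by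
    intro j k x hx y hy
    rcases le_total j k with hjk | hjk
    · exact key j k hjk x hx y hy
    · rw [h.symm]
      exact key k j hjk y hy x hx
  intro x hx y hy
  have h1 : coreSum e m ≤ LinearMap.ker (B x) := coreSum_le (fun k z hz => by
    have h2 : coreSum e m ≤ LinearMap.ker (B z) := coreSum_le (fun j t ht => key2 _ _ z hz t ht) m
    change B x z = 0
    rw [h.symm]
    exact h2 hx) m
  exact h1 hy

section Perp

variable [FiniteDimensional ℂ V]

/-- `ker e^k` and `im e^k` are orthogonals of each other, so the orthogonal of their intersection is
their sum. -/
theorem mem_range_sup_ker_of_orthogonal (h : IsSkewNilpotent B e) {k : ℕ} {x : V}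
    (hx : ∀ y ∈ LinearMap.ker (e ^ k) ⊓ LinearMap.range (e ^ k), B y x = 0) :
    x ∈ LinearMap.range (e ^ k) ⊔ LinearMap.ker (e ^ k) := by
  have hrefl : LinearMap.BilinForm.IsRefl B := fun x y hxy => by rw [h.symm, hxy]
  have hnd : LinearMap.BilinForm.Nondegenerate B :=
    ⟨h.nondeg, fun x hx => h.nondeg x fun y => by rw [h.symm, hx]⟩
  rw [← LinearMap.BilinForm.orthogonal_orthogonal hnd hrefl (LinearMap.range (e ^ k) ⊔ _)]
  intro y hy
  refine hx y ⟨?_, ?_⟩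
  · refine h.nondeg _ fun z => ?_
    have h1 : B ((e ^ k) z) y = 0 := hy _ (Submodule.mem_sup_left ⟨z, rfl⟩)
    rw [h.skew_pow, h.symm, h1, mul_zero]
  · rw [SetLike.mem_coe, h.mem_range_pow_iff]
    intro z hz
    rw [h.symm]
    exact hy _ (Submodule.mem_sup_right hz)

/-- A vector orthogonal to all `ker e^k ∩ im e^k` is a sum of vectors in
`ker e^(k+1) ∩ im e^k`. -/
theorem mem_of_orthogonal_coreSum (h : IsSkewNilpotent B e) {N : ℕ} (hN : e ^ N = 0)
    {S : Submodule ℂ V}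
    (hS : ∀ k, LinearMap.ker (e ^ (k + 1)) ⊓ LinearMap.range (e ^ k) ≤ S) {x : V}
    (hx : ∀ y ∈ coreSum e N, B y x = 0) : x ∈ S := by
  have hmem : ∀ k, x ∈ LinearMap.range (e ^ k) ⊔ LinearMap.ker (e ^ k) := fun k =>
    mem_range_sup_ker_of_orthogonal h fun y hy => hx y (ker_inf_range_le_coreSum_of_pow hN k hy)
  have hle : ∀ i j, LinearMap.ker (e ^ (i + 1)) ⊓ LinearMap.range (e ^ i) ≤
      LinearMap.range (e ^ j) ⊔ LinearMap.ker (e ^ j) := by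
    rintro i j y ⟨hy, ⟨z, rfl⟩⟩
    rcases le_or_gt j i with hji | hij
    · refine Submodule.mem_sup_left ⟨(e ^ (i - j)) z, ?_⟩
      rw [pow_add_apply, Nat.add_sub_cancel' hji]
    · exact Submodule.mem_sup_right (pow_eq_zero_of_le hy hij)
  -- Inductively `x - y` lies in `im e^k`. Writing it as an element of `im e^(k+1)` plus `t` in `ker
  -- e^(k+1)`, the term `t` also lies in `im e^k`, hence in `S`, and is absorbed into `y`.
  have key : ∀ k, ∃ y ∈ S, (∀ j, y ∈ LinearMap.range (e ^ j) ⊔ LinearMap.ker (e ^ j)) ∧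
      x - y ∈ LinearMap.range (e ^ k) := by
    intro k
    induction k with
    | zero =>
      exact ⟨0, S.zero_mem, fun j => Submodule.zero_mem _, ⟨x, by simp⟩⟩
    | succ k ih =>
      obtain ⟨y, hyS, hy, hxy⟩ := ih
      obtain ⟨s, ⟨z, rfl⟩, t, ht, hst⟩ :=
        Submodule.mem_sup.1 (Submodule.sub_mem _ (hmem (k + 1)) (hy (k + 1)))
      have ht' : t ∈ LinearMap.ker (e ^ (k + 1)) ⊓ LinearMap.range (e ^ k) := by
        refine ⟨ht, ?_⟩
        rw [SetLike.mem_coe, ← add_sub_cancel_left ((e ^ (k + 1)) z) t, hst]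
        refine Submodule.sub_mem _ hxy ⟨e z, ?_⟩
        rw [pow_succ, Module.End.mul_apply]
      refine ⟨y + t, S.add_mem hyS (hS k ht'), fun j => Submodule.add_mem _ (hy j) (hle k j ht'),
        ⟨z, ?_⟩⟩
      rw [← sub_sub, ← hst, add_sub_cancel_right]
  obtain ⟨y, hy, -, hxy⟩ := key N
  rw [hN] at hxy
  obtain ⟨z, hz⟩ := hxy
  rw [sub_eq_zero.1 hz.symm]
  exact hy

/-- A vector of `ker e^(j+1) ∩ im e^j` lies in the core if `e^j` takes it to `im e^(2j+1)`. -/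
theorem mem_coreSum_of_pow_mem {N : ℕ} (hN : e ^ N = 0) {j : ℕ} {u : V}
    (hu : (e ^ (j + j + 1)) u = 0) (hp : (e ^ (j + j)) u ∈ LinearMap.range (e ^ (j + j + 1))) :
    (e ^ j) u ∈ coreSum e N := by
  obtain ⟨t, ht⟩ := hp
  -- The vector `e^j u` is split into a part in `ker e^j ∩ im e^j` and the part `e^(j+1) t` in `ker
  -- e^(j+1) ∩ im e^(j+1)`.
  have h1 : (e ^ j) u - (e ^ (j + 1)) t ∈ coreSum e N := by
    refine ker_inf_range_le_coreSum_of_pow hN j ⟨?_, ⟨u - e t, ?_⟩⟩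
    · rw [SetLike.mem_coe, LinearMap.mem_ker, map_sub, pow_add_apply, pow_add_apply, ← ht,
        ← add_assoc, sub_self]
    · rw [map_sub, pow_succ, Module.End.mul_apply]
  have h2 : (e ^ (j + 1)) t ∈ coreSum e N := by
    refine ker_inf_range_le_coreSum_of_pow hN (j + 1) ⟨?_, ⟨t, rfl⟩⟩
    rw [SetLike.mem_coe, LinearMap.mem_ker, pow_add_apply,
      show j + 1 + (j + 1) = 1 + (j + j + 1) by omega, ← pow_add_apply, ht, pow_add_apply,
      add_comm, hu]
  rw [← sub_add_cancel ((e ^ j) u) ((e ^ (j + 1)) t)]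
  exact Submodule.add_mem _ h1 h2

/-- Put `a = 2j` and `x = e^j u`. The class of `e^a u` lies in the quotient of `ker e ∩ im e^a` by
`ker e ∩ im e^(a+1)`, of dimension at most one. There `k` acts by a scalar `c` with `c^2 = 1`, and
`c ≠ -1`, so `c = 1` and `mem_coreSum_of_pow_mem` applies to `k u - u`. If the class is zero, `x` is
itself in the core. -/
theorem IsCayley.sub_mem_coreSum (h : IsSkewNilpotent B e) {N : ℕ} (hN : e ^ N = 0)
    (hodd : ∀ a, Even a → blockCount e (a + 1) ≤ 1) {k : End ℂ V} (hk : IsCayley B e k) (j : ℕ) :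
    ∀ x ∈ LinearMap.ker (e ^ (j + 1)) ⊓ LinearMap.range (e ^ j), k x - x ∈ coreSum e N := by
  rintro _ ⟨hx, ⟨u, rfl⟩⟩
  have hu : (e ^ (j + j + 1)) u = 0 := by
    have : (e ^ (j + 1)) ((e ^ j) u) = 0 := hx
    rwa [pow_add_apply, add_right_comm] at this
  set a := j + j with ha
  have hker : ∀ x, (e ^ (a + 1)) x = 0 ↔ e ((e ^ a) x) = 0 := fun x => by
    rw [pow_succ', Module.End.mul_apply]
  have hku : (e ^ (a + 1)) (k u) = 0 := by rw [← comm_pow_apply hk.comm, hu, map_zero]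
  have hKu : (e ^ a) u ∈ kerRange e a := ⟨(hker u).1 hu, ⟨u, rfl⟩⟩
  by_cases hp : (e ^ a) u ∈ kerRange e (a + 1)
  · have hmem := mem_coreSum_of_pow_mem hN hu hp.2
    exact Submodule.sub_mem _ (coreSum_stable hk.comm N _ hmem) hmem
  have hb := hodd a ⟨j, ha⟩
  rw [blockCount_succ] at hb
  have hsup : kerRange e (a + 1) ⊔ Submodule.span ℂ {(e ^ a) u} = kerRange e a := by
    have hle : kerRange e (a + 1) ⊔ Submodule.span ℂ {(e ^ a) u} ≤ kerRange e a :=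
      sup_le (kerRange_succ_le a) ((Submodule.span_singleton_le_iff_mem _ _).2 hKu)
    refine Submodule.eq_of_le_of_finrank_le hle ?_
    have hlt : kerRange e (a + 1) < kerRange e (a + 1) ⊔ Submodule.span ℂ {(e ^ a) u} := by
      refine lt_of_le_of_ne le_sup_left fun heq => hp ?_
      rw [heq]
      exact Submodule.mem_sup_right (Submodule.mem_span_singleton_self _)
    have := Submodule.finrank_lt_finrank_of_lt hlt
    omega
  have hdec : ∀ p ∈ kerRange e a, ∃ c : ℂ, ∃ t, p = c • (e ^ a) u + (e ^ (a + 1)) t ∧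
      (e ^ (a + 1)) t ∈ kerRange e (a + 1) := by
    intro p hp
    rw [← hsup] at hp
    obtain ⟨q, ⟨hq, ⟨t, rfl⟩⟩, r, hr, rfl⟩ := Submodule.mem_sup.1 hp
    obtain ⟨c, rfl⟩ := Submodule.mem_span_singleton.1 hr
    exact ⟨c, t, add_comm _ _, hq, ⟨t, rfl⟩⟩
  have hzero : ∀ t y, (e ^ (a + 1)) y = 0 → B ((e ^ (a + 1)) t) y = 0 := fun t y hy => by
    rw [h.skew_pow, hy, map_zero, mul_zero]
  have hae : Even a := ⟨j, ha⟩
  have hsymm : ∀ x y, B ((e ^ a) x) y = B ((e ^ a) y) x := fun x y => by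
    rw [h.swap_pairing a y x, hae.neg_one_pow, one_mul]
  have huu : B ((e ^ a) u) u ≠ 0 := by
    intro h0
    obtain ⟨-, w, -, hw, -, hpw⟩ := exists_pairing_of_notMem h hKu hp
    obtain ⟨c, t, hct, -⟩ := hdec ((e ^ a) w) ⟨(hker w).1 hw, ⟨w, rfl⟩⟩
    apply hpw
    rw [hsymm, hct, map_add, map_smul, LinearMap.add_apply, LinearMap.smul_apply, h0,
      hzero t u hu, smul_zero, add_zero]
  obtain ⟨c, t, hct, htK⟩ := hdec (k ((e ^ a) u)) (kerRange_stable hk.comm a _ hKu)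
  have hcc : c * c = 1 := by
    have h1 : B (k ((e ^ a) u)) (k u) = B ((e ^ a) u) u := hk.isometry _ _
    rw [hct, map_add, map_smul, LinearMap.add_apply, LinearMap.smul_apply, hzero t _ hku,
      add_zero, hsymm, ← comm_pow_apply hk.comm, hct, map_add, map_smul, LinearMap.add_apply,
      LinearMap.smul_apply, hzero t u hu, add_zero, smul_eq_mul, smul_eq_mul, ← mul_assoc] at h1
    exact mul_right_cancel₀ huu (h1.trans (one_mul _).symm)
  -- With `c = -1`, the injective map `1 + k` would send `ker e ∩ im e^a` into the strictly smaller
  -- `ker e ∩ im e^(a+1)`.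
  have hc1 : c ≠ -1 := by
    rintro rfl
    have h1 : ∀ p ∈ kerRange e a, (1 + k) p ∈ kerRange e (a + 1) := by
      intro p hp
      obtain ⟨d, s, rfl, hs⟩ := hdec p hp
      have h2 : (1 + k) (d • (e ^ a) u + (e ^ (a + 1)) s) =
          d • (e ^ (a + 1)) t + ((e ^ (a + 1)) s + k ((e ^ (a + 1)) s)) := by
        rw [LinearMap.add_apply, Module.End.one_apply, map_add, map_smul, hct]
        module
      rw [h2]
      exact Submodule.add_mem _ (Submodule.smul_mem _ _ htK)
        (Submodule.add_mem _ hs (kerRange_stable hk.comm _ _ hs))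
    have h2 : finrank ℂ (kerRange e a) ≤ finrank ℂ (kerRange e (a + 1)) := by
      refine LinearMap.finrank_le_finrank_of_injective (f := (1 + k).restrict h1) fun x y hxy => ?_
      exact Subtype.ext (hk.injective (congrArg Subtype.val hxy))
    exact hp (Submodule.eq_of_le_of_finrank_le (kerRange_succ_le a) h2 ▸ hKu)
  have hc : c = 1 := (mul_self_eq_one_iff.1 hcc).resolve_right hc1
  rw [comm_pow_apply hk.comm, ← map_sub]
  refine mem_coreSum_of_pow_mem hN ?_ ⟨t, ?_⟩
  · rw [map_sub, hku, hu, sub_zero]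
  · rw [map_sub, ← comm_pow_apply hk.comm, ← ha, hct, hc, one_smul, add_sub_cancel_left]

theorem sub_mem_coreSum_of_mem_cayleyMonoid (h : IsSkewNilpotent B e) {N : ℕ} (hN : e ^ N = 0)
    (hodd : ∀ a, Even a → blockCount e (a + 1) ≤ 1) {k : End ℂ V} (hk : k ∈ cayleyMonoid B e)
    {x : V} (hx : ∀ y ∈ coreSum e N, B y x = 0) : k x - x ∈ coreSum e N := by
  induction hk using Submonoid.closure_induction with
  | mem k hk =>
    change x ∈ (coreSum e N).comap (k - 1)
    refine mem_of_orthogonal_coreSum h hN (fun j y hy => ?_) hx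
    change k y - y ∈ coreSum e N
    exact hk.sub_mem_coreSum h hN hodd j y hy
  | one => simp
  | mul k l hk _ ihk ihl =>
    have h1 : (k * l) x - x = k (l x - x) + (k x - x) := by
      rw [Module.End.mul_apply, map_sub]; abel
    rw [h1]
    exact Submodule.add_mem _
      (coreSum_stable (isCentIsometry_of_mem h (cayleyMonoid_le hk)).comm N _ ihl) ihk

/-- The new summand meets the previous sum in `ker e^m ∩ im e^(m+1)`, and determinants on all `ker
e^b ∩ im e^c` are products of the `d_i`. -/
theorem detOn_coreSum {k : End ℂ V} (hk : Commute k e) (hd : ∀ b, detOn k (kerRange e b) = 1)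
    (m : ℕ) : detOn k (coreSum e m) = 1 := by
  have h1 : ∀ b c, detOn k (LinearMap.ker (e ^ b) ⊓ LinearMap.range (e ^ c)) = 1 := fun b c => by
    rw [detOn_ker_inf_range hk]
    exact Finset.prod_eq_one fun i _ => hd _
  induction m with
  | zero => exact detOn_bot
  | succ m ih =>
    have h2 := detOn_sup_mul_inf (coreSum_stable hk m) (ker_inf_range_stable hk (m + 1) (m + 1))
    have h3 : coreSum e m ⊓ (LinearMap.ker (e ^ (m + 1)) ⊓ LinearMap.range (e ^ (m + 1))) =
        LinearMap.ker (e ^ m) ⊓ LinearMap.range (e ^ (m + 1)) := by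
      apply le_antisymm
      · rintro x ⟨hx, -, hx'⟩
        exact ⟨coreSum_le_ker m hx, hx'⟩
      · rintro _ ⟨hx, ⟨z, rfl⟩⟩
        refine ⟨ker_inf_range_le_coreSum le_rfl ⟨hx, ⟨e z, ?_⟩⟩,
          pow_eq_zero_of_le hx m.le_succ, ⟨z, rfl⟩⟩
        rw [pow_succ, Module.End.mul_apply]
    rw [h3, h1, h1, ih, mul_one, mul_one] at h2
    exact h2

theorem detOn_eq_of_sub_mem {T : End ℂ V} {p q : Submodule ℂ V} (hqp : q ≤ p)
    (hq : ∀ x ∈ q, T x ∈ q) (hp : ∀ x ∈ p, T x - x ∈ q) : detOn T p = detOn T q := by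
  have hp' : ∀ x ∈ p, T x ∈ p := fun x hx => by
    rw [← sub_add_cancel (T x) x]
    exact p.add_mem (hqp (hp x hx)) hx
  rw [detOn_eq hp', detOn_eq hq, det_eq_of_exact (f := T.restrict hq) (h := 1)
    (Submodule.inclusion hqp) (q.submoduleOf p).mkQ (Submodule.inclusion_injective _)
    (Submodule.mkQ_surjective _) ?_ (fun x => rfl) fun x => ?_]
  · rw [map_one, mul_one]
  · rw [Submodule.ker_mkQ, Submodule.range_inclusion]
    rfl
  · symm
    rw [Module.End.one_apply, ← sub_eq_zero, ← map_sub, Submodule.mkQ_apply,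
      Submodule.Quotient.mk_eq_zero]
    exact hp x x.2

end Perp

end Core

/-! ### The sign by which stabilizers of a Lagrangian act on the vacuum -/

section VacuumCharacter

variable {V : Type u} [AddCommGroup V] [Module ℂ V] [FiniteDimensional ℂ V]
variable {Q : QuadraticForm ℂ V}

theorem spin_mul_ι (x : spinGroup Q) (v : V) :
    (x : CliffordAlgebra Q) * ι Q v = ι Q (soEnd (covering Q x) v) * x := by
  have h1 : ι Q (soEnd (covering Q x) v) = _ := ι_covering Q x v
  rw [h1, mul_assoc, spinGroup.star_mul_self_of_mem x.2, mul_one]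

theorem spin_mul_prod (x : spinGroup Q) (l : List V) :
    (x : CliffordAlgebra Q) * (l.map (ι Q)).prod =
      ((l.map (soEnd (covering Q x))).map (ι Q)).prod * x := by
  induction l with
  | nil => simp
  | cons v l ih =>
    simp only [List.map_cons, List.prod_cons]
    rw [← mul_assoc, spin_mul_ι, mul_assoc, ih, mul_assoc]

/-- Vectors of an isotropic `M` square to zero in `C(V)`, so their product factors through the
exterior algebra of `M`, and in top degree `g` acts by its determinant. -/
theorem prod_map_eq_det_smul {M : Submodule ℂ V} (hM : ∀ x ∈ M, Q x = 0) {m : ℕ}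
    (b : Basis (Fin m) ℂ M) {g : End ℂ V} (hg : ∀ x ∈ M, g x ∈ M) :
    vacuum Q (fun i => g (b i)) = detOn g M • vacuum Q (fun i => (b i : V)) := by
  let f : M →ₗ[ℂ] CliffordAlgebra Q := ι Q ∘ₗ M.subtype
  have hf : ∀ x, f x * f x = 0 := fun x => by
    change ι Q (x : V) * ι Q (x : V) = 0
    rw [ι_sq_scalar, hM x x.2, map_zero]
  let A : M [⋀^Fin m]→ₗ[ℂ] CliffordAlgebra Q :=
    (ExteriorAlgebra.lift ℂ ⟨f, hf⟩).toLinearMap.compAlternatingMap (ExteriorAlgebra.ιMulti ℂ m)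
  have hA : ∀ v : Fin m → M, A v = vacuum Q (fun i => (v i : V)) := by
    intro v
    change ExteriorAlgebra.lift ℂ ⟨f, hf⟩ (ExteriorAlgebra.ιMulti ℂ m v) = _
    rw [ExteriorAlgebra.ιMulti_apply, map_list_prod, List.map_ofFn, vacuum, List.map_ofFn]
    congr 2
    funext i
    exact ExteriorAlgebra.lift_ι_apply ℂ f hf (v i)
  -- Linear functionals reduce the claim to scalar-valued alternating maps, which are multiples of
  -- the basis determinant.
  have h1 : A (g.restrict hg ∘ b) = LinearMap.det (g.restrict hg) • A b := by
    rw [← sub_eq_zero, ← forall_dual_apply_eq_zero_iff ℂ]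
    intro φ
    have h2 := congrArg (fun β => β (g.restrict hg ∘ b))
      ((φ.compAlternatingMap A).eq_smul_basis_det b)
    simp only [LinearMap.compAlternatingMap_apply, AlternatingMap.smul_apply, smul_eq_mul,
      b.det_comp, b.det_self, mul_one] at h2
    rw [map_sub, h2, map_smul, smul_eq_mul, mul_comm, sub_self]
  rw [hA, hA] at h1
  rw [detOn_eq hg]
  exact h1

/-- Determinant `1` gives `x ω = ω x`. As `x ω` is killed by `M`, it equals `c ω`, and applying star
gives `ω x* = c ω`. Hence `c^2 ω = x ω x* = ω x x* = ω`. -/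
theorem spin_mul_vacuum {M : Submodule ℂ V} (hM : ∀ x ∈ M, Q x = 0) {m : ℕ}
    {b : Basis (Fin m) ℂ M} {w : Fin m → V} (hb : IsHyperbolicBasis Q (fun i => (b i : V)) w)
    {x : spinGroup Q} (hg : ∀ v ∈ M, soEnd (covering Q x) v ∈ M)
    (hdet : detOn (soEnd (covering Q x)) M = 1) :
    (x : CliffordAlgebra Q) * vacuum Q (fun i => (b i : V)) = vacuum Q (fun i => (b i : V)) ∨
    (x : CliffordAlgebra Q) * vacuum Q (fun i => (b i : V)) = -vacuum Q (fun i => (b i : V)) := by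
  have hswap : (x : CliffordAlgebra Q) * vacuum Q (fun i => (b i : V)) =
      vacuum Q (fun i => (b i : V)) * x := by
    have h1 := spin_mul_prod x (List.ofFn fun i => (b i : V))
    have h2 := prod_map_eq_det_smul hM b hg
    rw [hdet, one_smul] at h2
    have h3 : (List.ofFn fun i => (b i : V)).map (soEnd (covering Q x)) =
        List.ofFn fun i => soEnd (covering Q x) (b i) := List.map_ofFn
    rw [h3] at h1
    exact h1.trans (congrArg (· * (x : CliffordAlgebra Q)) h2)
  set ω := vacuum Q (fun i => (b i : V)) with hω
  have hsurj : ∀ v ∈ M, ∃ v' ∈ M, soEnd (covering Q x) v' = v := by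
    have hinj : Function.Injective ((soEnd (covering Q x)).restrict hg) := fun y y' hyy =>
      Subtype.ext ((covering Q x : V ≃ₗ[ℂ] V).injective (congrArg Subtype.val hyy))
    intro v hv
    obtain ⟨y, hy⟩ := LinearMap.injective_iff_surjective.1 hinj ⟨v, hv⟩
    exact ⟨y, y.2, congrArg Subtype.val hy⟩
  have hkill : ∀ v ∈ M, ι Q v * ω = 0 := by
    intro v hv
    have h1 : M ≤ LinearMap.ker (LinearMap.mulRight ℂ ω ∘ₗ ι Q) := by
      rw [← Submodule.map_subtype_top M, ← b.span_eq, Submodule.map_span, Submodule.span_le]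
      rintro _ ⟨_, ⟨i, rfl⟩, rfl⟩
      exact hb.left_mul_vacuum i
    exact h1 hv
  obtain ⟨c, hc⟩ := hb.mul_vacuum_eq_smul (x := x) fun i => by
    obtain ⟨v, hv, hvi⟩ := hsurj (b i) (b i).2
    rw [← hvi, ← mul_assoc, ← spin_mul_ι, mul_assoc, hkill v hv, mul_zero]
  obtain ⟨s, hs, hstar⟩ := hb.star_vacuum
  have hs0 : s ≠ 0 := left_ne_zero_of_mul_eq_one hs
  have h1 : ω * star (x : CliffordAlgebra Q) = c • ω := by
    have h2 := congrArg star hc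
    rw [star_mul, hstar, CliffordAlgebra.star_smul, hstar, smul_mul_assoc, smul_comm c s] at h2
    exact smul_right_injective _ hs0 h2
  have h3 : (c * c) • ω = (1 : ℂ) • ω := by
    rw [mul_smul, ← h1, ← smul_mul_assoc, ← hc, hswap, mul_assoc,
      spinGroup.mul_star_self_of_mem x.2, mul_one, one_smul]
  have h4 : c * c = 1 := smul_left_injective ℂ hb.vacuum_ne_zero h3
  rcases mul_self_eq_one_iff.1 h4 with rfl | rfl
  · left; rw [hc, one_smul]
  · right; rw [hc, neg_smul, one_smul]

end VacuumCharacter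

/-! ### A continuous sign splits a double covering over the identity component -/

section Lift

variable {G H : Type u} [Group G] [TopologicalSpace G] [SeparatelyContinuousMul G]
variable [Group H] [TopologicalSpace H] [SeparatelyContinuousMul H]

/-- On the connected component of `1` the sign `F` is constant, while `F z = -1`. The sheet `F = 1`
over the identity component of `H` maps to it bijectively by an open map, so it is connected. -/
theorem mem_identityComponent_of_sign {f : G →* H} (hopen : IsOpenMap f)
    (hf : Continuous f) (hsurj : Function.Surjective f) {z : G} (hz1 : f z = 1)
    (hker : ∀ x, f x = 1 → x = 1 ∨ x = z) {F : G → ℂ} (hF : Continuous F) (hF1 : F 1 = 1)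
    (hFz : ∀ x, F (x * z) = -F x)
    (hsign : ∀ x, f x ∈ identityComponent H → F x = 1 ∨ F x = -1) :
    z ∉ identityComponent G ∧
      ∀ x, f x ∈ identityComponent H → F x = 1 → x ∈ identityComponent G := by
  constructor
  · intro hz
    have h1 : Set.MapsTo F (connectedComponent (1 : G)) {1, -1} := fun x hx =>
      hsign x (identityComponent_le_comap hf hx)
    have h2 : F 1 = F z := isPreconnected_connectedComponent.constant_of_mapsTo
      (Set.toFinite ({1, -1} : Set ℂ)).isDiscrete hF.continuousOn h1 mem_connectedComponent hz
    have h3 := hFz 1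
    rw [one_mul, ← h2, hF1] at h3
    norm_num at h3
  · intro x hx hFx
    let S : Set H := connectedComponent 1
    let r := S.restrictPreimage f
    -- The sheet `F = 1`, written so that it is visibly open.
    let P : Set (f ⁻¹' S) := {x | F x ≠ -1}
    have hP : IsOpen P := isOpen_ne_fun (hF.comp continuous_subtype_val) continuous_const
    have hr : IsOpenMap (P.domRestrict r) := (hopen.restrictPreimage S).domRestrict hP
    have hFP : ∀ y : P, F y = 1 := fun y => (hsign _ y.1.2).resolve_right y.2
    have hinj : Function.Injective (P.domRestrict r) := by
      intro y y' hyy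
      have h1 : f (y : G) = f (y' : G) := congrArg Subtype.val hyy
      have h2 := hker ((y : G)⁻¹ * y') (by rw [map_mul, map_inv, h1, inv_mul_cancel])
      rcases h2 with h2 | h2
      · exact Subtype.ext (Subtype.ext (inv_mul_eq_one.1 h2))
      · exfalso
        have h3 := hFz y
        rw [← h2, mul_inv_cancel_left, hFP, hFP] at h3
        norm_num at h3
    have hpre : PreconnectedSpace S := isPreconnected_iff_preconnectedSpace.1
      isPreconnected_connectedComponent
    have hPc : IsPreconnected (P.domRestrict r ⁻¹' Set.univ) := by
      refine isPreconnected_univ.preimage_of_isOpenMap hinj hr ?_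
      rintro ⟨h, hh⟩ -
      obtain ⟨y, rfl⟩ := hsurj h
      rcases hsign y hh with h1 | h1
      · exact ⟨⟨⟨y, hh⟩, by change F y ≠ -1; rw [h1]; norm_num⟩, rfl⟩
      · refine ⟨⟨⟨y * z, by change f (y * z) ∈ S; rw [map_mul, hz1, mul_one]; exact hh⟩, ?_⟩, ?_⟩
        · change F (y * z) ≠ -1
          rw [hFz, h1]
          norm_num
        · exact Subtype.ext (by change f (y * z) = f y; rw [map_mul, hz1, mul_one])
    have hval : Continuous fun y : P => ((y : f ⁻¹' S) : G) :=
      continuous_subtype_val.comp continuous_subtype_val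
    refine (hPc.image _ hval.continuousOn).subset_connectedComponent
      ⟨⟨⟨1, by change f 1 ∈ S; rw [map_one]; exact mem_connectedComponent⟩, ?_⟩, trivial, rfl⟩
      ⟨⟨⟨x, hx⟩, ?_⟩, trivial, rfl⟩
    · change F 1 ≠ -1
      rw [hF1]; norm_num
    · change F x ≠ -1
      rw [hFx]; norm_num

end Lift

/-! ### The component group for `Spin(V)` in the two cases -/

section Main

variable {V : Type u} [AddCommGroup V] [Module ℂ V] [FiniteDimensional ℂ V]
variable {Q : QuadraticForm ℂ V} {e : End ℂ V}

theorem exists_unit_vector (hQ : (QuadraticMap.polarBilin Q).Nondegenerate)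
    (hV : 0 < finrank ℂ V) : ∃ v, Q v = 1 := by
  obtain ⟨b, hb, -⟩ := exists_orthonormal_basis hQ
  exact ⟨b ⟨0, hV⟩, hb _⟩

theorem exists_neg_one (e : End ℂ V) {v : V} (hv : Q v = 1) :
    ∃ z : centralizerSpin Q e, ((z : spinGroup Q) : CliffordAlgebra Q) = -1 ∧
      coveringCentralizer Q e z = 1 ∧ z * z = 1 := by
  have hm : Q v * Q (-v) = 1 := by rw [QuadraticMap.map_neg, hv, one_mul]
  have hval : ι Q v * ι Q (-v) = -1 := by rw [map_neg, mul_neg, ι_sq_scalar, hv, map_one]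
  let z : spinGroup Q := ⟨_, ι_mul_ι_mem_spinGroup hm⟩
  have hz : (z : CliffordAlgebra Q) = -1 := hval
  have hzz : z * z = 1 := Subtype.ext (by
    change (z : CliffordAlgebra Q) * z = 1
    rw [hz, neg_mul_neg, one_mul])
  have hcov : covering Q z = 1 := by
    refine soEnd_injective (LinearMap.ext fun w => ?_)
    rw [soEnd_covering, soEnd_one, Module.End.one_apply]
    refine vectorAction_of_eq Q ?_
    rw [hz, star_neg, star_one, neg_mul, neg_mul_neg, one_mul, mul_one]
  refine ⟨⟨z, ?_⟩, hz, Subtype.ext hcov, Subtype.ext hzz⟩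
  change covering Q z ∈ centralizerSO Q e
  rw [hcov]
  exact Subgroup.one_mem _

theorem coveringCentralizer_eq_one {n : ℕ} (hQ : (QuadraticMap.polarBilin Q).Nondegenerate)
    (hV : finrank ℂ V = 2 * n) {x : centralizerSpin Q e} (hx : coveringCentralizer Q e x = 1) :
    ((x : spinGroup Q) : CliffordAlgebra Q) = 1 ∨ ((x : spinGroup Q) : CliffordAlgebra Q) = -1 := by
  obtain ⟨M, -, hM, hM'⟩ := exists_lagrangian hQ hV (L := ⊥) (fun x hx => by
    rw [(Submodule.mem_bot ℂ).1 hx, QuadraticMap.map_zero])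
  obtain ⟨b, w, hb⟩ := exists_hyperbolicBasis hQ hM hM'
  exact hb.covering_eq_one (congrArg Subtype.val hx)

/-- The map of component groups induced by the covering `ρ`. -/
noncomputable def componentCovering (Q : QuadraticForm ℂ V) (e : End ℂ V) :
    componentGroupSpin Q e →* componentGroupSO Q e :=
  QuotientGroup.map _ _ (coveringCentralizer Q e)
    (identityComponent_le_comap (coveringCentralizer_continuous e))

theorem componentCovering_surjective (hQ : (QuadraticMap.polarBilin Q).Nondegenerate) :
    Function.Surjective (componentCovering Q e) := by
  intro y
  obtain ⟨g, rfl⟩ := QuotientGroup.mk_surjective y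
  obtain ⟨x, rfl⟩ := coveringCentralizer_surjective e hQ g
  exact ⟨componentClass x, rfl⟩

theorem componentCovering_eq_one_iff (x : centralizerSpin Q e) :
    componentCovering Q e (componentClass x) = 1 ↔
      coveringCentralizer Q e x ∈ identityComponent (centralizerSO Q e) :=
  QuotientGroup.eq_one_iff _

theorem exists_componentGroup_equiv {n : ℕ} (hQ : (QuadraticMap.polarBilin Q).Nondegenerate)
    (hV : finrank ℂ V = 2 * n) (h : IsSkewNilpotent (QuadraticMap.polarBilin Q) e)
    {a : ℕ} (ha : Even a) (hr : 1 < blockCount e (a + 1)) :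
    ∃ φ : componentGroupSpin Q e ≃* componentGroupSO Q e,
      ∀ x : centralizerSpin Q e,
        φ (componentClass x) = componentClass (coveringCentralizer Q e x) := by
  obtain ⟨u, w, hp⟩ := exists_hyperbolicPair_of_blockCount h ha hr
  obtain ⟨z, hz, hz1⟩ := neg_one_mem_identityComponent_of_hyperbolicPair h ha hp
  have hker : (coveringCentralizer Q e).ker ≤ identityComponent (centralizerSpin Q e) := by
    intro x hx
    rcases coveringCentralizer_eq_one hQ hV hx with h1 | h1
    · have : x = 1 := Subtype.ext (Subtype.ext h1)
      rw [this]
      exact Subgroup.one_mem _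
    · have : x = z := Subtype.ext (Subtype.ext (h1.trans hz1.symm))
      rwa [this]
  have hinj : Function.Injective (componentCovering Q e) := by
    rw [injective_iff_map_eq_one]
    intro y hy
    obtain ⟨x, rfl⟩ := QuotientGroup.mk_surjective y
    rw [QuotientGroup.eq_one_iff]
    exact comap_identityComponent_le (coveringCentralizer_continuous e)
      (coveringCentralizer_isOpenMap e hQ) (coveringCentralizer_surjective e hQ) hker
      ((componentCovering_eq_one_iff x).1 hy)
  exact ⟨MulEquiv.ofBijective (componentCovering Q e) ⟨hinj, componentCovering_surjective hQ⟩,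
    fun x => rfl⟩

/-- If all odd block sizes have multiplicity at most one, the elements of `Spin` over the identity
component of the centralizer act on the vacuum of a suitable Lagrangian by a sign. -/
theorem exists_sign_functional {n : ℕ} (hQ : (QuadraticMap.polarBilin Q).Nondegenerate)
    (hV : finrank ℂ V = 2 * n) (h : IsSkewNilpotent (QuadraticMap.polarBilin Q) e)
    (hodd : ∀ a, Even a → blockCount e (a + 1) ≤ 1) :
    ∃ F : CliffordAlgebra Q →ₗ[ℂ] ℂ, F 1 = 1 ∧ ∀ x : centralizerSpin Q e,
      coveringCentralizer Q e x ∈ identityComponent (centralizerSO Q e) →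
        F (x : spinGroup Q) = 1 ∨ F (x : spinGroup Q) = -1 := by
  obtain ⟨N, hN⟩ := h.nil
  obtain ⟨M, hLM, hM, hM'⟩ := exists_lagrangian hQ hV (L := coreSum e N) (fun x hx => by
    rw [quadratic_eq_half_polar, coreSum_isotropic h N x hx x hx, zero_div])
  obtain ⟨b, w, hb⟩ := exists_hyperbolicBasis hQ hM hM'
  obtain ⟨ℓ, hℓ⟩ : ∃ ℓ : CliffordAlgebra Q →ₗ[ℂ] ℂ, ℓ (vacuum Q fun i => (b i : V)) = 1 := by
    have h1 := (forall_dual_apply_eq_zero_iff ℂ (vacuum Q fun i => (b i : V))).not.2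
      hb.vacuum_ne_zero
    push Not at h1
    obtain ⟨φ, hφ⟩ := h1
    exact ⟨(φ (vacuum Q fun i => (b i : V)))⁻¹ • φ, by
      rw [LinearMap.smul_apply, smul_eq_mul, inv_mul_cancel₀ hφ]⟩
  -- The functional is `x ↦ ℓ (x ω)` with `ℓ ω = 1`; it reads off the sign in `x ω = ± ω`.
  refine ⟨ℓ ∘ₗ LinearMap.mulRight ℂ (vacuum Q fun i => (b i : V)), by simp [hℓ], fun x hx => ?_⟩
  have hd := (mem_identityComponent_iff h _).1 hx
  have hiso := isCentIsometry_toEnd (coveringCentralizer Q e x)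
  have hcay := (mem_cayleyMonoid_iff h hiso).2 hd
  set g := soEnd ((coveringCentralizer Q e x : centralizerSO Q e) : SO Q) with hg
  -- As `M` is isotropic and contains the core, it is orthogonal to the core.
  have hgM : ∀ v ∈ M, g v - v ∈ coreSum e N := fun v hv =>
    sub_mem_coreSum_of_mem_cayleyMonoid h hN hodd hcay fun y hy => by
      change QuadraticMap.polar Q y v = 0
      rw [QuadraticMap.polar, hM _ (M.add_mem (hLM hy) hv), hM y (hLM hy), hM v hv]
      simp
  have hstab : ∀ v ∈ M, g v ∈ M := fun v hv => by
    rw [← sub_add_cancel (g v) v]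
    exact M.add_mem (hLM (hgM v hv)) hv
  have hdet : detOn g M = 1 := by
    rw [detOn_eq_of_sub_mem hLM (coreSum_stable hiso.comm N) hgM, detOn_coreSum hiso.comm hd]
  rcases spin_mul_vacuum hM hb (x := (x : spinGroup Q)) hstab hdet with h1 | h1
  · left
    rw [LinearMap.comp_apply, LinearMap.mulRight_apply, h1, hℓ]
  · right
    rw [LinearMap.comp_apply, LinearMap.mulRight_apply, h1, map_neg, hℓ]

theorem exists_exact_sequence {n : ℕ} (hn : 0 < n)
    (hQ : (QuadraticMap.polarBilin Q).Nondegenerate)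
    (hV : finrank ℂ V = 2 * n) (h : IsSkewNilpotent (QuadraticMap.polarBilin Q) e)
    (hodd : ∀ a, Even a → blockCount e (a + 1) ≤ 1) :
    ∃ (i : ℤˣ →* componentGroupSpin Q e) (p : componentGroupSpin Q e →* componentGroupSO Q e),
      (∀ u : ℤˣ, ∃ x : centralizerSpin Q e,
        ((x : spinGroup Q) : CliffordAlgebra Q) = ((u : ℤ) : CliffordAlgebra Q) ∧
          i u = componentClass x) ∧
      (∀ x : centralizerSpin Q e,
        p (componentClass x) = componentClass (coveringCentralizer Q e x)) ∧
      Function.Injective i ∧ i.range = p.ker ∧ Function.Surjective p := by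
  obtain ⟨v, hv⟩ := exists_unit_vector hQ (by omega)
  obtain ⟨z, hz, hz1, hzz⟩ := exists_neg_one e hv
  obtain ⟨F, hF1, hF⟩ := exists_sign_functional hQ hV h hodd
  obtain ⟨hzn, hmem⟩ := mem_identityComponent_of_sign (coveringCentralizer_isOpenMap e hQ)
    (coveringCentralizer_continuous e) (coveringCentralizer_surjective e hQ) hz1
    (fun x hx => (coveringCentralizer_eq_one hQ hV hx).imp
      (fun h1 => Subtype.ext (Subtype.ext h1))
      (fun h1 => Subtype.ext (Subtype.ext (h1.trans hz.symm))))
    (F := fun x => F (x : spinGroup Q))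
    ((spin_continuous_functional F).comp continuous_subtype_val) hF1
    (fun x => by
      change F (((x : spinGroup Q) : CliffordAlgebra Q) * ((z : spinGroup Q) : CliffordAlgebra Q)) = _
      rw [hz, mul_neg, mul_one, map_neg])
    hF
  let s : ℤˣ →* centralizerSpin Q e := MonoidHom.mk' (fun u => if u = 1 then 1 else z) (by
    intro u t
    rcases Int.units_eq_one_or u with rfl | rfl <;> rcases Int.units_eq_one_or t with rfl | rfl <;>
      simp [hzz])
  have hs1 : s 1 = 1 := map_one s
  have hs2 : s (-1) = z := by simp [s]
  refine ⟨(QuotientGroup.mk' _).comp s, componentCovering Q e, fun u => ⟨s u, ?_, rfl⟩,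
    fun x => rfl, ?_, ?_, componentCovering_surjective hQ⟩
  · rcases Int.units_eq_one_or u with rfl | rfl
    · rw [hs1]; simp
    · rw [hs2, hz]; simp
  · rw [injective_iff_map_eq_one]
    intro u hu
    rcases Int.units_eq_one_or u with rfl | rfl
    · rfl
    · rw [MonoidHom.comp_apply, hs2] at hu
      exact absurd ((QuotientGroup.eq_one_iff z).1 hu) hzn
  · ext y
    constructor
    · rintro ⟨u, rfl⟩
      rw [MonoidHom.mem_ker]
      refine (componentCovering_eq_one_iff (s u)).2 ?_
      rcases Int.units_eq_one_or u with rfl | rfl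
      · rw [hs1, map_one]
        exact Subgroup.one_mem _
      · rw [hs2, hz1]
        exact Subgroup.one_mem _
    -- An element `x` of the kernel lies over the identity component, so `F x` is a sign: for `F x =
    -- 1` its class is trivial, and for `F x = -1` the product `z * x` has sign `1`, so `x` has the
    -- class of `z`.
    · obtain ⟨x, rfl⟩ := QuotientGroup.mk_surjective y
      intro hy
      have hx := (componentCovering_eq_one_iff x).1 hy
      rcases hF x hx with h1 | h1
      · refine ⟨1, ?_⟩
        rw [map_one]
        exact ((QuotientGroup.eq_one_iff x).2 (hmem x hx h1)).symm
      · refine ⟨-1, ?_⟩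
        rw [MonoidHom.comp_apply, hs2]
        refine QuotientGroup.eq.2 ?_
        have hzi : z⁻¹ = z := inv_eq_of_mul_eq_one_left hzz
        rw [hzi]
        refine hmem _ ?_ ?_
        · rwa [map_mul, hz1, one_mul]
        · change F (((z : spinGroup Q) : CliffordAlgebra Q) * ((x : spinGroup Q) : CliffordAlgebra Q)) = 1
          rw [hz, neg_mul, one_mul, map_neg, h1, neg_neg]

end Main

end SpinOrbit

open Module SpinOrbit in
theorem proposition5p2 {V : Type*} [AddCommGroup V] [Module ℂ V] [FiniteDimensional ℂ V]
    (n : ℕ) (hn : 0 < n) (hV : finrank ℂ V = 2 * n)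
    (Q : QuadraticForm ℂ V) (hQ : (QuadraticMap.polarBilin Q).Nondegenerate)
    (e : End ℂ V) (he : e ∈ soAlgebra Q) (hnil : IsNilpotent e) :
    (0 < numOddSizes e →
      Nonempty (componentGroupSO Q e ≃*
        (Fin (numOddSizes e - 1) → Multiplicative (ZMod 2)))) ∧
    (numOddSizes e = 0 → Subsingleton (componentGroupSO Q e)) ∧
    ((∃ k : ℕ, 1 < blockCount e (2 * k + 1)) →
      ∃ φ : componentGroupSpin Q e ≃* componentGroupSO Q e,
        ∀ x : centralizerSpin Q e,
          φ (componentClass x) = componentClass (coveringCentralizer Q e x)) ∧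
    ((∀ k : ℕ, blockCount e (2 * k + 1) ≤ 1) →
      ∃ (i : ℤˣ →* componentGroupSpin Q e)
        (p : componentGroupSpin Q e →* componentGroupSO Q e),
        (∀ u : ℤˣ, ∃ x : centralizerSpin Q e,
          ((x : spinGroup Q) : CliffordAlgebra Q) = ((u : ℤ) : CliffordAlgebra Q) ∧
            i u = componentClass x) ∧
        (∀ x : centralizerSpin Q e,
          p (componentClass x) = componentClass (coveringCentralizer Q e x)) ∧
        Function.Injective i ∧ i.range = p.ker ∧ Function.Surjective p) := by
  have h := isSkewNilpotent_of_mem_soAlgebra hQ he hnil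
  refine ⟨componentGroupSO_equiv h, subsingleton_componentGroupSO h, ?_, fun hodd => ?_⟩
  · rintro ⟨k, hk⟩
    exact exists_componentGroup_equiv hQ hV h (even_two_mul k) hk
  · refine exists_exact_sequence hn hQ hV h ?_
    rintro a ⟨k, rfl⟩
    rw [← two_mul]
    exact hodd k
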